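/- \textbf{Model.} Fix integers $K,L\ge 1$, a real $M>0$, and probability distributions $D,D'$ on $\mathbb{R}_+$. There are $n$ students and $m=Mn$ universities ($n$ ranging over the positive integers for which $Mn$ is an integer), each university with capacity $L$. The students' preference orders over the universities are independent and uniformly random. Given these, each university independently observes for every student a signal, drawn from $D$ if the university is the student's favourite and from $D'$ otherwise, and ranks the students in decreasing order of signal (equal signals are ordered by an independent uniformly random tie-breaking order). In student-proposing deferred acceptance every student applies, as long as she is rejected, to the next university on her list, up to $K$ applications; every university holds the best $L$ applicants it has received and rejects the others. Let $g(x,M,L)$ be the expected number of accepted proposals when $x$ proposals are made, each to one of the $Mn$ universities chosen independently and uniformly at random, and every university accepts its best $L$ proposals. For real $x\ge 0$ this is read in either of two ways: (a) the exact expectation for integers $x$, extended linearly between consecutive integers; (b) the Poisson form $g(x,M,L)=Mn\,\mathbb{E}[\min(L,N)]$ with $N\sim\mathrm{Poisson}(x/(Mn))$, which for $L=1$ is $Mn(1-e^{-x/(Mn)})$. \textbf{Proposition.} Suppose $D=D'$ (so that the universities' preferences are uniformly random). Under either reading of $g$ the following hold. (1) For every $n\ge 1$ with $Mn$ an integer,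 the equation $$\frac{g(x,M,L)}{n}=1-\Bigl(1-\frac{g(x,M,L)}{x}\Bigr)^K$$ has exactly one solution $x=x_n$ in $(0,\infty)$. (2) Let $X_n$ be the expected total number of applications sent in student-proposing deferred acceptance. As $n\to\infty$ with $K,L,M,D$ fixed, $|X_n-x_n|=o(n)$. (3) Let $\phi_n$ be the (random) fraction of students who are matched to their first choice by student-proposing deferred acceptance. Both for $y_n=x_n$ and for $y_n=X_n$, we have $\mathbb{E}[\phi_n]=g(y_n,M,L)/y_n+o(1)$, and for every $\varepsilon>0$, $\;|\phi_n-g(y_n,M,L)/y_n|\le\varepsilon$ with probability $1-o(1)$. -/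

import Mathlib

open scoped NNReal

noncomputable section

/-- The data of a market with `n` students and `m` universities.
`studentRank s u` is the position of `u` in the preference list of `s` (`0` is the favourite),
`signal u s` is the signal that `u` observes about `s`, and `tieBreak u` is the order in which
`u` ranks students with equal signals. -/
structure Market (n m : ℕ) where
  studentRank : Fin n → Equiv.Perm (Fin m)
  signal : Fin m → Fin n → ℝ≥0
  tieBreak : Fin m → Equiv.Perm (Fin n)

namespace Market

variable {n m : ℕ}

/-- University `u` prefers student `s` to student `t`: decreasing order of signal, ties broken
by `tieBreak u`. -/
def Prefers (I : Market n m) (u : Fin m) (s t : Fin n) : Prop :=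
  I.signal u t < I.signal u s ∨
    (I.signal u s = I.signal u t ∧ I.tieBreak u s < I.tieBreak u t)

/-- A state of the algorithm records for each student how many rejections she has received.
In state `p` student `s` is proposing to (or held by) `u` if `u` is the next entry of her list
and is among her `K` favourites. -/
def ProposesTo (I : Market n m) (K : ℕ) (p : Fin n → ℕ) (s : Fin n) (u : Fin m) : Prop :=
  (I.studentRank s u : ℕ) = p s ∧ p s < K

open Classical in
/-- In state `p` student `s` is rejected: she is at a university `u` at which at least `L` of the
present students are preferred to her. -/
def Rejected (I : Market n m) (K L : ℕ) (p : Fin n → ℕ) (s : Fin n) : Prop :=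
  ∃ u, I.ProposesTo K p s u ∧
    L ≤ (Finset.univ.filter fun t => I.ProposesTo K p t u ∧ I.Prefers u t s).card

open Classical in
/-- One round of student-proposing deferred acceptance: every university keeps the (at most) `L`
best students present and rejects the others, who move on to the next university. -/
def daStep (I : Market n m) (K L : ℕ) (p : Fin n → ℕ) : Fin n → ℕ :=
  fun s => if I.Rejected K L p s then p s + 1 else p s

/-- The final state. A round without rejection is stationary, and at most `n * K` rejections can
ever occur, so after `n * K` rounds the algorithm has terminated. -/
def daFinal (I : Market n m) (K L : ℕ) : Fin n → ℕ :=
  (I.daStep K L)^[n * K] (fun _ => 0)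

open Classical in
/-- Total number of applications (proposals) sent during student-proposing deferred acceptance:
`s` has applied to the first `daFinal s + 1` universities on her list, but to at most `K`. -/
def totalApplications (I : Market n m) (K L : ℕ) : ℕ :=
  ∑ s, (Finset.univ.filter fun u : Fin m =>
    (I.studentRank s u : ℕ) ≤ I.daFinal K L s ∧ (I.studentRank s u : ℕ) < K).card

open Classical in
/-- Number of students matched to their favourite university by student-proposing deferred
acceptance (at termination the match of `s` is the university she is held by). -/
def numFirstChoice (I : Market n m) (K L : ℕ) : ℕ :=
  (Finset.univ.filter fun s : Fin n =>
    ∃ u, (I.studentRank s u : ℕ) = 0 ∧ I.ProposesTo K (I.daFinal K L) s u).card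

/-- Law of the signals given the students' preferences: all signals are independent; `u` draws a
signal from `D` for a student whose favourite is `u`, and from `D'` for every other student. -/
def signalLaw (D D' : MeasureTheory.Measure ℝ≥0) (r : Fin n → Equiv.Perm (Fin m)) :
    MeasureTheory.Measure (Fin m → Fin n → ℝ≥0) :=
  MeasureTheory.Measure.pi fun u => MeasureTheory.Measure.pi fun s =>
    if (r s u : ℕ) = 0 then D else D'

/-- Expectation in the random market: the students' preference lists are independent and uniform,
the tie-breaking orders are independent and uniform, and, given the preference lists, the signals
have law `signalLaw D D'`. -/
def expectation (D D' : MeasureTheory.Measure ℝ≥0) (n m : ℕ) (F : Market n m → ℝ) : ℝ :=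
  Finset.expect Finset.univ fun r : Fin n → Equiv.Perm (Fin m) =>
    Finset.expect Finset.univ fun b : Fin m → Equiv.Perm (Fin n) =>
      ∫ v, F ⟨r, v, b⟩ ∂(signalLaw D D' r)

open Classical in
/-- Probability of an event in the random market. -/
def probability (D D' : MeasureTheory.Measure ℝ≥0) (n m : ℕ) (A : Market n m → Prop) : ℝ :=
  expectation D D' n m fun I => if A I then 1 else 0

end Market

/-- Expected number of accepted proposals when `k` proposals are made, each to one of `m`
universities chosen independently and uniformly at random, and each university accepts its `L`
best proposals (all of them if there are fewer). -/
def acceptedNat (m L k : ℕ) : ℝ :=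
  Finset.expect Finset.univ fun f : Fin k → Fin m =>
    ∑ u, ((min L (Finset.univ.filter fun i => f i = u).card : ℕ) : ℝ)

/-- `acceptedNat`, extended linearly between consecutive integers to real numbers `x ≥ 0` of
proposals. -/
def acceptedExact (m L : ℕ) (x : ℝ) : ℝ :=
  (1 - Int.fract x) * acceptedNat m L ⌊x⌋₊ + Int.fract x * acceptedNat m L (⌊x⌋₊ + 1)

/-- The same expectation in its limiting form, where each university receives a Poisson number of
proposals with mean `x / m`; for `L = 1` this is `m * (1 - exp (-x / m))`. -/
def acceptedPoisson (m L : ℕ) (x : ℝ) : ℝ :=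
  m * ∑' k : ℕ, Real.exp (-(x / m)) * (x / m) ^ k / (k.factorial : ℝ) * ((min L k : ℕ) : ℝ)

/-- `x > 0` solves `g(x) / n = 1 - (1 - g(x) / x) ^ K`. -/
def IsConsistent (g : ℝ → ℝ) (n K : ℕ) (x : ℝ) : Prop :=
  0 < x ∧ g x / n = 1 - (1 - g x / x) ^ K

end

/-! Uniqueness. Both readings of g are concave with value 0 at 0, so g(x) is nondecreasing, g(x) ≤ x
and g(x)/x is nonincreasing (`IsAcceptanceCurve`). Hence the defect g(x)/n - 1 + (1 - g(x)/x)^K is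
strictly increasing. With p = g(x)/x, the bounds p ≤ 1 - (1-p)^K ≤ Kp make it negative for x < n and
positive for x > nK, so it has exactly one zero, and that zero lies in [n, nK]. In the exact reading
concavity holds because the gain from one more proposal is the probability that its recipient has
received fewer than L so far, which decreases with the number of proposals.

Asymptotics. If D = D', the universities' rankings are uniform
(`Market.expectation_eq_rankExpectation`). The outcome of deferred acceptance does not depend on the
order of the rejections (`Market.eq_daFinal_of_path`), so applications may be sent one at a time,
each revealing only what it needs: it goes to a uniform university among those the student has not
tried, and its place among the applicants there is uniform
(`ApplicationState.card_agreeing_eq_mul`). Whether the university is her first or a later choice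
does not influence that place.

Let T be the number of applications sent so far, A_k the number of them sent to position k of a
list, λ = T/m, and p_c(λ) the Poisson weights. Typically m p_c(λ) universities have c applicants,
and A_k p_c(λ)/(c+1) universities have c+1 applicants with one from position k at a given place. In
each step the deviations from these values drift by at most O((deviation + 1)/m) on average. So the
sum of their squares obeys a discrete Grönwall inequality (`ApplicationState.nextMean_potential_le`,
`ApplicationState.sum_run_le`) and has mean O(n) after nK steps. The targets use the current random
T and A_k, so this can be evaluated at the end of the algorithm.

Summing over the best L places, the applications to every position k are held at the same rate p =
g(T)/T, up to o(n) in mean (`ApplicationState.exists_expect_abs_numHeld_sub_le`). At the end,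
whoever applied at position k is held there or applied at position k+1; hence A_{k+1} ≈ (1-p) A_k
with A_0 = n, and summing gives pT ≈ n(1 - (1-p)^K). Thus T nearly solves the consistency equation.
By compactness T/n is close to the root τ of the limiting equation, and so is x_n/n, since the two
readings of g differ by O(1) on the relevant range. The case k = 0 gives the first choices. All
errors are bounded in mean absolute value, which yields the statements about expectations directly
and those about probabilities by Markov's inequality. -/

noncomputable section

/-! ### Poisson weights, acceptance curves and the unique solution of the consistency equation. -/

/-- Shift of a sequence by one place to the right, with value `0` at `0`. -/
def shiftSeq (b : ℕ → ℝ) : ℕ → ℝ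
  | 0 => 0
  | c + 1 => b c

@[simp] lemma shiftSeq_zero (b : ℕ → ℝ) : shiftSeq b 0 = 0 := rfl

@[simp] lemma shiftSeq_succ (b : ℕ → ℝ) (c : ℕ) : shiftSeq b (c + 1) = b c := rfl

/-- The Poisson weight `exp (-x) * x ^ c / c!`. -/
def poissonWeight (c : ℕ) (x : ℝ) : ℝ := Real.exp (-x) * x ^ c / (c.factorial : ℝ)

lemma poissonWeight_nonneg (c : ℕ) {x : ℝ} (hx : 0 ≤ x) : 0 ≤ poissonWeight c x := by
  unfold poissonWeight; positivity

lemma poissonWeight_pos (c : ℕ) {x : ℝ} (hx : 0 < x) : 0 < poissonWeight c x := by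
  unfold poissonWeight; positivity

lemma hasSum_poissonWeight (x : ℝ) : HasSum (fun c => poissonWeight c x) 1 := by
  have h := (NormedSpace.expSeries_div_hasSum_exp x).mul_left (Real.exp (-x))
  rw [← Real.exp_eq_exp_ℝ, ← Real.exp_add, neg_add_cancel, Real.exp_zero] at h
  refine h.congr_fun ?_ |> fun h => h
  intro c
  simp [poissonWeight, mul_div_assoc]

lemma sum_poissonWeight_le_one (s : Finset ℕ) {x : ℝ} (hx : 0 ≤ x) :
    ∑ c ∈ s, poissonWeight c x ≤ 1 :=
  sum_le_hasSum s (fun c _ => poissonWeight_nonneg c hx) (hasSum_poissonWeight x)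

lemma poissonWeight_le_one (c : ℕ) {x : ℝ} (hx : 0 ≤ x) : poissonWeight c x ≤ 1 := by
  simpa using sum_poissonWeight_le_one {c} hx

lemma poissonWeight_zero_zero : poissonWeight 0 0 = 1 := by simp [poissonWeight]

lemma poissonWeight_succ_zero (c : ℕ) : poissonWeight (c + 1) 0 = 0 := by simp [poissonWeight]

lemma succ_mul_poissonWeight_succ (c : ℕ) (x : ℝ) :
    ((c : ℝ) + 1) * poissonWeight (c + 1) x = x * poissonWeight c x := by
  unfold poissonWeight
  rw [Nat.factorial_succ]
  push_cast
  field_simp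
  ring

lemma shiftSeq_poissonWeight_nonneg (c : ℕ) {x : ℝ} (hx : 0 ≤ x) :
    0 ≤ shiftSeq (fun c => poissonWeight c x) c := by
  cases c with
  | zero => simp
  | succ c => exact poissonWeight_nonneg c hx

lemma shiftSeq_poissonWeight_le_one (c : ℕ) {x : ℝ} (hx : 0 ≤ x) :
    shiftSeq (fun c => poissonWeight c x) c ≤ 1 := by
  cases c with
  | zero => simp
  | succ c => exact poissonWeight_le_one c hx

/-- The forward equation of the Poisson process. `binomialWeight` satisfies the same equation in
discrete time, and `shiftSeq` covers c = 0 without a case split. -/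
lemma hasDerivAt_poissonWeight (c : ℕ) (x : ℝ) :
    HasDerivAt (poissonWeight c) (shiftSeq (fun c => poissonWeight c x) c - poissonWeight c x) x := by
  have h := ((hasDerivAt_neg x).exp.mul (hasDerivAt_pow c x)).div_const (c.factorial : ℝ)
  refine h.congr_deriv ?_
  cases c with
  | zero => simp [poissonWeight]
  | succ c =>
    simp only [shiftSeq_succ, poissonWeight, Nat.factorial_succ]
    push_cast
    field_simp
    ring

/-- The derivative is a difference of two numbers in [0, 1]. -/
lemma abs_poissonWeight_sub_le (c : ℕ) {x y : ℝ} (hx : 0 ≤ x) (hy : 0 ≤ y) :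
    |poissonWeight c y - poissonWeight c x| ≤ |y - x| := by
  have h := Convex.norm_image_sub_le_of_norm_hasDerivWithin_le (f := poissonWeight c)
    (f' := fun x => shiftSeq (fun c => poissonWeight c x) c - poissonWeight c x) (C := 1)
    (s := Set.Ici 0) (fun x _ => (hasDerivAt_poissonWeight c x).hasDerivWithinAt)
    (fun x hx => by
      have hx : 0 ≤ x := hx
      rw [Real.norm_eq_abs, abs_le]
      have := poissonWeight_nonneg c hx
      have := poissonWeight_le_one c hx
      have := shiftSeq_poissonWeight_nonneg c hx
      have := shiftSeq_poissonWeight_le_one c hx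
      constructor <;> linarith) (convex_Ici 0) (x := x) (y := y) hx hy
  simpa using h

lemma abs_shiftSeq_poissonWeight_sub_le (c : ℕ) {x y : ℝ} (hx : 0 ≤ x) (hy : 0 ≤ y) :
    |shiftSeq (fun c => poissonWeight c y) c - shiftSeq (fun c => poissonWeight c x) c|
      ≤ |y - x| := by
  cases c with
  | zero => simp
  | succ c => exact abs_poissonWeight_sub_le c hx hy

/-- Second order Taylor estimate for the Poisson weights. -/
lemma abs_poissonWeight_taylor_le (c : ℕ) {x h : ℝ} (hx : 0 ≤ x) (hh : 0 ≤ h) :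
    |poissonWeight c (x + h) - poissonWeight c x
      - h * (shiftSeq (fun c => poissonWeight c x) c - poissonWeight c x)| ≤ 2 * h ^ 2 := by
  set d := shiftSeq (fun c => poissonWeight c x) c - poissonWeight c x with hd
  -- Mean value inequality for the function minus its tangent at x: the derivative is a difference
  -- of two 1-Lipschitz functions, so it deviates from d by at most 2h.
  have key := Convex.norm_image_sub_le_of_norm_hasDerivWithin_le
    (f := fun y => poissonWeight c y - y * d)
    (f' := fun y => (shiftSeq (fun c => poissonWeight c y) c - poissonWeight c y) - 1 * d)
    (C := 2 * h) (s := Set.Icc x (x + h))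
    (fun y _ => ((hasDerivAt_poissonWeight c y).sub
      ((hasDerivAt_id y).mul_const d)).hasDerivWithinAt)
    (fun y hy => by
      have hy0 : 0 ≤ y := hx.trans hy.1
      have h1 := abs_poissonWeight_sub_le c hx hy0
      have h2 := abs_shiftSeq_poissonWeight_sub_le c hx hy0
      have h3 : |y - x| ≤ h := by
        rw [abs_of_nonneg (by linarith [hy.1])]; linarith [hy.2]
      rw [abs_le] at h1 h2
      rw [Real.norm_eq_abs, abs_le, hd]
      constructor <;> linarith [h1.1, h1.2, h2.1, h2.2])
    (convex_Icc _ _) (x := x) (y := x + h) (by simp [hh]) (by simp [hh])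
  simp only [Real.norm_eq_abs, add_sub_cancel_left, abs_of_nonneg hh] at key
  calc _ = |poissonWeight c (x + h) - (x + h) * d - (poissonWeight c x - x * d)| := by
        congr 1; ring
    _ ≤ 2 * h * h := key
    _ = _ := by ring

/-- The probability that a Poisson variable exceeds `l`. -/
def poissonTail (l : ℕ) (x : ℝ) : ℝ := 1 - ∑ c ∈ Finset.range (l + 1), poissonWeight c x

lemma hasDerivAt_poissonTail (l : ℕ) (x : ℝ) :
    HasDerivAt (poissonTail l) (poissonWeight l x) x := by
  have h := (hasDerivAt_const x (1 : ℝ)).sub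
    (HasDerivAt.fun_sum (u := Finset.range (l + 1)) fun c _ => hasDerivAt_poissonWeight c x)
  refine h.congr_deriv ?_
  clear h
  induction l with
  | zero => simp
  | succ l ih =>
    rw [Finset.sum_range_succ]
    simp only [shiftSeq_succ]
    linarith

lemma hasSum_poissonTail (l : ℕ) (x : ℝ) :
    HasSum (fun c => poissonWeight c x * if l < c then 1 else 0) (poissonTail l x) := by
  have h1 : HasSum (fun c => if c ∈ Finset.range (l + 1) then poissonWeight c x else 0)
      (∑ c ∈ Finset.range (l + 1), poissonWeight c x) := by
    have := hasSum_sum_of_ne_finset_zero (s := Finset.range (l + 1))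
      (f := fun c => if c ∈ Finset.range (l + 1) then poissonWeight c x else 0)
      (L := SummationFilter.unconditional ℕ)
      (fun c hc => if_neg hc)
    rwa [Finset.sum_congr rfl fun c hc => if_pos hc] at this
  have h := (hasSum_poissonWeight x).sub h1
  refine h.congr_fun ?_ |> fun h => h
  intro c
  by_cases hc : l < c
  · simp [hc, not_lt.2 (Nat.succ_le_of_lt hc)]
  · simp [hc, Nat.lt_succ_of_le (not_lt.1 hc)]

/-- The expectation of `min L N` for a Poisson variable `N` with mean `x`. -/
def poissonMin (L : ℕ) (x : ℝ) : ℝ := ∑ l ∈ Finset.range L, poissonTail l x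

/-- min L c counts the l < L with l < c, so the expectation is a sum of tails. -/
lemma hasSum_poissonMin (L : ℕ) (x : ℝ) :
    HasSum (fun c => poissonWeight c x * ((min L c : ℕ) : ℝ)) (poissonMin L x) := by
  have h := hasSum_sum (s := Finset.range L) fun l _ => hasSum_poissonTail l x
  refine h.congr_fun ?_ |> fun h => h
  intro c
  rw [← Finset.mul_sum, Finset.sum_boole]
  congr 3
  rw [show (Finset.range L).filter (fun l => l < c) = Finset.range (min L c) by
    ext; simp, Finset.card_range]

lemma acceptedPoisson_eq (m L : ℕ) (x : ℝ) :
    acceptedPoisson m L x = m * poissonMin L (x / m) := by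
  rw [acceptedPoisson, ← (hasSum_poissonMin L (x / m)).tsum_eq]
  rfl

lemma hasDerivAt_poissonMin (L : ℕ) (x : ℝ) :
    HasDerivAt (poissonMin L) (∑ l ∈ Finset.range L, poissonWeight l x) x :=
  HasDerivAt.fun_sum (u := Finset.range L) fun l _ => hasDerivAt_poissonTail l x

lemma continuous_poissonMin (L : ℕ) : Continuous (poissonMin L) :=
  continuous_iff_continuousAt.2 fun x => (hasDerivAt_poissonMin L x).continuousAt

lemma poissonTail_zero_right (l : ℕ) : poissonTail l 0 = 0 := by
  rw [poissonTail, Finset.sum_range_succ']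
  simp [poissonWeight_zero_zero, poissonWeight_succ_zero]

lemma poissonMin_zero_right (L : ℕ) : poissonMin L 0 = 0 :=
  Finset.sum_eq_zero fun l _ => poissonTail_zero_right l

lemma poissonMin_strictMonoOn {L : ℕ} (hL : 1 ≤ L) :
    StrictMonoOn (poissonMin L) (Set.Ici 0) := by
  refine strictMonoOn_of_deriv_pos (convex_Ici 0) (continuous_poissonMin L).continuousOn ?_
  intro x hx
  rw [interior_Ici] at hx
  rw [(hasDerivAt_poissonMin L x).deriv]
  exact Finset.sum_pos (fun l _ => poissonWeight_pos l hx) ⟨0, Finset.mem_range.2 hL⟩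

/-- The derivative of `poissonMin L` is the probability of fewer than L events, hence at most 1. -/
lemma poissonMin_sub_le (L : ℕ) {x y : ℝ} (hx : 0 ≤ x) (hxy : x ≤ y) :
    poissonMin L y - poissonMin L x ≤ y - x := by
  have h : MonotoneOn (fun y => y - poissonMin L y) (Set.Ici 0) := by
    refine monotoneOn_of_deriv_nonneg (convex_Ici 0)
      (continuous_id.sub (continuous_poissonMin L)).continuousOn
      (fun z _ => ((hasDerivAt_id z).sub
        (hasDerivAt_poissonMin L z)).differentiableAt.differentiableWithinAt) ?_
    intro z hz
    rw [interior_Ici] at hz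
    rw [((hasDerivAt_id' z).fun_sub (hasDerivAt_poissonMin L z)).deriv]
    exact sub_nonneg.2 (sum_poissonWeight_le_one _ (le_of_lt hz))
  have := h (Set.mem_Ici.2 hx) (Set.mem_Ici.2 (hx.trans hxy)) hxy
  simp only at this
  linarith

lemma poissonMin_le_self (L : ℕ) {x : ℝ} (hx : 0 ≤ x) : poissonMin L x ≤ x := by
  have := poissonMin_sub_le L le_rfl hx
  rw [poissonMin_zero_right] at this
  linarith

lemma poissonMin_concaveOn {L : ℕ} (hL : 1 ≤ L) : ConcaveOn ℝ (Set.Ici 0) (poissonMin L) := by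
  have hd : deriv (poissonMin L) = fun x => 1 - poissonTail (L - 1) x := by
    ext x
    rw [(hasDerivAt_poissonMin L x).deriv, poissonTail, Nat.sub_add_cancel hL]
    ring
  refine AntitoneOn.concaveOn_of_deriv (convex_Ici 0) (continuous_poissonMin L).continuousOn
    (fun x _ => (hasDerivAt_poissonMin L x).differentiableAt.differentiableWithinAt) ?_
  rw [interior_Ici, hd]
  have h : MonotoneOn (poissonTail (L - 1)) (Set.Ici 0) := by
    refine monotoneOn_of_deriv_nonneg (convex_Ici 0)
      (fun x _ => (hasDerivAt_poissonTail _ x).continuousAt.continuousWithinAt)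
      (fun x _ => (hasDerivAt_poissonTail _ x).differentiableAt.differentiableWithinAt) ?_
    intro x hx
    rw [interior_Ici] at hx
    rw [(hasDerivAt_poissonTail _ x).deriv]
    exact poissonWeight_nonneg _ (le_of_lt hx)
  intro x hx y hy hxy
  exact sub_le_sub_left (h (Set.mem_Ici.2 (le_of_lt hx)) (Set.mem_Ici.2 (le_of_lt hy)) hxy) 1

/-- The properties of the expected number of accepted proposals, as a function of the number of
proposals, that make the consistency equation uniquely solvable. -/
structure IsAcceptanceCurve (g : ℝ → ℝ) : Prop where
  pos : ∀ x, 0 < x → 0 < g x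
  le_self : ∀ x, 0 < x → g x ≤ x
  mono : MonotoneOn g (Set.Ioi 0)
  anti : AntitoneOn (fun x => g x / x) (Set.Ioi 0)
  cont : ContinuousOn g (Set.Ioi 0)

/-- A concave function vanishing at `0` has nonincreasing quotient by the identity. -/
lemma ConcaveOn.antitoneOn_div {g : ℝ → ℝ} (hg : ConcaveOn ℝ (Set.Ici 0) g) (h0 : g 0 = 0) :
    AntitoneOn (fun x => g x / x) (Set.Ioi 0) := by
  intro x hx y hy hxy
  have hx : 0 < x := hx
  have hy : 0 < y := hy
  have h := hg.2 (Set.mem_Ici.2 hy.le) (Set.mem_Ici.2 le_rfl) 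
    (show 0 ≤ x / y by positivity) (sub_nonneg.2 ((div_le_one hy).2 hxy)) (add_sub_cancel (x / y) 1)
  simp only [smul_eq_mul, mul_zero, add_zero, h0] at h
  rw [div_mul_cancel₀ x hy.ne'] at h
  rw [div_le_div_iff₀ hy hx]
  calc g y * x = x / y * g y * y := by field_simp
    _ ≤ g x * y := mul_le_mul_of_nonneg_right h hy.le

lemma isAcceptanceCurve_poisson {L : ℕ} (hL : 1 ≤ L) {a : ℝ} (ha : 0 < a) :
    IsAcceptanceCurve (fun x => a * poissonMin L (x / a)) where
  pos x hx := by
    have := poissonMin_strictMonoOn hL (Set.mem_Ici.2 le_rfl)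
      (Set.mem_Ici.2 (div_pos hx ha).le) (div_pos hx ha)
    rw [poissonMin_zero_right] at this
    positivity
  le_self x hx := by
    calc a * poissonMin L (x / a) ≤ a * (x / a) :=
          mul_le_mul_of_nonneg_left (poissonMin_le_self L (div_pos hx ha).le) ha.le
      _ = x := by field_simp
  mono x hx y hy hxy := by
    have hx : 0 < x := hx
    have hy : 0 < y := hy
    exact mul_le_mul_of_nonneg_left ((poissonMin_strictMonoOn hL).monotoneOn
      (Set.mem_Ici.2 (div_pos hx ha).le) (Set.mem_Ici.2 (div_pos hy ha).le)
      (div_le_div_of_nonneg_right hxy ha.le)) ha.le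
  anti x hx y hy hxy := by
    have hx : 0 < x := hx
    have hy : 0 < y := hy
    have := (poissonMin_concaveOn hL).antitoneOn_div (poissonMin_zero_right L)
      (div_pos hx ha) (div_pos hy ha) (div_le_div_of_nonneg_right hxy ha.le)
    simp only [div_div_eq_mul_div] at this
    simpa only [mul_comm a] using this
  cont := (continuous_const.mul
    ((continuous_poissonMin L).comp (continuous_id.div_const a))).continuousOn

/-- The defect in the consistency equation. -/
def consistencyDefect (g : ℝ → ℝ) (n : ℝ) (K : ℕ) (x : ℝ) : ℝ :=
  g x / n - 1 + (1 - g x / x) ^ K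

lemma isConsistent_iff {g : ℝ → ℝ} {n K : ℕ} {x : ℝ} :
    IsConsistent g n K x ↔ 0 < x ∧ consistencyDefect g n K x = 0 := by
  unfold IsConsistent consistencyDefect
  refine and_congr_right fun _ => ⟨fun h => by rw [h]; ring, fun h => by linarith⟩

/-- The upper bound is Bernoulli's inequality. With p = g(x)/x, the two bounds confine the root to
[n, nK]. -/
lemma one_sub_one_sub_pow_bounds {p : ℝ} (hp0 : 0 ≤ p) (hp1 : p ≤ 1) {K : ℕ} (hK : 1 ≤ K) :
    p ≤ 1 - (1 - p) ^ K ∧ 1 - (1 - p) ^ K ≤ K * p := by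
  constructor
  · have : (1 - p) ^ K ≤ (1 - p) ^ 1 :=
      pow_le_pow_of_le_one (by linarith) (by linarith) hK
    linarith
  · have := one_add_mul_le_pow (a := -p) (by linarith) K
    have h2 : 1 + -p = 1 - p := by ring
    rw [h2] at this
    linarith

namespace IsAcceptanceCurve

lemma div_pos {g : ℝ → ℝ} (hg : IsAcceptanceCurve g) {x : ℝ} (hx : 0 < x) : 0 < g x / x := _root_.div_pos (hg.pos x hx) hx

lemma div_le_one {g : ℝ → ℝ} (hg : IsAcceptanceCurve g) {x : ℝ} (hx : 0 < x) : g x / x ≤ 1 := (_root_.div_le_one hx).2 (hg.le_self x hx)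

lemma consistencyDefect_neg {g : ℝ → ℝ} (hg : IsAcceptanceCurve g)
    {n : ℝ} {K : ℕ} (hK : 1 ≤ K) {x : ℝ} (hx : 0 < x)
    (hxn : x < n) : consistencyDefect g n K x < 0 := by
  have h := (one_sub_one_sub_pow_bounds (hg.div_pos hx).le (hg.div_le_one hx) hK).1
  have : g x / n < g x / x := div_lt_div_of_pos_left (hg.pos x hx) hx hxn
  unfold consistencyDefect
  linarith

lemma consistencyDefect_pos {g : ℝ → ℝ} (hg : IsAcceptanceCurve g)
    {n : ℝ} (hn : 0 < n)
    {K : ℕ} (hK : 1 ≤ K) {x : ℝ}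
    (hxn : n * K < x) : 0 < consistencyDefect g n K x := by
  have hK0 : (0 : ℝ) < K := by exact_mod_cast hK
  have hx : 0 < x := (mul_pos hn hK0).trans hxn
  have h := (one_sub_one_sub_pow_bounds (hg.div_pos hx).le (hg.div_le_one hx) hK).2
  have : K * (g x / x) < g x / n := by
    rw [mul_div_assoc', div_lt_div_iff₀ hx hn]
    nlinarith [hg.pos x hx]
  unfold consistencyDefect
  linarith

lemma continuousOn_consistencyDefect {g : ℝ → ℝ} (hg : IsAcceptanceCurve g) (n : ℝ) (K : ℕ) :
    ContinuousOn (consistencyDefect g n K) (Set.Ioi 0) :=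
  ((hg.cont.div_const n).sub continuousOn_const).add
    ((continuousOn_const.sub (hg.cont.div continuousOn_id fun _ hx => ne_of_gt hx)).pow K)

lemma consistencyDefect_strictMonoOn {g : ℝ → ℝ} (hg : IsAcceptanceCurve g)
    {n : ℝ} (hn : 0 < n) {K : ℕ} (hK : 1 ≤ K) :
    StrictMonoOn (consistencyDefect g n K) (Set.Ioi 0) := by
  intro x hx y hy hxy
  have hx : 0 < x := hx
  have hy : 0 < y := hy
  have h1 : g x / n ≤ g y / n := div_le_div_of_nonneg_right (hg.mono hx hy hxy.le) hn.le
  have h2 : g y / y ≤ g x / x := hg.anti hx hy hxy.le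
  have h3 : (1 - g x / x) ^ K ≤ (1 - g y / y) ^ K :=
    pow_le_pow_left₀ (by linarith [hg.div_le_one hx]) (by linarith) K
  have h4 : consistencyDefect g n K x ≤ consistencyDefect g n K y := by
    unfold consistencyDefect; linarith
  -- Both summands are weakly monotone, so equality of the sums forces g x = g y and g x / x = g y /
  -- y, which is impossible for x < y and g y > 0.
  refine lt_of_le_of_ne h4 fun heq => ?_
  unfold consistencyDefect at heq
  have h5 : g x / n = g y / n := by linarith
  have h6 : (1 - g x / x) ^ K = (1 - g y / y) ^ K := by linarith
  have h7 : 1 - g x / x = 1 - g y / y :=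
    (pow_left_inj₀ (by linarith [hg.div_le_one hx]) (by linarith [hg.div_le_one hy])
      (by omega)).1 h6
  have h8 : g x = g y := by field_simp at h5; exact h5
  have h9 : g y / y < g x / x := by
    rw [h8]; exact div_lt_div_of_pos_left (hg.pos y hy) hx hxy
  linarith

lemma exists_consistencyDefect_eq_zero {g : ℝ → ℝ} (hg : IsAcceptanceCurve g)
    {n : ℝ} (hn : 0 < n) {K : ℕ} (hK : 1 ≤ K) :
    ∃ x, 0 < x ∧ consistencyDefect g n K x = 0 := by
  have hK1 : (1 : ℝ) ≤ K := by exact_mod_cast hK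
  have hlt : consistencyDefect g n K (n / 2) < 0 :=
    hg.consistencyDefect_neg hK (by linarith) (by linarith)
  have hgt : 0 < consistencyDefect g n K (n * K + n) :=
    hg.consistencyDefect_pos hn hK (by linarith)
  have hle : n / 2 ≤ n * K + n := by nlinarith
  obtain ⟨x, hx, hx0⟩ := intermediate_value_Icc hle
    ((hg.continuousOn_consistencyDefect n K).mono fun y hy => lt_of_lt_of_le (by linarith) hy.1)
    ⟨hlt.le, hgt.le⟩
  exact ⟨x, lt_of_lt_of_le (by linarith) hx.1, hx0⟩

lemma mem_Icc_of_consistencyDefect_eq_zero {g : ℝ → ℝ} (hg : IsAcceptanceCurve g)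
    {n : ℝ} (hn : 0 < n) {K : ℕ} (hK : 1 ≤ K) {x : ℝ}
    (hx : 0 < x) (h0 : consistencyDefect g n K x = 0) : n ≤ x ∧ x ≤ n * K := by
  constructor
  · by_contra! h
    exact (hg.consistencyDefect_neg hK hx h).ne h0
  · by_contra! h
    exact (hg.consistencyDefect_pos hn hK h).ne' h0

lemma existsUnique_isConsistent {g : ℝ → ℝ} (hg : IsAcceptanceCurve g)
    {n : ℕ} (hn : 1 ≤ n) {K : ℕ} (hK : 1 ≤ K) :
    ∃! x, IsConsistent g n K x := by
  have hn0 : (0 : ℝ) < n := by exact_mod_cast hn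
  obtain ⟨x, hx, hx0⟩ := hg.exists_consistencyDefect_eq_zero hn0 hK
  refine ⟨x, isConsistent_iff.2 ⟨hx, hx0⟩, fun y hy => ?_⟩
  obtain ⟨hy, hy0⟩ := isConsistent_iff.1 hy
  exact (hg.consistencyDefect_strictMonoOn hn0 hK).injOn hy hx (hy0.trans hx0.symm)

end IsAcceptanceCurve

end

/-! ### The exact number of accepted proposals and its Poisson approximation. -/

noncomputable section

/-- The binomial weights with parameters `k` and `1 / m`, by the Pascal recursion. -/
def binomialWeight (m : ℕ) : ℕ → ℕ → ℝ
  | 0, c => if c = 0 then 1 else 0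
  | k + 1, c => binomialWeight m k c
      + (shiftSeq (binomialWeight m k) c - binomialWeight m k c) / m

lemma binomialWeight_nonneg {m : ℕ} (hm : 1 ≤ m) (k c : ℕ) : 0 ≤ binomialWeight m k c := by
  have hm' : (1 : ℝ) ≤ m := by exact_mod_cast hm
  induction k generalizing c with
  | zero => unfold binomialWeight; positivity
  | succ k ih =>
    have h1 : 0 ≤ shiftSeq (binomialWeight m k) c := by
      cases c with
      | zero => simp
      | succ c => exact ih c
    have h2 : binomialWeight m k c / m ≤ binomialWeight m k c := div_le_self (ih c) hm'
    have h3 : 0 ≤ shiftSeq (binomialWeight m k) c / m := by positivity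
    rw [binomialWeight, sub_div]
    linarith

/-- The sum telescopes: a new proposal lifts a university above l only if it had exactly l and is
the one chosen. -/
lemma sum_binomialWeight_succ (m k l : ℕ) :
    ∑ c ∈ Finset.range (l + 1), binomialWeight m (k + 1) c =
      ∑ c ∈ Finset.range (l + 1), binomialWeight m k c - binomialWeight m k l / m := by
  induction l with
  | zero => simp [binomialWeight]; ring
  | succ l ih =>
    rw [Finset.sum_range_succ, ih, Finset.sum_range_succ _ (l + 1), binomialWeight, shiftSeq_succ]
    ring

lemma sum_binomialWeight_antitone {m : ℕ} (hm : 1 ≤ m) {L : ℕ} (hL : 1 ≤ L) :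
    Antitone fun k => ∑ c ∈ Finset.range L, binomialWeight m k c := by
  refine antitone_nat_of_succ_le fun k => ?_
  obtain ⟨l, rfl⟩ : ∃ l, L = l + 1 := ⟨L - 1, by omega⟩
  rw [sum_binomialWeight_succ]
  have := binomialWeight_nonneg hm k l
  have : 0 ≤ binomialWeight m k l / m := by positivity
  linarith

lemma sum_binomialWeight_zero (m : ℕ) {L : ℕ} (hL : 1 ≤ L) :
    ∑ c ∈ Finset.range L, binomialWeight m 0 c = 1 := by
  simp [binomialWeight, Nat.pos_iff_ne_zero.1 hL]

lemma expect_card_fiber_eq {m : ℕ} (hm : 1 ≤ m) (u : Fin m) (k c : ℕ) :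
    (Finset.expect Finset.univ fun f : Fin k → Fin m =>
      if (Finset.univ.filter fun i => f i = u).card = c then (1 : ℝ) else 0)
      = binomialWeight m k c := by
  have hm0 : (m : ℝ) ≠ 0 := by positivity
  have : Nonempty (Fin m) := ⟨u⟩
  induction k generalizing c with
  | zero => simp [binomialWeight, eq_comm]
  | succ k ih =>
    rw [← Fintype.expect_equiv (Fin.consEquiv fun _ => Fin m)
      (fun q : Fin m × (Fin k → Fin m) =>
        if (if q.1 = u then 1 else 0) + (Finset.univ.filter fun i => q.2 i = u).card = c
          then (1 : ℝ) else 0) _ ?_]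
    · rw [← Finset.univ_product_univ, Finset.expect_product]
      have h : ∀ a : Fin m, (Finset.expect Finset.univ fun f : Fin k → Fin m =>
          if (if a = u then 1 else 0) + (Finset.univ.filter fun i => f i = u).card = c
            then (1 : ℝ) else 0) = binomialWeight m k c +
              if a = u then (shiftSeq (binomialWeight m k) c - binomialWeight m k c) else 0 := by
        intro a
        split_ifs with ha
        · rw [add_sub_cancel]
          cases c with
          | zero => simp
          | succ c => simp only [shiftSeq_succ, ← ih c, add_comm 1, add_left_inj]
        · rw [add_zero, ← ih c]; simp
      simp_rw [h]
      rw [binomialWeight, Finset.expect_add_distrib, Finset.expect_const Finset.univ_nonempty,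
        Fintype.expect_eq_sum_div_card]
      simp
    · intro q
      have h : (Finset.univ.filter fun i : Fin (k + 1) =>
          (Fin.cons q.1 q.2 : Fin (k + 1) → Fin m) i = u).card =
          (if q.1 = u then 1 else 0) + (Finset.univ.filter fun i => q.2 i = u).card := by
        rw [Fin.card_filter_univ_succ']
        simp
      rw [← h]
      rfl

lemma acceptedNat_eq {m : ℕ} (hm : 1 ≤ m) (L k : ℕ) :
    acceptedNat m L k = m * ∑ l ∈ Finset.range L,
      (1 - ∑ c ∈ Finset.range (l + 1), binomialWeight m k c) := by
  have : Nonempty (Fin m) := ⟨⟨0, hm⟩⟩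
  have h1 : ∀ N : ℕ, ((min L N : ℕ) : ℝ) =
      ∑ l ∈ Finset.range L, (1 - ∑ c ∈ Finset.range (l + 1), if N = c then (1 : ℝ) else 0) := by
    intro N
    have : ∀ l, (1 - ∑ c ∈ Finset.range (l + 1), if N = c then (1 : ℝ) else 0)
        = if l < N then 1 else 0 := by
      intro l
      by_cases h : l < N <;> simp [h, not_le.2, not_lt.1]
    simp_rw [this]
    rw [Finset.sum_boole, show (Finset.range L).filter (fun l => l < N) = Finset.range (min L N) by
      ext; simp, Finset.card_range]
  unfold acceptedNat
  simp_rw [h1]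
  rw [Finset.expect_sum_comm]
  simp_rw [Finset.expect_sum_comm, Finset.expect_sub_distrib, Finset.expect_sum_comm,
    Finset.expect_const Finset.univ_nonempty]
  have h2 := fun (u : Fin m) c => expect_card_fiber_eq hm u k c
  simp_rw [h2]
  simp [mul_sub]

lemma acceptedNat_zero {m : ℕ} (hm : 1 ≤ m) (L : ℕ) : acceptedNat m L 0 = 0 := by
  rw [acceptedNat_eq hm]
  simp [sum_binomialWeight_zero]

/-- The gain is the probability that the recipient of the next proposal has fewer than L. Its
monotonicity in k is the concavity of `acceptedNat`. -/
lemma acceptedNat_succ_sub {m : ℕ} (hm : 1 ≤ m) (L k : ℕ) :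
    acceptedNat m L (k + 1) - acceptedNat m L k = ∑ c ∈ Finset.range L, binomialWeight m k c := by
  have hm0 : (m : ℝ) ≠ 0 := by positivity
  rw [acceptedNat_eq hm, acceptedNat_eq hm, ← mul_sub, ← Finset.sum_sub_distrib, Finset.mul_sum]
  refine Finset.sum_congr rfl fun l _ => ?_
  rw [sum_binomialWeight_succ]
  field_simp
  ring

/-- The extension of a sequence to the reals that is linear between consecutive integers. -/
def linearExtension (a : ℕ → ℝ) (x : ℝ) : ℝ :=
  (1 - Int.fract x) * a ⌊x⌋₊ + Int.fract x * a (⌊x⌋₊ + 1)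

lemma acceptedExact_eq (m L : ℕ) : acceptedExact m L = linearExtension (acceptedNat m L) := rfl

lemma fract_eq_sub_natFloor {x : ℝ} (hx : 0 ≤ x) : Int.fract x = x - ⌊x⌋₊ := by
  rw [← Int.self_sub_floor, ← natCast_floor_eq_intCast_floor hx]

lemma linearExtension_eq_line (a : ℕ → ℝ) {x : ℝ} (hx : 0 ≤ x) :
    linearExtension a x = a ⌊x⌋₊ + (a (⌊x⌋₊ + 1) - a ⌊x⌋₊) * (x - ⌊x⌋₊) := by
  rw [linearExtension, fract_eq_sub_natFloor hx]; ring

/-- Discrete concavity: the sequence lies below each of its chords between neighbours, extended to a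
line. -/
lemma le_line_of_antitone {a : ℕ → ℝ} (ha : Antitone fun k => a (k + 1) - a k) (j k : ℕ) :
    a j ≤ a k + (a (k + 1) - a k) * ((j : ℝ) - k) := by
  rcases le_total k j with h | h
  · induction j, h using Nat.le_induction with
    | base => simp
    | succ j hj ih =>
      have : a (j + 1) - a j ≤ a (k + 1) - a k := ha hj
      push_cast
      linarith
  · obtain ⟨d, rfl⟩ := Nat.exists_eq_add_of_le h
    clear h
    induction d generalizing j with
    | zero => simp
    | succ d ih =>
      have h1 := ih (j + 1)
      rw [show j + 1 + d = j + (d + 1) by ring] at h1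
      have h2 : a (j + (d + 1) + 1) - a (j + (d + 1)) ≤ a (j + 1) - a j := ha (by omega)
      push_cast at h1 ⊢
      linarith

lemma linearExtension_le_line {a : ℕ → ℝ} (ha : Antitone fun k => a (k + 1) - a k) {x : ℝ}
    (hx : 0 ≤ x) (k : ℕ) : linearExtension a x ≤ a k + (a (k + 1) - a k) * (x - k) := by
  have h1 := le_line_of_antitone ha ⌊x⌋₊ k
  have h2 := le_line_of_antitone ha (⌊x⌋₊ + 1) k
  have h3 := mul_le_mul_of_nonneg_left h1 (sub_nonneg.2 (Int.fract_lt_one x).le)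
  have h4 := mul_le_mul_of_nonneg_left h2 (Int.fract_nonneg x)
  rw [linearExtension]
  refine (add_le_add h3 h4).trans (le_of_eq ?_)
  rw [fract_eq_sub_natFloor hx]
  push_cast
  ring

lemma linearExtension_mono {a : ℕ → ℝ} (ha : Antitone fun k => a (k + 1) - a k)
    (h0 : ∀ k, 0 ≤ a (k + 1) - a k) {x y : ℝ} (hx : 0 ≤ x) (hxy : x ≤ y) :
    linearExtension a x ≤ linearExtension a y := by
  refine (linearExtension_le_line ha hx ⌊y⌋₊).trans ?_
  rw [linearExtension_eq_line a (hx.trans hxy)]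
  have := mul_le_mul_of_nonneg_left (sub_le_sub_right hxy (⌊y⌋₊ : ℝ)) (h0 ⌊y⌋₊)
  linarith

lemma linearExtension_sub_le {a : ℕ → ℝ} (ha : Antitone fun k => a (k + 1) - a k)
    (h1 : ∀ k, a (k + 1) - a k ≤ 1) {x y : ℝ} (hx : 0 ≤ x) (hxy : x ≤ y) :
    linearExtension a y - linearExtension a x ≤ y - x := by
  have h := linearExtension_le_line ha (hx.trans hxy) ⌊x⌋₊
  rw [linearExtension_eq_line a hx]
  have := mul_le_mul_of_nonneg_right (h1 ⌊x⌋₊) (sub_nonneg.2 hxy)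
  linarith

lemma isAcceptanceCurve_linearExtension {a : ℕ → ℝ} (ha : Antitone fun k => a (k + 1) - a k)
    (h0 : ∀ k, 0 ≤ a (k + 1) - a k) (ha0 : a 0 = 0) (ha1 : a 1 = 1) :
    IsAcceptanceCurve (linearExtension a) := by
  have h1 : ∀ k, a (k + 1) - a k ≤ 1 := fun k =>
    (ha (Nat.zero_le k)).trans (by simp [ha0, ha1])
  have hle : ∀ x, 0 < x → linearExtension a x ≤ x := fun x hx => by
    have := linearExtension_le_line ha hx.le 0
    simpa [ha0, ha1] using this
  refine ⟨fun x hx => ?_, hle, fun x hx y _ hxy => linearExtension_mono ha h0 (le_of_lt hx) hxy,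
    fun x hx y hy hxy => ?_, ?_⟩
  -- Positivity by comparison with a point of [0, 1), where the extension is the identity.
  · have h2 : linearExtension a (min x (1 / 2)) = min x (1 / 2) := by
      have h3 : 0 ≤ min x (1 / 2) := by positivity
      have h4 : ⌊min x (1 / 2)⌋₊ = 0 :=
        Nat.floor_eq_zero.2 ((min_le_right _ _).trans_lt (by norm_num))
      rw [linearExtension_eq_line a h3, h4]
      simp [ha0, ha1]
    have h5 := linearExtension_mono ha h0 (x := min x (1 / 2)) (y := x) (by positivity)
      (min_le_left _ _)
    rw [h2] at h5
    exact lt_of_lt_of_le (by positivity) h5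
  · have hx : 0 < x := hx
    have hy : 0 < y := hy
    have h2 := linearExtension_le_line ha hy.le ⌊x⌋₊
    have h3 := linearExtension_eq_line a hx.le
    have h4 := le_line_of_antitone ha 0 ⌊x⌋₊
    rw [ha0, Nat.cast_zero] at h4
    simp only
    rw [div_le_div_iff₀ hy hx]
    set d := a (⌊x⌋₊ + 1) - a ⌊x⌋₊
    -- The value at 0 of the line carrying the linear piece at x. It is nonnegative, since the line
    -- lies above a 0 = 0; this makes the quotient by x nonincreasing.
    set e := a ⌊x⌋₊ + d * (0 - (⌊x⌋₊ : ℝ))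
    have h5 : linearExtension a x = e + d * x := by rw [h3]; ring
    have h6 : linearExtension a y ≤ e + d * y := h2.trans (le_of_eq (by ring))
    calc linearExtension a y * x ≤ (e + d * y) * x := mul_le_mul_of_nonneg_right h6 hx.le
      _ = e * x + d * y * x := by ring
      _ ≤ e * y + d * y * x := by gcongr
      _ = linearExtension a x * y := by rw [h5]; ring
  · have : LipschitzOnWith 1 (linearExtension a) (Set.Ioi 0) := by
      refine LipschitzOnWith.of_le_add_mul 1 fun x hx y hy => ?_
      rw [NNReal.coe_one, one_mul, Real.dist_eq]
      rcases le_total x y with h | h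
      · have := linearExtension_mono ha h0 (le_of_lt hx) h
        linarith [abs_nonneg (x - y)]
      · have := linearExtension_sub_le ha h1 (le_of_lt hy) h
        linarith [le_abs_self (x - y)]
    exact this.continuousOn

lemma acceptedNat_antitone_sub {m : ℕ} (hm : 1 ≤ m) {L : ℕ} (hL : 1 ≤ L) :
    Antitone fun k => acceptedNat m L (k + 1) - acceptedNat m L k := by
  simp_rw [acceptedNat_succ_sub hm]
  exact sum_binomialWeight_antitone hm hL

lemma acceptedNat_one {m : ℕ} (hm : 1 ≤ m) {L : ℕ} (hL : 1 ≤ L) : acceptedNat m L 1 = 1 := by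
  have := acceptedNat_succ_sub hm L 0
  rwa [sum_binomialWeight_zero m hL, acceptedNat_zero hm, sub_zero, zero_add] at this

lemma acceptedNat_sub_nonneg {m : ℕ} (hm : 1 ≤ m) (L k : ℕ) :
    0 ≤ acceptedNat m L (k + 1) - acceptedNat m L k := by
  rw [acceptedNat_succ_sub hm]
  exact Finset.sum_nonneg fun c _ => binomialWeight_nonneg hm k c

lemma acceptedNat_sub_le_one {m : ℕ} (hm : 1 ≤ m) {L : ℕ} (hL : 1 ≤ L) (k : ℕ) :
    acceptedNat m L (k + 1) - acceptedNat m L k ≤ 1 := by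
  refine (acceptedNat_antitone_sub hm hL (Nat.zero_le k)).trans ?_
  simp [acceptedNat_zero hm, acceptedNat_one hm hL]

lemma isAcceptanceCurve_acceptedExact {m : ℕ} (hm : 1 ≤ m) {L : ℕ} (hL : 1 ≤ L) :
    IsAcceptanceCurve (acceptedExact m L) :=
  isAcceptanceCurve_linearExtension (acceptedNat_antitone_sub hm hL)
    (acceptedNat_sub_nonneg hm L) (acceptedNat_zero hm L) (acceptedNat_one hm hL)

lemma isAcceptanceCurve_acceptedPoisson {m : ℕ} (hm : 1 ≤ m) {L : ℕ} (hL : 1 ≤ L) :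
    IsAcceptanceCurve (acceptedPoisson m L) := by
  have := isAcceptanceCurve_poisson hL (a := (m : ℝ)) (by exact_mod_cast hm)
  rwa [← funext fun x => acceptedPoisson_eq m L x] at this

/-- Poisson approximation of the binomial weights. -/
lemma abs_binomialWeight_sub_poissonWeight_le {m : ℕ} (hm : 1 ≤ m) (k c : ℕ) :
    |binomialWeight m k c - poissonWeight c (k / m)| ≤ 2 * k / (m : ℝ) ^ 2 := by
  have hm' : (1 : ℝ) ≤ m := by exact_mod_cast hm
  have hm0 : (m : ℝ) ≠ 0 := by positivity
  induction k generalizing c with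
  | zero => cases c <;> simp [binomialWeight, poissonWeight_zero_zero, poissonWeight_succ_zero]
  | succ k ih =>
    have hx : (0 : ℝ) ≤ k / m := by positivity
    have ht := abs_poissonWeight_taylor_le c hx (h := 1 / m) (by positivity)
    have hs : |shiftSeq (binomialWeight m k) c - shiftSeq (fun c => poissonWeight c (k / m)) c|
        ≤ 2 * k / (m : ℝ) ^ 2 := by
      cases c with
      | zero => simp; positivity
      | succ c => exact ih c
    have hi := ih c
    have hadd : ((k + 1 : ℕ) : ℝ) / m = k / m + 1 / m := by push_cast; ring
    rw [binomialWeight, hadd]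
    set b := binomialWeight m k c
    set b' := shiftSeq (binomialWeight m k) c
    set q := poissonWeight c (k / m)
    set q' := shiftSeq (fun c => poissonWeight c (k / m)) c
    set r := poissonWeight c (k / m + 1 / m)
    have hone : 0 ≤ 1 - 1 / (m : ℝ) := by
      rw [sub_nonneg, div_le_one (by positivity)]; exact hm'
    -- The new error is a convex combination of two old ones minus a Taylor remainder of size 2/m²,
    -- so k steps accumulate at most 2k/m².
    have e : b + (b' - b) / m - r = (1 - 1 / m) * (b - q) + 1 / m * (b' - q')
        - (r - q - 1 / m * (q' - q)) := by ring
    rw [e]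
    calc _ ≤ |(1 - 1 / (m : ℝ)) * (b - q)| + |1 / (m : ℝ) * (b' - q')|
          + |r - q - 1 / m * (q' - q)| :=
          (abs_sub _ _).trans (add_le_add_left (abs_add_le _ _) _)
      _ ≤ (1 - 1 / (m : ℝ)) * (2 * k / (m : ℝ) ^ 2) + 1 / (m : ℝ) * (2 * k / (m : ℝ) ^ 2)
          + 2 * (1 / m) ^ 2 := by
          rw [abs_mul, abs_mul, abs_of_nonneg hone, abs_of_nonneg (show (0 : ℝ) ≤ 1 / m by positivity)]
          gcongr
      _ = _ := by push_cast; field_simp; ring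

lemma abs_acceptedNat_sub_le {m : ℕ} (hm : 1 ≤ m) (L k : ℕ) :
    |acceptedNat m L k - m * poissonMin L (k / m)| ≤ 2 * L ^ 2 * (k / m) := by
  have hm0 : (0 : ℝ) < m := by exact_mod_cast hm
  rw [acceptedNat_eq hm, poissonMin, ← mul_sub, ← Finset.sum_sub_distrib, abs_mul,
    abs_of_pos hm0]
  have h : ∀ l ∈ Finset.range L, |(1 - ∑ c ∈ Finset.range (l + 1), binomialWeight m k c)
      - poissonTail l (k / m)| ≤ L * (2 * k / (m : ℝ) ^ 2) := by
    intro l hl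
    rw [poissonTail, sub_sub_sub_cancel_left, ← Finset.sum_sub_distrib]
    refine (Finset.abs_sum_le_sum_abs _ _).trans ?_
    refine (Finset.sum_le_sum fun c _ => ?_ :
      _ ≤ ∑ c ∈ Finset.range (l + 1), 2 * k / (m : ℝ) ^ 2).trans ?_
    · rw [abs_sub_comm]; exact abs_binomialWeight_sub_poissonWeight_le hm k c
    · rw [Finset.sum_const, Finset.card_range, nsmul_eq_mul]
      gcongr
      exact_mod_cast Finset.mem_range.1 hl
  calc _ ≤ (m : ℝ) * ∑ l ∈ Finset.range L, (L : ℝ) * (2 * k / (m : ℝ) ^ 2) := by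
        gcongr
        exact (Finset.abs_sum_le_sum_abs _ _).trans (Finset.sum_le_sum h)
    _ = 2 * L ^ 2 * (k / m) := by
        rw [Finset.sum_const, Finset.card_range, nsmul_eq_mul]; field_simp

/-- Replacing x by its floor changes either reading by at most 1, whence the summand 2; at integers
the Poisson approximation applies. -/
lemma abs_acceptedExact_sub_acceptedPoisson_le {m : ℕ} (hm : 1 ≤ m) {L : ℕ} (hL : 1 ≤ L) {x : ℝ}
    (hx : 0 ≤ x) :
    |acceptedExact m L x - acceptedPoisson m L x| ≤ 2 * L ^ 2 * (x / m) + 2 := by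
  have hm0 : (0 : ℝ) < m := by exact_mod_cast hm
  set k := ⌊x⌋₊
  have hk : (k : ℝ) ≤ x := Nat.floor_le hx
  have hk1 : x < k + 1 := Nat.lt_floor_add_one x
  have hN := abs_acceptedNat_sub_le hm L k
  have e1 := linearExtension_eq_line (acceptedNat m L) hx
  rw [← acceptedExact_eq] at e1
  have h0 := acceptedNat_sub_nonneg hm L k
  have h1 := acceptedNat_sub_le_one hm hL k
  have hd0 : 0 ≤ (acceptedNat m L (k + 1) - acceptedNat m L k) * (x - k) :=
    mul_nonneg h0 (by linarith)
  have hd1 : (acceptedNat m L (k + 1) - acceptedNat m L k) * (x - k) ≤ 1 :=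
    mul_le_one₀ h1 (by linarith) (by linarith)
  have hP0 : poissonMin L (k / m) ≤ poissonMin L (x / m) :=
    (poissonMin_strictMonoOn hL).monotoneOn (Set.mem_Ici.2 (by positivity))
      (Set.mem_Ici.2 (by positivity)) (by gcongr)
  have hP1 : poissonMin L (x / m) - poissonMin L (k / m) ≤ x / m - k / m :=
    poissonMin_sub_le L (by positivity) (by gcongr)
  have hP0' : 0 ≤ m * (poissonMin L (x / m) - poissonMin L (k / m)) :=
    mul_nonneg hm0.le (by linarith)
  have hP1' : m * (poissonMin L (x / m) - poissonMin L (k / m)) ≤ 1 :=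
    calc _ ≤ m * (x / m - k / m) := by gcongr
      _ = x - k := by field_simp
      _ ≤ 1 := by linarith
  have hkx : 2 * (L : ℝ) ^ 2 * (k / m) ≤ 2 * L ^ 2 * (x / m) := by gcongr
  rw [acceptedPoisson_eq]
  rw [abs_le] at hN ⊢
  constructor <;> linarith [hN.1, hN.2]

end

/-! ### Equal signal laws give uniform rankings. -/

noncomputable section

/-- The permutation ρ⁻¹ followed by τ is an order automorphism of `Fin n`, and there is only the
trivial one. -/
lemma Equiv.Perm.eq_of_lt_iff_lt {n : ℕ} {ρ τ : Equiv.Perm (Fin n)}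
    (h : ∀ s t, ρ s < ρ t ↔ τ s < τ t) : ρ = τ := by
  have hm : StrictMono (ρ.symm.trans τ) := fun a b hab => by
    rw [Equiv.trans_apply, Equiv.trans_apply, ← h]; simpa using hab
  let e : Fin n ≃o Fin n := hm.orderIsoOfSurjective _ (ρ.symm.trans τ).surjective
  ext s
  have h1 : e (ρ s) = ρ s := by rw [Subsingleton.elim e (OrderIso.refl _)]; rfl
  have h2 : e (ρ s) = τ s := by simp [e]
  rw [← h1, h2]

open Classical in
/-- The ranking of the students in decreasing order of signal, with ties broken by `b`. -/
def signalRank {n : ℕ} (v : Fin n → ℝ≥0) (b : Equiv.Perm (Fin n)) (s : Fin n) : Fin n :=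
  ⟨(Finset.univ.filter fun t => v s < v t ∨ (v t = v s ∧ b t < b s)).card, by
    refine lt_of_lt_of_eq (Finset.card_lt_card (t := Finset.univ) ?_) (by simp)
    exact Finset.filter_ssubset.2 ⟨s, Finset.mem_univ _, by simp⟩⟩

lemma signalRank_lt_iff {n : ℕ} (v : Fin n → ℝ≥0) (b : Equiv.Perm (Fin n)) (s t : Fin n) :
    signalRank v b s < signalRank v b t ↔ v t < v s ∨ (v s = v t ∧ b s < b t) := by
  have key : ∀ s t, (v t < v s ∨ (v s = v t ∧ b s < b t)) →
      signalRank v b s < signalRank v b t := by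
    intro s t hst
    refine Fin.mk_lt_mk.2 (Finset.card_lt_card (Finset.ssubset_iff_subset_ne.2 ⟨fun w hw => ?_, fun h => ?_⟩))
    · simp only [Finset.mem_filter, Finset.mem_univ, true_and] at hw ⊢
      rcases hw with hw | ⟨hw, hw'⟩ <;> rcases hst with hst | ⟨hst, hst'⟩
      · exact Or.inl (hst.trans hw)
      · exact Or.inl (hst ▸ hw)
      · exact Or.inl (hw ▸ hst)
      · exact Or.inr ⟨hw.trans hst, hw'.trans hst'⟩
    · have : s ∈ Finset.univ.filter fun w => v t < v w ∨ (v w = v t ∧ b w < b t) := by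
        simpa using hst
      rw [← h] at this
      simp at this
  refine ⟨fun h => ?_, key s t⟩
  by_contra hn
  have hts : (v s < v t ∨ (v t = v s ∧ b t < b s)) ∨ s = t := by
    push Not at hn
    rcases hn.1.lt_or_eq with h1 | h1
    · exact Or.inl (Or.inl h1)
    · rcases (hn.2 h1).lt_or_eq with h2 | h2
      · exact Or.inl (Or.inr ⟨h1.symm, h2⟩)
      · exact Or.inr (b.injective h2.symm)
  rcases hts with hts | rfl
  · exact lt_asymm h (key t s hts)
  · exact lt_irrefl _ h

lemma signalRank_injective {n : ℕ} (v : Fin n → ℝ≥0) (b : Equiv.Perm (Fin n)) :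
    Function.Injective (signalRank v b) := by
  intro s t h
  have h1 := (signalRank_lt_iff v b s t).not.1 h.not_lt
  have h2 := (signalRank_lt_iff v b t s).not.1 h.symm.not_lt
  push Not at h1 h2
  have h3 : v s = v t := le_antisymm h1.1 h2.1
  exact b.injective (le_antisymm (h2.2 h3.symm) (h1.2 h3))

/-- `signalRank` as a permutation. -/
def signalPerm {n : ℕ} (v : Fin n → ℝ≥0) (b : Equiv.Perm (Fin n)) : Equiv.Perm (Fin n) :=
  Equiv.ofBijective _ (Finite.injective_iff_bijective.1 (signalRank_injective v b))

lemma signalPerm_lt_iff {n : ℕ} (v : Fin n → ℝ≥0) (b : Equiv.Perm (Fin n)) (s t : Fin n) :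
    signalPerm v b s < signalPerm v b t ↔ v t < v s ∨ (v s = v t ∧ b s < b t) :=
  signalRank_lt_iff v b s t

/-- Equivariance: renaming the students in signals and tie-breaks renames them in the ranking.
Uniformity of the ranking rests on this. -/
lemma signalPerm_comp {n : ℕ} (v : Fin n → ℝ≥0) (b σ : Equiv.Perm (Fin n)) :
    signalPerm (fun s => v (σ s)) (b * σ) = signalPerm v b * σ :=
  Equiv.Perm.eq_of_lt_iff_lt fun s t => by
    simp only [signalPerm_lt_iff, Equiv.Perm.mul_apply]

lemma measurableSet_signalPerm_eq {n : ℕ} (b ρ : Equiv.Perm (Fin n)) :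
    MeasurableSet {v : Fin n → ℝ≥0 | signalPerm v b = ρ} := by
  have : {v : Fin n → ℝ≥0 | signalPerm v b = ρ} =
      ⋂ s, ⋂ t, {v | (v t < v s ∨ (v s = v t ∧ b s < b t)) ↔ ρ s < ρ t} := by
    ext v
    simp only [Set.mem_ofPred_eq, Set.mem_iInter, ← signalPerm_lt_iff]
    exact ⟨fun h s t => by rw [h], fun h => Equiv.Perm.eq_of_lt_iff_lt h⟩
  rw [this]
  refine MeasurableSet.iInter fun s => MeasurableSet.iInter fun t => ?_
  have h1 : MeasurableSet {v : Fin n → ℝ≥0 | v t < v s} :=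
    measurableSet_lt (measurable_pi_apply t) (measurable_pi_apply s)
  have h2 : MeasurableSet {v : Fin n → ℝ≥0 | v s = v t} :=
    measurableSet_eq_fun (measurable_pi_apply s) (measurable_pi_apply t)
  have h3 := h1.union (h2.inter (MeasurableSet.const (b s < b t)))
  by_cases hc : ρ s < ρ t
  · convert h3 using 1
    ext v
    simp [hc]
  · convert h3.compl using 1
    ext v
    simp [hc]

lemma measurable_comp_signalPerm {n m : ℕ} (b : Fin m → Equiv.Perm (Fin n))
    (G : (Fin m → Equiv.Perm (Fin n)) → ℝ) :
    Measurable fun v : Fin m → Fin n → ℝ≥0 => G fun u => signalPerm (v u) (b u) := by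
  let _ : MeasurableSpace (Fin m → Equiv.Perm (Fin n)) := ⊤
  refine (measurable_from_top (f := G)).comp (measurable_to_countable' fun ρ => ?_)
  have : (fun v : Fin m → Fin n → ℝ≥0 => fun u => signalPerm (v u) (b u)) ⁻¹' {ρ} =
      ⋂ u, (fun v => v u) ⁻¹' {v | signalPerm v (b u) = ρ u} := by
    ext v; simp [funext_iff]
  rw [this]
  exact MeasurableSet.iInter fun u =>
    (measurableSet_signalPerm_eq (b u) (ρ u)).preimage (measurable_pi_apply u)

lemma integrable_comp_signalPerm {n m : ℕ} (b : Fin m → Equiv.Perm (Fin n))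
    (G : (Fin m → Equiv.Perm (Fin n)) → ℝ) (μ : MeasureTheory.Measure (Fin m → Fin n → ℝ≥0))
    [MeasureTheory.IsFiniteMeasure μ] :
    MeasureTheory.Integrable (fun v => G fun u => signalPerm (v u) (b u)) μ := by
  refine MeasureTheory.Integrable.of_bound
    (measurable_comp_signalPerm b G).aestronglyMeasurable (∑ ρ, |G ρ|) (.of_forall fun v => ?_)
  exact Finset.single_le_sum (f := fun ρ => |G ρ|) (fun _ _ => abs_nonneg _)
    (Finset.mem_univ fun u => signalPerm (v u) (b u))

namespace Market

variable {n m : ℕ}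

/-- The market with given rankings on both sides. -/
def ofRanks (r : Fin n → Equiv.Perm (Fin m)) (ρ : Fin m → Equiv.Perm (Fin n)) : Market n m :=
  ⟨r, fun _ _ => 0, ρ⟩

lemma prefers_ofRanks (r : Fin n → Equiv.Perm (Fin m)) (ρ : Fin m → Equiv.Perm (Fin n))
    (u : Fin m) (s t : Fin n) : (ofRanks r ρ).Prefers u s t ↔ ρ u s < ρ u t := by
  simp [ofRanks, Prefers]

/-- The average over all pairs of ranking profiles. -/
def rankExpectation (n m : ℕ) (F : Market n m → ℝ) : ℝ :=
  Finset.expect Finset.univ fun r : Fin n → Equiv.Perm (Fin m) =>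
    Finset.expect Finset.univ fun ρ : Fin m → Equiv.Perm (Fin n) => F (ofRanks r ρ)

/-- Identically distributed independent signals are exchangeable. This is where the equality of the
two signal laws enters. -/
lemma measurePreserving_permute (D : MeasureTheory.Measure ℝ≥0)
    [MeasureTheory.IsProbabilityMeasure D] (σ : Fin m → Equiv.Perm (Fin n)) :
    MeasureTheory.MeasurePreserving (fun (v : Fin m → Fin n → ℝ≥0) u s => v u (σ u s))
      (MeasureTheory.Measure.pi fun _ => MeasureTheory.Measure.pi fun _ => D)
      (MeasureTheory.Measure.pi fun _ => MeasureTheory.Measure.pi fun _ => D) := by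
  refine MeasureTheory.measurePreserving_pi (f := fun u (w : Fin n → ℝ≥0) s => w (σ u s)) _ _
    fun u => ?_
  have h := (MeasureTheory.measurePreserving_piCongrLeft (fun _ : Fin n => D) (σ u).symm)
  convert h using 1
  ext w s
  have := Equiv.piCongrLeft_apply_apply (fun _ : Fin n => ℝ≥0) (σ u).symm w (σ u s)
  rw [Equiv.symm_apply_apply] at this
  rw [← this]
  rfl

/-- The law of the ranking is invariant under right multiplication by every σ. Averaging over σ as
well, the inner average over σ is already uniform for each fixed ranking. -/
lemma expect_integral_signalPerm (D : MeasureTheory.Measure ℝ≥0)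
    [MeasureTheory.IsProbabilityMeasure D] (G : (Fin m → Equiv.Perm (Fin n)) → ℝ) :
    (Finset.expect Finset.univ fun b : Fin m → Equiv.Perm (Fin n) =>
      ∫ v, G (fun u => signalPerm (v u) (b u))
        ∂(MeasureTheory.Measure.pi fun _ : Fin m => MeasureTheory.Measure.pi fun _ : Fin n => D))
      = Finset.expect Finset.univ G := by
  set μ := MeasureTheory.Measure.pi fun _ : Fin m => MeasureTheory.Measure.pi fun _ : Fin n => D
  have h1 : ∀ σ : Fin m → Equiv.Perm (Fin n),
      (Finset.expect Finset.univ fun b : Fin m → Equiv.Perm (Fin n) =>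
        ∫ v, G (fun u => signalPerm (v u) (b u)) ∂μ) =
      Finset.expect Finset.univ fun b : Fin m → Equiv.Perm (Fin n) =>
        ∫ v, G ((fun u => signalPerm (v u) (b u)) * σ) ∂μ := by
    intro σ
    rw [← Fintype.expect_equiv (Equiv.mulRight σ) (fun b : Fin m → Equiv.Perm (Fin n) =>
        ∫ v, G (fun u => signalPerm (v u) ((b * σ) u)) ∂μ) _ (fun b => rfl)]
    refine Finset.expect_congr rfl fun b _ => ?_
    have hp := measurePreserving_permute D σ (n := n) (m := m)
    have hi := MeasureTheory.integral_map (μ := μ) hp.measurable.aemeasurable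
      (measurable_comp_signalPerm (b * σ) G).aestronglyMeasurable
    rw [hp.map_eq] at hi
    rw [hi]
    refine MeasureTheory.integral_congr_ae (.of_forall fun v => ?_)
    simp only [Pi.mul_apply, signalPerm_comp]
    rfl
  have h2 : ∀ ρ : Fin m → Equiv.Perm (Fin n),
      (Finset.expect Finset.univ fun σ => G (ρ * σ)) = Finset.expect Finset.univ G := fun ρ =>
    Fintype.expect_equiv (Equiv.mulLeft ρ) _ _ fun σ => rfl
  calc _ = Finset.expect Finset.univ fun σ : Fin m → Equiv.Perm (Fin n) =>
        Finset.expect Finset.univ fun b : Fin m → Equiv.Perm (Fin n) =>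
          ∫ v, G ((fun u => signalPerm (v u) (b u)) * σ) ∂μ := by
        rw [← Finset.expect_congr rfl fun σ _ => h1 σ,
          Finset.expect_const Finset.univ_nonempty]
    _ = Finset.expect Finset.univ fun b : Fin m → Equiv.Perm (Fin n) =>
          ∫ v, Finset.expect Finset.univ (fun σ => G ((fun u => signalPerm (v u) (b u)) * σ))
            ∂μ := by
        rw [Finset.expect_comm]
        refine Finset.expect_congr rfl fun b _ => ?_
        simp_rw [Fintype.expect_eq_sum_div_card]
        rw [MeasureTheory.integral_div, MeasureTheory.integral_finsetSum]
        exact fun σ _ => integrable_comp_signalPerm b (fun ρ => G (ρ * σ)) μ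
    _ = _ := by
        simp_rw [h2]
        simp [Finset.expect_const Finset.univ_nonempty]

/-- If the signals of favourites have the same law as all others, then the universities' rankings
are uniformly random. -/
lemma expectation_eq_rankExpectation (D : MeasureTheory.Measure ℝ≥0)
    [MeasureTheory.IsProbabilityMeasure D] (F : Market n m → ℝ)
    (hF : ∀ I J : Market n m, I.studentRank = J.studentRank →
      (∀ u s t, I.Prefers u s t ↔ J.Prefers u s t) → F I = F J) :
    expectation D D n m F = rankExpectation n m F := by
  refine Finset.expect_congr rfl fun r _ => ?_
  rw [← expect_integral_signalPerm D fun ρ => F (ofRanks r ρ)]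
  refine Finset.expect_congr rfl fun b _ => ?_
  simp only [signalLaw, ite_self]
  refine MeasureTheory.integral_congr_ae (.of_forall fun v => ?_)
  refine hF _ _ rfl fun u s t => ?_
  rw [prefers_ofRanks, signalPerm_lt_iff]
  rfl

end Market
end

/-! ### Deferred acceptance by rounds and independence of the order of rejections. -/

noncomputable section
namespace Market

variable {n m : ℕ}

lemma Prefers.trans {I : Market n m} {u : Fin m} {s t w : Fin n} (h1 : I.Prefers u s t)
    (h2 : I.Prefers u t w) : I.Prefers u s w := by
  rcases h1 with h1 | ⟨h1, h1'⟩ <;> rcases h2 with h2 | ⟨h2, h2'⟩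
  · exact Or.inl (h2.trans h1)
  · exact Or.inl (h2 ▸ h1)
  · exact Or.inl (h1 ▸ h2)
  · exact Or.inr ⟨h1.trans h2, h1'.trans h2'⟩

lemma not_prefers_self (I : Market n m) (u : Fin m) (s : Fin n) : ¬ I.Prefers u s s := by
  simp [Prefers]

lemma ProposesTo.unique {I : Market n m} {K : ℕ} {p : Fin n → ℕ} {s : Fin n} {u v : Fin m}
    (hu : I.ProposesTo K p s u) (hv : I.ProposesTo K p s v) : u = v :=
  (I.studentRank s).injective (Fin.ext (hu.1.trans hv.1.symm))

/-- No student is rejected in state `p`. -/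
def Settled (I : Market n m) (K L : ℕ) (p : Fin n → ℕ) : Prop := ∀ s, ¬ I.Rejected K L p s

open Classical in
/-- Every university that has rejected a student is proposed to by at least `L` students whom it
prefers. -/
def Justified (I : Market n m) (K L : ℕ) (p : Fin n → ℕ) : Prop :=
  ∀ t u, (I.studentRank t u : ℕ) < p t → (I.studentRank t u : ℕ) < K →
    L ≤ (Finset.univ.filter fun s => I.ProposesTo K p s u ∧ I.Prefers u s t).card

/-- The induction step for order independence: a rejection cannot carry a state past one that is
settled and justified. If s were still at u in q, then L students preferred to her would be at u in
q too, and q would reject her. -/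
lemma Rejected.lt_of_le {I : Market n m} {K L : ℕ} {p q : Fin n → ℕ} {s : Fin n}
    (h : I.Rejected K L p s) (hpq : p ≤ q) (hS : I.Settled K L q) (hJ : I.Justified K L q) :
    p s < q s := by
  classical
  obtain ⟨u, hsu, hcard⟩ := h
  refine lt_of_le_of_ne (hpq s) fun heq => hS s ⟨u, ⟨hsu.1.trans heq, by rw [← heq]; exact hsu.2⟩, ?_⟩
  by_cases hall : ∀ t, I.ProposesTo K p t u ∧ I.Prefers u t s → p t = q t
  · refine hcard.trans (Finset.card_le_card fun t ht => ?_)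
    simp only [Finset.mem_filter, Finset.mem_univ, true_and] at ht ⊢
    have := hall t ht
    exact ⟨⟨this ▸ ht.1.1, this ▸ ht.1.2⟩, ht.2⟩
  -- Some preferred student t has left u by the time of q, so `Justified` supplies L students at u
  -- even better than t.
  · push Not at hall
    obtain ⟨t, ⟨ht, hts⟩, hne⟩ := hall
    have hlt : p t < q t := lt_of_le_of_ne (hpq t) hne
    refine (hJ t u (by rw [ht.1]; exact hlt) (by rw [ht.1]; exact ht.2)).trans
      (Finset.card_le_card fun w hw => ?_)
    simp only [Finset.mem_filter, Finset.mem_univ, true_and] at hw ⊢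
    exact ⟨hw.1, hw.2.trans hts⟩

/-- It suffices that L students better than t at u remain L in number after a round, possibly with
other members. -/
lemma Justified.daStep {I : Market n m} {K L : ℕ} {p : Fin n → ℕ} (hJ : I.Justified K L p) :
    I.Justified K L (I.daStep K L p) := by
  classical
  have key : ∀ t u,
      L ≤ (Finset.univ.filter fun s => I.ProposesTo K p s u ∧ I.Prefers u s t).card →
      L ≤ (Finset.univ.filter fun s =>
        I.ProposesTo K (I.daStep K L p) s u ∧ I.Prefers u s t).card := by
    intro t u hL
    have hkeep : ∀ s, I.ProposesTo K p s u → ¬ I.Rejected K L p s →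
        I.ProposesTo K (I.daStep K L p) s u := fun s hs hr => by
      unfold ProposesTo Market.daStep
      rw [if_neg hr]
      exact hs
    let better : Fin n → Finset (Fin n) := fun x =>
      Finset.univ.filter fun s => I.ProposesTo K p s u ∧ I.Prefers u s x
    -- If some of the better students are rejected, take the best of them, that is, the one with the
    -- fewest better rivals. She is rejected because of at least L students at u, and all of these
    -- stay.
    by_cases hB : ((better t).filter fun s => I.Rejected K L p s).Nonempty
    · obtain ⟨x, hx, hmin⟩ := Finset.exists_min_image _ (fun s => (better s).card) hB
      simp only [better, Finset.mem_filter, Finset.mem_univ, true_and] at hx hmin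
      obtain ⟨v, hxv, hcard⟩ := hx.2
      obtain rfl := hxv.unique hx.1.1
      refine hcard.trans (Finset.card_le_card fun s hs => ?_)
      simp only [Finset.mem_filter, Finset.mem_univ, true_and] at hs ⊢
      refine ⟨hkeep s hs.1 fun hr => ?_, hs.2.trans hx.1.2⟩
      refine absurd (hmin s ⟨⟨hs.1, hs.2.trans hx.1.2⟩, hr⟩) (not_le.2 (Finset.card_lt_card ?_))
      refine Finset.ssubset_iff_subset_ne.2 ⟨fun w hw => ?_, fun h => ?_⟩
      · simp only [Finset.mem_filter, Finset.mem_univ, true_and] at hw ⊢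
        exact ⟨hw.1, hw.2.trans hs.2⟩
      · have : s ∈ Finset.univ.filter fun w => I.ProposesTo K p w v ∧ I.Prefers v w x := by
          simpa using hs
        rw [← h] at this
        simp [not_prefers_self] at this
    · rw [Finset.not_nonempty_iff_eq_empty, Finset.filter_eq_empty_iff] at hB
      refine hL.trans (Finset.card_le_card fun s hs => ?_)
      have := hB hs
      simp only [Finset.mem_filter, Finset.mem_univ, true_and] at hs ⊢
      exact ⟨hkeep s hs.1 this, hs.2⟩
  intro t u htu hK
  refine key t u ?_
  by_cases hr : I.Rejected K L p t
  · unfold Market.daStep at htu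
    rw [if_pos hr] at htu
    rcases Nat.lt_succ_iff_lt_or_eq.1 htu with h | h
    · exact hJ t u h hK
    · obtain ⟨v, htv, hcard⟩ := hr
      obtain rfl := htv.unique ⟨h, h ▸ hK⟩
      exact hcard
  · unfold Market.daStep at htu
    rw [if_neg hr] at htu
    exact hJ t u htu hK

lemma justified_zero (I : Market n m) (K L : ℕ) : I.Justified K L fun _ => 0 :=
  fun _ _ h => absurd h (Nat.not_lt_zero _)

lemma justified_iterate (I : Market n m) (K L j : ℕ) :
    I.Justified K L ((I.daStep K L)^[j] fun _ => 0) := by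
  induction j with
  | zero => exact I.justified_zero K L
  | succ j ih => rw [Function.iterate_succ_apply']; exact ih.daStep

lemma Rejected.lt {I : Market n m} {K L : ℕ} {p : Fin n → ℕ} {s : Fin n}
    (h : I.Rejected K L p s) : p s < K := by
  obtain ⟨u, hu, -⟩ := h
  exact hu.2

lemma iterate_daStep_le (I : Market n m) (K L j : ℕ) (s : Fin n) :
    (I.daStep K L)^[j] (fun _ => 0) s ≤ K := by
  induction j with
  | zero => simp
  | succ j ih =>
    rw [Function.iterate_succ_apply', daStep]
    split_ifs with h
    · exact h.lt
    · exact ih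

lemma Settled.daStep_eq {I : Market n m} {K L : ℕ} {p : Fin n → ℕ} (h : I.Settled K L p) :
    I.daStep K L p = p := funext fun s => if_neg (h s)

/-- Every round before settlement adds a rejection. After n * K such rounds all counts would equal
K, and then nobody can be rejected. -/
lemma settled_daFinal (I : Market n m) (K L : ℕ) : I.Settled K L (I.daFinal K L) := by
  have key : ∀ j, I.Settled K L ((I.daStep K L)^[j] fun _ => 0) ∨
      j ≤ ∑ s, (I.daStep K L)^[j] (fun _ => 0) s := by
    intro j
    induction j with
    | zero => exact Or.inr (Nat.zero_le _)
    | succ j ih =>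
      rw [Function.iterate_succ_apply']
      by_cases hS : I.Settled K L ((I.daStep K L)^[j] fun _ => 0)
      · rw [hS.daStep_eq]; exact Or.inl hS
      · refine Or.inr (Nat.succ_le_of_lt ((ih.resolve_left hS).trans_lt ?_))
        unfold Settled at hS
        push Not at hS
        obtain ⟨s, hs⟩ := hS
        refine Finset.sum_lt_sum (fun t _ => ?_) ⟨s, Finset.mem_univ _, ?_⟩
        · unfold daStep; split_ifs <;> omega
        · simp only [daStep, if_pos hs]; omega
  rcases key (n * K) with h | h
  · exact h
  · intro s hs
    have hlt := hs.lt
    have : ∑ s, I.daFinal K L s < ∑ _s : Fin n, K :=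
      Finset.sum_lt_sum (fun t _ => I.iterate_daStep_le K L _ t) ⟨s, Finset.mem_univ _, hlt⟩
    simp only [Finset.sum_const, Finset.card_univ, Fintype.card_fin, smul_eq_mul] at this
    exact absurd h (not_le.2 this)

lemma le_of_path {I : Market n m} {K L : ℕ} {p : ℕ → Fin n → ℕ} {q : Fin n → ℕ}
    (h0 : ∀ s, p 0 s = 0)
    (hstep : ∀ j s, p (j + 1) s = p j s ∨ (I.Rejected K L (p j) s ∧ p (j + 1) s = p j s + 1))
    (hS : I.Settled K L q) (hJ : I.Justified K L q) (j : ℕ) : p j ≤ q := by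
  induction j with
  | zero => intro s; simp [h0]
  | succ j ih =>
    intro s
    rcases hstep j s with h | ⟨hr, h⟩
    · rw [h]; exact ih s
    · rw [h]; exact hr.lt_of_le ih hS hJ

/-- The outcome of deferred acceptance does not depend on the order of the rejections. -/
lemma eq_daFinal_of_path {I : Market n m} {K L : ℕ} {p : ℕ → Fin n → ℕ}
    (h0 : ∀ s, p 0 s = 0)
    (hstep : ∀ j s, p (j + 1) s = p j s ∨ (I.Rejected K L (p j) s ∧ p (j + 1) s = p j s + 1))
    {N : ℕ} (hS : I.Settled K L (p N)) (hJ : I.Justified K L (p N)) :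
    p N = I.daFinal K L := by
  -- Each of the two processes ends in a settled and justified state, so each end state bounds the
  -- other process from above.
  refine le_antisymm (le_of_path h0 hstep (I.settled_daFinal K L)
    (I.justified_iterate K L _) N) ?_
  refine le_of_path (p := fun j => (I.daStep K L)^[j] fun _ => 0) (fun _ => rfl) (fun j s => ?_)
    hS hJ (n * K)
  simp only [Function.iterate_succ_apply']
  by_cases hr : I.Rejected K L ((I.daStep K L)^[j] fun _ => 0) s
  · exact Or.inr ⟨hr, if_pos hr⟩
  · exact Or.inl (if_neg hr)

lemma proposesTo_congr {I J : Market n m} (hr : I.studentRank = J.studentRank) :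
    I.ProposesTo = J.ProposesTo := by
  funext K p s u; simp only [ProposesTo, hr]

lemma daFinal_congr {I J : Market n m} (hr : I.studentRank = J.studentRank)
    (hp : ∀ u s t, I.Prefers u s t ↔ J.Prefers u s t) (K L : ℕ) :
    I.daFinal K L = J.daFinal K L := by
  have hp' : I.Prefers = J.Prefers := by
    funext u s t; exact propext (hp u s t)
  have hR : I.Rejected = J.Rejected := by
    funext K L p s; unfold Rejected; rw [proposesTo_congr hr, hp']
  have hD : I.daStep = J.daStep := by
    funext K L p s; unfold daStep; rw [hR]
  unfold daFinal
  rw [hD]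

lemma totalApplications_congr {I J : Market n m} (hr : I.studentRank = J.studentRank)
    (hp : ∀ u s t, I.Prefers u s t ↔ J.Prefers u s t) (K L : ℕ) :
    I.totalApplications K L = J.totalApplications K L := by
  simp only [totalApplications, daFinal_congr hr hp, hr]

lemma numFirstChoice_congr {I J : Market n m} (hr : I.studentRank = J.studentRank)
    (hp : ∀ u s t, I.Prefers u s t ↔ J.Prefers u s t) (K L : ℕ) :
    I.numFirstChoice K L = J.numFirstChoice K L := by
  unfold numFirstChoice
  rw [proposesTo_congr hr, daFinal_congr hr hp, hr]

end Market
end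

/-! ### Revealed information and the counting of profiles that agree with it. -/

noncomputable section
open scoped BigOperators

section Lists

variable {n : ℕ}

open Classical in
/-- The rankings that order a list of students increasingly. -/
def compatibleRankings (l : List (Fin n)) : Finset (Equiv.Perm (Fin n)) :=
  Finset.univ.filter fun ρ => l.Pairwise fun a b => ρ a < ρ b

lemma mem_compatibleRankings {l : List (Fin n)} {ρ : Equiv.Perm (Fin n)} :
    ρ ∈ compatibleRankings l ↔ l.Pairwise fun a b => ρ a < ρ b := by
  simp [compatibleRankings]

lemma nodup_of_mem_compatibleRankings {l : List (Fin n)} {ρ : Equiv.Perm (Fin n)}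
    (h : ρ ∈ compatibleRankings l) : l.Nodup :=
  (mem_compatibleRankings.1 h).imp fun h => by rintro rfl; exact lt_irrefl _ h

lemma card_compatibleRankings_map (l : List (Fin n)) (σ : Equiv.Perm (Fin n)) :
    (compatibleRankings (l.map σ)).card = (compatibleRankings l).card := by
  refine Finset.card_bij' (fun ρ _ => ρ * σ) (fun ρ _ => ρ * σ⁻¹) ?_ ?_ ?_ ?_
  · intro ρ h
    simpa only [mem_compatibleRankings, List.pairwise_map, Equiv.Perm.mul_apply] using h
  · intro ρ h
    have hσ : ∀ a, (ρ * σ⁻¹) (σ a) = ρ a := fun a => by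
      rw [← Equiv.Perm.mul_apply, inv_mul_cancel_right]
    simpa only [mem_compatibleRankings, List.pairwise_map, hσ] using h
  · intro ρ _; simp
  · intro ρ _; simp

/-- Interchanging the names a and b turns one list into the other, since neither occurs in A or B.
-/
lemma card_compatibleRankings_swap (A B : List (Fin n)) (a b : Fin n)
    (h : (A ++ a :: b :: B).Nodup) :
    (compatibleRankings (A ++ a :: b :: B)).card =
      (compatibleRankings (A ++ b :: a :: B)).card := by
  rw [← card_compatibleRankings_map _ (Equiv.swap a b)]
  have hfix : ∀ l : List (Fin n), a ∉ l → b ∉ l → l.map (Equiv.swap a b) = l := by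
    intro l ha hb
    conv_rhs => rw [← List.map_id l]
    refine List.map_congr_left fun c hc => ?_
    exact Equiv.swap_apply_of_ne_of_ne (fun h => ha (h ▸ hc)) (fun h => hb (h ▸ hc))
  simp only [List.nodup_append, List.nodup_cons, List.mem_cons, not_or] at h
  obtain ⟨-, ⟨⟨hab, haB⟩, hbB, -⟩, hA⟩ := h
  rw [List.map_append, List.map_cons, List.map_cons, hfix A, hfix B haB hbB,
    Equiv.swap_apply_left, Equiv.swap_apply_right]
  · exact fun h => hA a h a (Or.inl rfl) rfl
  · exact fun h => hA b h b (Or.inr (Or.inl rfl)) rfl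

lemma List.Nodup.insertIdx_of_notMem {l : List (Fin n)} (hl : l.Nodup) {a : Fin n} (ha : a ∉ l)
    {i : ℕ} (hi : i ≤ l.length) : (l.insertIdx i a).Nodup :=
  ((List.perm_insertIdx a l hi).symm.nodup (List.nodup_cons.2 ⟨ha, hl⟩))

lemma List.insertIdx_eq_take_append_drop {α : Type*} (l : List α) (a : α) {i : ℕ}
    (hi : i ≤ l.length) : l.insertIdx i a = l.take i ++ a :: l.drop i := by
  induction l generalizing i with
  | nil => simp only [List.length_nil, Nat.le_zero] at hi; simp [hi]
  | cons b l ih =>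
    rcases i with _ | i
    · simp
    · simp [ih (show i ≤ l.length by simpa using hi)]

lemma card_compatibleRankings_insertIdx {l : List (Fin n)} (hl : l.Nodup) {a : Fin n}
    (ha : a ∉ l) {i : ℕ} (hi : i ≤ l.length) :
    (compatibleRankings (l.insertIdx i a)).card = (compatibleRankings (a :: l)).card := by
  induction i with
  | zero => rw [List.insertIdx_zero]
  | succ i ih =>
    rw [← ih (by omega)]
    have hnd := hl.insertIdx_of_notMem ha (show i ≤ l.length by omega)
    have h1 : l.insertIdx i a = l.take i ++ a :: l[i] :: l.drop (i + 1) := by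
      rw [List.insertIdx_eq_take_append_drop l a (by omega), List.drop_eq_getElem_cons hi]
    have h2 : l.insertIdx (i + 1) a = l.take i ++ l[i] :: a :: l.drop (i + 1) := by
      rw [List.insertIdx_eq_take_append_drop l a hi, List.take_succ_eq_append_getElem hi,
        List.append_assoc, List.singleton_append]
    rw [h1] at hnd ⊢
    rw [h2, card_compatibleRankings_swap _ _ _ _ hnd]

lemma exists_pairwise_insertIdx {ρ : Equiv.Perm (Fin n)} {l : List (Fin n)}
    (hl : l.Pairwise fun a b => ρ a < ρ b) {a : Fin n} (ha : a ∉ l) :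
    ∃ i ≤ l.length, (l.insertIdx i a).Pairwise fun a b => ρ a < ρ b := by
  induction l with
  | nil => exact ⟨0, le_rfl, by simp⟩
  | cons b l ih =>
    rw [List.pairwise_cons] at hl
    rw [List.mem_cons, not_or] at ha
    rcases lt_or_gt_of_ne (ρ.injective.ne ha.1) with h | h
    · refine ⟨0, Nat.zero_le _, ?_⟩
      rw [List.insertIdx_zero, List.pairwise_cons, List.pairwise_cons]
      refine ⟨fun c hc => ?_, hl⟩
      rcases List.mem_cons.1 hc with rfl | hc
      · exact h
      · exact h.trans (hl.1 c hc)
    · obtain ⟨i, hi, hp⟩ := ih hl.2 ha.2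
      refine ⟨i + 1, by simpa using hi, ?_⟩
      rw [List.insertIdx_succ_cons, List.pairwise_cons]
      refine ⟨fun c hc => ?_, hp⟩
      rcases (List.mem_insertIdx hi).1 hc with rfl | hc
      · exact h
      · exact hl.1 c hc

lemma pairwise_insertIdx_unique {ρ : Equiv.Perm (Fin n)} {l : List (Fin n)} {a : Fin n}
    {i j : ℕ} (hi : i ≤ l.length) (hj : j ≤ l.length)
    (hpi : (l.insertIdx i a).Pairwise fun a b => ρ a < ρ b)
    (hpj : (l.insertIdx j a).Pairwise fun a b => ρ a < ρ b) : i = j := by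
  induction l generalizing i j with
  | nil => simp only [List.length_nil, Nat.le_zero] at hi hj; rw [hi, hj]
  | cons b l ih =>
    rcases i with _ | i <;> rcases j with _ | j
    · rfl
    · rw [List.insertIdx_zero, List.pairwise_cons] at hpi
      rw [List.insertIdx_succ_cons, List.pairwise_cons] at hpj
      exact absurd (hpi.1 b (by simp))
        (hpj.1 a ((List.mem_insertIdx (by simpa using hj)).2 (Or.inl rfl))).asymm
    · rw [List.insertIdx_zero, List.pairwise_cons] at hpj
      rw [List.insertIdx_succ_cons, List.pairwise_cons] at hpi
      exact absurd (hpj.1 b (by simp))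
        (hpi.1 a ((List.mem_insertIdx (by simpa using hi)).2 (Or.inl rfl))).asymm
    · rw [List.insertIdx_succ_cons, List.pairwise_cons] at hpi hpj
      rw [ih (by simpa using hi) (by simpa using hj) hpi.2 hpj.2]

/-- A new student is equally likely to be inserted at each place of a list. -/
lemma card_compatibleRankings_eq_mul {l : List (Fin n)} (hl : l.Nodup) {a : Fin n}
    (ha : a ∉ l) {i : ℕ} (hi : i ≤ l.length) :
    (compatibleRankings l).card =
      (l.length + 1) * (compatibleRankings (l.insertIdx i a)).card := by
  classical
  -- The rankings compatible with l are split by the place that a takes among the members of l; all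
  -- parts have the same size because adjacent places can be swapped.
  have hU : compatibleRankings l =
      (Finset.range (l.length + 1)).biUnion fun j => compatibleRankings (l.insertIdx j a) := by
    ext ρ
    simp only [Finset.mem_biUnion, Finset.mem_range, Nat.lt_succ_iff, mem_compatibleRankings]
    exact ⟨fun h => exists_pairwise_insertIdx h ha,
      fun ⟨j, _, h⟩ => h.sublist (List.sublist_insertIdx l j a)⟩
  rw [hU, Finset.card_biUnion, Finset.sum_congr rfl fun j hj =>
    (card_compatibleRankings_insertIdx hl ha (Nat.lt_succ_iff.1 (Finset.mem_range.1 hj))).trans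
      (card_compatibleRankings_insertIdx hl ha hi).symm]
  · simp
  · intro j hj k hk hjk
    refine Finset.disjoint_left.2 fun ρ h1 h2 => hjk ?_
    rw [mem_compatibleRankings] at h1 h2
    exact pairwise_insertIdx_unique (Nat.lt_succ_iff.1 (Finset.mem_range.1 hj))
      (Nat.lt_succ_iff.1 (Finset.mem_range.1 hk)) h1 h2

end Lists

/-- The information revealed during deferred acceptance when the applications are sent one at a
time: the number of applications that each student has sent, and for each university the list of
its applicants, best first, each with the position of the university on her list. -/
structure ApplicationState (n m : ℕ) where
  count : Fin n → ℕ
  applicants : Fin m → List (Fin n × ℕ)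

namespace ApplicationState

variable {n m : ℕ}

/-- The state in which nothing has been revealed. -/
def init (n m : ℕ) : ApplicationState n m := ⟨fun _ => 0, fun _ => []⟩

open Classical in
/-- The student `s` sends her next application to `u` and is inserted at place `i`. -/
def apply (x : ApplicationState n m) (s : Fin n) (u : Fin m) (i : ℕ) : ApplicationState n m where
  count := Function.update x.count s (x.count s + 1)
  applicants := Function.update x.applicants u ((x.applicants u).insertIdx i (s, x.count s))

/-- The student `s` is among the `L` best applicants of some university. -/
def Held (x : ApplicationState n m) (L : ℕ) (s : Fin n) : Prop :=
  ∃ u k, (s, k) ∈ (x.applicants u).take L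

/-- The student `s` is not held and has not yet sent `K` applications. -/
def Active (x : ApplicationState n m) (K L : ℕ) (s : Fin n) : Prop :=
  x.count s < K ∧ ¬ x.Held L s

open Classical in
/-- The universities that have not received an application from `s`. -/
def fresh (x : ApplicationState n m) (s : Fin n) : Finset (Fin m) :=
  Finset.univ.filter fun u => s ∉ (x.applicants u).map Prod.fst

lemma mem_fresh {x : ApplicationState n m} {s : Fin n} {u : Fin m} :
    u ∈ x.fresh s ↔ s ∉ (x.applicants u).map Prod.fst := by simp [fresh]

/-- The preferences of the students agree with the revealed information. -/
def PrefsAgree (x : ApplicationState n m) (r : Fin n → Equiv.Perm (Fin m)) : Prop :=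
  ∀ u s k, (s, k) ∈ x.applicants u ↔ (r s u : ℕ) = k ∧ k < x.count s

open Classical in
/-- The preference profiles that agree with the revealed information. -/
def agreeingPrefs (x : ApplicationState n m) : Finset (Fin n → Equiv.Perm (Fin m)) :=
  Finset.univ.filter x.PrefsAgree

lemma mem_agreeingPrefs {x : ApplicationState n m} {r : Fin n → Equiv.Perm (Fin m)} :
    r ∈ x.agreeingPrefs ↔ x.PrefsAgree r := by simp [agreeingPrefs]

/-- The rankings of the universities that agree with the revealed information. -/
def agreeingRanks (x : ApplicationState n m) : Finset (Fin m → Equiv.Perm (Fin n)) :=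
  Fintype.piFinset fun u => compatibleRankings ((x.applicants u).map Prod.fst)

/-- The pairs of profiles that agree with the revealed information. -/
def agreeing (x : ApplicationState n m) :
    Finset ((Fin n → Equiv.Perm (Fin m)) × (Fin m → Equiv.Perm (Fin n))) :=
  x.agreeingPrefs ×ˢ x.agreeingRanks

lemma mem_fresh_iff {x : ApplicationState n m} {r : Fin n → Equiv.Perm (Fin m)}
    (h : x.PrefsAgree r) {s : Fin n} {u : Fin m} : u ∈ x.fresh s ↔ x.count s ≤ r s u := by
  rw [mem_fresh, List.mem_map, ← not_lt, not_iff_not]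
  constructor
  · rintro ⟨⟨s', k⟩, hk, rfl⟩
    obtain ⟨h1, h2⟩ := (h u s' k).1 hk
    exact h1 ▸ h2
  · exact fun hlt => ⟨(s, r s u), (h u s _).2 ⟨rfl, hlt⟩, rfl⟩

lemma prefsAgree_apply {x : ApplicationState n m} {r : Fin n → Equiv.Perm (Fin m)} {s : Fin n}
    {u : Fin m} (hu : u ∈ x.fresh s) {i : ℕ} (hi : i ≤ (x.applicants u).length) :
    (x.apply s u i).PrefsAgree r ↔ x.PrefsAgree r ∧ (r s u : ℕ) = x.count s := by
  have hnot : ∀ k, (s, k) ∉ x.applicants u := fun k hk =>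
    mem_fresh.1 hu (List.mem_map.2 ⟨_, hk, rfl⟩)
  have hmem : ∀ v t k, (t, k) ∈ (x.apply s u i).applicants v ↔
      (v = u ∧ t = s ∧ k = x.count s) ∨ (t, k) ∈ x.applicants v := by
    intro v t k
    by_cases hv : v = u
    · subst hv
      simp [apply, List.mem_insertIdx hi]
    · simp [apply, hv]
  have hcs : (x.apply s u i).count s = x.count s + 1 := by simp [apply]
  have hct : ∀ t, t ≠ s → (x.apply s u i).count t = x.count t := fun t ht => by simp [apply, ht]
  constructor
  · intro h
    have hru : (r s u : ℕ) = x.count s :=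
      ((h u s _).1 ((hmem u s _).2 (Or.inl ⟨rfl, rfl, rfl⟩))).1
    refine ⟨fun v t k => ?_, hru⟩
    have h1 := (hmem v t k).symm.trans (h v t k)
    by_cases ht : t = s
    · subst ht
      rw [hcs] at h1
      constructor
      · intro hk
        obtain ⟨h2, h3⟩ := h1.1 (Or.inr hk)
        refine ⟨h2, lt_of_le_of_ne (Nat.lt_succ_iff.1 h3) fun h4 => ?_⟩
        have : v = u := (r t).injective (Fin.ext (by rw [h2, h4, hru]))
        exact hnot k (this ▸ hk)
      · rintro ⟨h2, h3⟩
        rcases h1.2 ⟨h2, h3.trans (Nat.lt_succ_self _)⟩ with ⟨-, -, h4⟩ | h4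
        · omega
        · exact h4
    · rw [hct t ht] at h1
      simpa [ht] using h1
  · rintro ⟨h, hru⟩ v t k
    rw [hmem]
    by_cases ht : t = s
    · subst ht
      rw [hcs, h v t k]
      constructor
      · rintro (⟨rfl, -, rfl⟩ | ⟨h1, h2⟩)
        · exact ⟨hru, Nat.lt_succ_self _⟩
        · exact ⟨h1, h2.trans (Nat.lt_succ_self _)⟩
      · rintro ⟨h1, h2⟩
        rcases Nat.lt_succ_iff_lt_or_eq.1 h2 with h3 | h3
        · exact Or.inr ⟨h1, h3⟩
        · exact Or.inl ⟨(r t).injective (Fin.ext (by rw [h1, h3, hru])), rfl, h3⟩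
    · rw [hct t ht, h v t k]
      simp [ht]

/-- Under any agreeing profile the fresh universities are those at positions `count s` and later. -/
lemma card_fresh {x : ApplicationState n m} {r : Fin n → Equiv.Perm (Fin m)}
    (h : x.PrefsAgree r) (s : Fin n) : (x.fresh s).card = m - x.count s := by
  have : x.fresh s = (Finset.univ.filter fun i : Fin m => x.count s ≤ i).map
      (r s).symm.toEmbedding := by
    ext u
    rw [mem_fresh_iff h]
    simp
  rw [this, Finset.card_map]
  have h1 := Finset.card_filter_add_card_filter_not (s := (Finset.univ : Finset (Fin m)))
    fun i => (i : ℕ) < x.count s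
  have h2 := Fin.card_filter_val_lt (n := m) (m := x.count s)
  simp only [not_lt, Finset.card_univ, Fintype.card_fin] at h1
  omega

-- Exchanging the fresh universities u and v on the list of s touches only unrevealed positions, so
-- it is an involution of the agreeing profiles.
open Classical in
lemma card_prefs_swap {x : ApplicationState n m} {s : Fin n} {u v : Fin m}
    (hu : u ∈ x.fresh s) (hv : v ∈ x.fresh s) :
    (x.agreeingPrefs.filter fun r => (r s u : ℕ) = x.count s).card =
      (x.agreeingPrefs.filter fun r => (r s v : ℕ) = x.count s).card := by
  let σ : (Fin n → Equiv.Perm (Fin m)) → Fin n → Equiv.Perm (Fin m) := fun r =>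
    Function.update r s (r s * Equiv.swap u v)
  have hσσ : ∀ r, σ (σ r) = r := fun r => by simp [σ, mul_assoc]
  have hagree : ∀ r, x.PrefsAgree r → x.PrefsAgree (σ r) := by
    intro r h w t k
    rw [h w t k]
    by_cases ht : t = s
    · subst ht
      have hu' := (mem_fresh_iff h).1 hu
      have hv' := (mem_fresh_iff h).1 hv
      simp only [σ, Function.update_self, Equiv.Perm.mul_apply]
      by_cases hwu : w = u
      · subst hwu
        rw [Equiv.swap_apply_left]
        omega
      · by_cases hwv : w = v
        · subst hwv
          rw [Equiv.swap_apply_right]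
          omega
        · rw [Equiv.swap_apply_of_ne_of_ne hwu hwv]
    · simp [σ, ht]
  refine Finset.card_bij' (fun r _ => σ r) (fun r _ => σ r) ?_ ?_ (fun r _ => hσσ r)
    (fun r _ => hσσ r)
  · intro r hr
    rw [Finset.mem_filter, mem_agreeingPrefs] at hr ⊢
    exact ⟨hagree r hr.1, by simpa [σ] using hr.2⟩
  · intro r hr
    rw [Finset.mem_filter, mem_agreeingPrefs] at hr ⊢
    exact ⟨hagree r hr.1, by simpa [σ] using hr.2⟩

open Classical in
/-- The next application of a student is equally likely to go to each fresh university. -/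
lemma card_agreeingPrefs_eq_mul {x : ApplicationState n m} {s : Fin n} (hs : x.count s < m)
    {u : Fin m} (hu : u ∈ x.fresh s) :
    x.agreeingPrefs.card = (x.fresh s).card *
      (x.agreeingPrefs.filter fun r => (r s u : ℕ) = x.count s).card := by
  have hU : x.agreeingPrefs = (x.fresh s).biUnion fun v =>
      x.agreeingPrefs.filter fun r => (r s v : ℕ) = x.count s := by
    ext r
    simp only [Finset.mem_biUnion, Finset.mem_filter]
    refine ⟨fun h => ⟨(r s).symm ⟨x.count s, hs⟩, ?_, h, by simp⟩, fun ⟨_, _, h, _⟩ => h⟩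
    rw [mem_fresh_iff (mem_agreeingPrefs.1 h)]
    simp
  conv_lhs => rw [hU]
  rw [Finset.card_biUnion, Finset.sum_congr rfl fun v hv => card_prefs_swap hv hu]
  · simp
  · intro v _ w _ hvw
    refine Finset.disjoint_left.2 fun r h1 h2 => hvw ?_
    rw [Finset.mem_filter] at h1 h2
    exact (r s).injective (Fin.ext (h1.2.trans h2.2.symm))

lemma map_fst_apply (x : ApplicationState n m) (s : Fin n) (u : Fin m) (i : ℕ) :
    ((x.apply s u i).applicants u).map Prod.fst =
      ((x.applicants u).map Prod.fst).insertIdx i s := by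
  simp [apply, List.map_insertIdx]

lemma card_agreeingRanks_eq_mul {x : ApplicationState n m} (hx : x.agreeingRanks.Nonempty)
    {s : Fin n} {u : Fin m} (hu : u ∈ x.fresh s) {i : ℕ} (hi : i ≤ (x.applicants u).length) :
    x.agreeingRanks.card =
      ((x.applicants u).length + 1) * (x.apply s u i).agreeingRanks.card := by
  classical
  obtain ⟨ρ, hρ⟩ := hx
  have hnd := nodup_of_mem_compatibleRankings (Fintype.mem_piFinset.1 hρ u)
  rw [agreeingRanks, agreeingRanks, Fintype.card_piFinset, Fintype.card_piFinset,
    ← Finset.mul_prod_erase _ _ (Finset.mem_univ u),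
    ← Finset.mul_prod_erase Finset.univ (fun v =>
      (compatibleRankings (((x.apply s u i).applicants v).map Prod.fst)).card)
      (Finset.mem_univ u), map_fst_apply,
    card_compatibleRankings_eq_mul hnd (mem_fresh.1 hu) (i := i) (by simpa using hi),
    List.length_map, mul_assoc]
  congr 2
  refine Finset.prod_congr rfl fun v hv => ?_
  simp [apply, Finset.ne_of_mem_erase hv]

/-- The principle of deferred decisions in counting form: given the revealed information, the next
university is uniform among the fresh ones and the place of the applicant there is uniform among
`length + 1` places. -/
lemma card_agreeing_eq_mul {x : ApplicationState n m} (hx : x.agreeing.Nonempty)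
    {s : Fin n} (hs : x.count s < m) {u : Fin m} (hu : u ∈ x.fresh s) {i : ℕ}
    (hi : i ≤ (x.applicants u).length) :
    x.agreeing.card =
      (x.fresh s).card * ((x.applicants u).length + 1) * (x.apply s u i).agreeing.card := by
  classical
  rw [agreeing, agreeing, Finset.card_product, Finset.card_product,
    card_agreeingRanks_eq_mul (Finset.nonempty_product.1 hx).2 hu hi,
    card_agreeingPrefs_eq_mul hs hu]
  have : (x.apply s u i).agreeingPrefs =
      x.agreeingPrefs.filter fun r => (r s u : ℕ) = x.count s := by
    ext r
    rw [mem_agreeingPrefs, prefsAgree_apply hu hi, Finset.mem_filter, mem_agreeingPrefs]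
  rw [this]
  ring

end ApplicationState
end

/-! ### Sequential deferred acceptance as a random process. -/

noncomputable section
open scoped BigOperators
namespace ApplicationState

variable {n m : ℕ}

lemma mem_agreeing {x : ApplicationState n m}
    {ω : (Fin n → Equiv.Perm (Fin m)) × (Fin m → Equiv.Perm (Fin n))} :
    ω ∈ x.agreeing ↔ x.PrefsAgree ω.1 ∧
      ∀ u, ((x.applicants u).map Prod.fst).Pairwise fun a b => ω.2 u a < ω.2 u b := by
  simp only [agreeing, Finset.mem_product, mem_agreeingPrefs, agreeingRanks,
    Fintype.mem_piFinset, mem_compatibleRankings]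

lemma agreeing_apply_subset {x : ApplicationState n m} {s : Fin n} {u : Fin m}
    (hu : u ∈ x.fresh s) {i : ℕ} (hi : i ≤ (x.applicants u).length) :
    (x.apply s u i).agreeing ⊆ x.agreeing := by
  intro ω hω
  rw [mem_agreeing] at hω ⊢
  refine ⟨((prefsAgree_apply hu hi).1 hω.1).1, fun v => ?_⟩
  by_cases hv : v = u
  · subst hv
    have := hω.2 v
    rw [map_fst_apply] at this
    exact this.sublist (List.sublist_insertIdx _ _ _)
  · simpa [apply, hv] using hω.2 v

lemma exists_mem_agreeing_apply {x : ApplicationState n m}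
    {ω : (Fin n → Equiv.Perm (Fin m)) × (Fin m → Equiv.Perm (Fin n))} (hω : ω ∈ x.agreeing)
    {s : Fin n} (hs : x.count s < m) :
    ∃ u ∈ x.fresh s, ∃ i ≤ (x.applicants u).length, ω ∈ (x.apply s u i).agreeing := by
  rw [mem_agreeing] at hω
  set u := (ω.1 s).symm ⟨x.count s, hs⟩ with hu
  have hru : (ω.1 s u : ℕ) = x.count s := by simp [hu]
  have hfresh : u ∈ x.fresh s := (mem_fresh_iff hω.1).2 hru.ge
  obtain ⟨i, hi, hp⟩ := exists_pairwise_insertIdx (hω.2 u) (mem_fresh.1 hfresh)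
  rw [List.length_map] at hi
  refine ⟨u, hfresh, i, hi, mem_agreeing.2
    ⟨(prefsAgree_apply hfresh hi).2 ⟨hω.1, hru⟩, fun v => ?_⟩⟩
  by_cases hv : v = u
  · rw [hv, map_fst_apply]; exact hp
  · simpa [apply, hv] using hω.2 v

lemma mem_agreeing_apply_unique {x : ApplicationState n m}
    {ω : (Fin n → Equiv.Perm (Fin m)) × (Fin m → Equiv.Perm (Fin n))} {s : Fin n} {u v : Fin m}
    (hu : u ∈ x.fresh s) (hv : v ∈ x.fresh s) {i j : ℕ} (hi : i ≤ (x.applicants u).length)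
    (hj : j ≤ (x.applicants v).length) (h1 : ω ∈ (x.apply s u i).agreeing)
    (h2 : ω ∈ (x.apply s v j).agreeing) : u = v ∧ i = j := by
  rw [mem_agreeing] at h1 h2
  have h3 := ((prefsAgree_apply hu hi).1 h1.1).2
  have h4 := ((prefsAgree_apply hv hj).1 h2.1).2
  obtain rfl : u = v := (ω.1 s).injective (Fin.ext (h3.trans h4.symm))
  refine ⟨rfl, ?_⟩
  have h5 := h1.2 u
  have h6 := h2.2 u
  rw [map_fst_apply] at h5 h6
  exact pairwise_insertIdx_unique (by simpa using hi) (by simpa using hj) h5 h6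

/-- The places at which the next application of `s` can be inserted. -/
def slots (x : ApplicationState n m) (s : Fin n) : Finset (Σ _ : Fin m, ℕ) :=
  (x.fresh s).sigma fun u => Finset.range ((x.applicants u).length + 1)

lemma mem_slots {x : ApplicationState n m} {s : Fin n} {q : Σ _ : Fin m, ℕ} :
    q ∈ x.slots s ↔ q.1 ∈ x.fresh s ∧ q.2 ≤ (x.applicants q.1).length := by
  simp [slots]

open Classical in
/-- One step of sequential deferred acceptance: some active student sends an application. -/
def step (K L : ℕ) (ω : (Fin n → Equiv.Perm (Fin m)) × (Fin m → Equiv.Perm (Fin n)))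
    (x : ApplicationState n m) : ApplicationState n m :=
  if h : ∃ s, x.Active K L s then
    if h' : ∃ q ∈ x.slots h.choose, ω ∈ (x.apply h.choose q.1 q.2).agreeing then
      x.apply h.choose h'.choose.1 h'.choose.2
    else x
  else x

lemma step_of_not_active {K L : ℕ} {x : ApplicationState n m} (h : ¬ ∃ s, x.Active K L s)
    (ω : (Fin n → Equiv.Perm (Fin m)) × (Fin m → Equiv.Perm (Fin n))) : step K L ω x = x :=
  dif_neg h

lemma step_eq_apply {K L : ℕ} {x : ApplicationState n m} (h : ∃ s, x.Active K L s)
    {ω : (Fin n → Equiv.Perm (Fin m)) × (Fin m → Equiv.Perm (Fin n))}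
    {q : Σ _ : Fin m, ℕ} (hq : q ∈ x.slots h.choose)
    (hω : ω ∈ (x.apply h.choose q.1 q.2).agreeing) :
    step K L ω x = x.apply h.choose q.1 q.2 := by
  have h' : ∃ q ∈ x.slots h.choose, ω ∈ (x.apply h.choose q.1 q.2).agreeing := ⟨q, hq, hω⟩
  rw [step, dif_pos h, dif_pos h']
  have h1 := h'.choose_spec
  have h2 := mem_slots.1 h1.1
  have h3 := mem_slots.1 hq
  obtain ⟨e1, e2⟩ := mem_agreeing_apply_unique h2.1 h3.1 h2.2 h3.2 h1.2 hω
  rw [e1, e2]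

lemma exists_step_eq_apply {K L : ℕ} (hK : K ≤ m) {x : ApplicationState n m}
    (h : ∃ s, x.Active K L s)
    {ω : (Fin n → Equiv.Perm (Fin m)) × (Fin m → Equiv.Perm (Fin n))} (hω : ω ∈ x.agreeing) :
    ∃ q ∈ x.slots h.choose, ω ∈ (x.apply h.choose q.1 q.2).agreeing ∧
      step K L ω x = x.apply h.choose q.1 q.2 := by
  obtain ⟨u, hu, i, hi, hω'⟩ :=
    exists_mem_agreeing_apply hω (h.choose_spec.1.trans_le hK)
  have hq : (⟨u, i⟩ : Σ _ : Fin m, ℕ) ∈ x.slots h.choose := mem_slots.2 ⟨hu, hi⟩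
  exact ⟨⟨u, i⟩, hq, hω', step_eq_apply h hq hω'⟩

/-- The state after `j` steps. -/
def run (K L : ℕ) (ω : (Fin n → Equiv.Perm (Fin m)) × (Fin m → Equiv.Perm (Fin n)))
    (j : ℕ) (x : ApplicationState n m) : ApplicationState n m := (step K L ω)^[j] x

lemma run_succ (K L : ℕ) (ω : (Fin n → Equiv.Perm (Fin m)) × (Fin m → Equiv.Perm (Fin n)))
    (j : ℕ) (x : ApplicationState n m) :
    run K L ω (j + 1) x = run K L ω j (step K L ω x) := Function.iterate_succ_apply _ _ _

lemma run_of_not_active {K L : ℕ} {x : ApplicationState n m} (h : ¬ ∃ s, x.Active K L s)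
    (ω : (Fin n → Equiv.Perm (Fin m)) × (Fin m → Equiv.Perm (Fin n))) (j : ℕ) :
    run K L ω j x = x := Function.iterate_fixed (step_of_not_active h ω) j

/-- The applying student `h.choose` depends on the state only, not on the profile. So the agreeing
profiles split according to her next slot, and each part consists of the profiles agreeing with the
new state. -/
lemma sum_agreeing_step {K L : ℕ} (hK : K ≤ m) {x : ApplicationState n m}
    (h : ∃ s, x.Active K L s)
    (F : (Fin n → Equiv.Perm (Fin m)) × (Fin m → Equiv.Perm (Fin n)) →
      ApplicationState n m → ℝ) :
    ∑ ω ∈ x.agreeing, F ω (step K L ω x) = ∑ q ∈ x.slots h.choose,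
      ∑ ω ∈ (x.apply h.choose q.1 q.2).agreeing, F ω (x.apply h.choose q.1 q.2) := by
  classical
  have hU : x.agreeing =
      (x.slots h.choose).biUnion fun q => (x.apply h.choose q.1 q.2).agreeing := by
    ext ω
    rw [Finset.mem_biUnion]
    constructor
    · intro hω
      obtain ⟨q, hq, h1, -⟩ := exists_step_eq_apply hK h hω
      exact ⟨q, hq, h1⟩
    · rintro ⟨q, hq, h1⟩
      exact agreeing_apply_subset (mem_slots.1 hq).1 (mem_slots.1 hq).2 h1
  conv_lhs => rw [hU]
  rw [Finset.sum_biUnion]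
  · refine Finset.sum_congr rfl fun q hq => Finset.sum_congr rfl fun ω hω => ?_
    rw [step_eq_apply h hq hω]
  · intro q hq q' hq' hne
    refine Finset.disjoint_left.2 fun ω h1 h2 => hne ?_
    have h3 := mem_slots.1 hq
    have h4 := mem_slots.1 hq'
    obtain ⟨e1, e2⟩ := mem_agreeing_apply_unique h3.1 h4.1 h3.2 h4.2 h1 h2
    exact Sigma.ext e1 (heq_of_eq e2)

/-- The average of a function of the state after the next application of `s`. -/
def nextMean (x : ApplicationState n m) (s : Fin n) (f : Fin m → ℕ → ℝ) : ℝ :=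
  𝔼 u ∈ x.fresh s, 𝔼 i ∈ Finset.range ((x.applicants u).length + 1), f u i

/-- Conditional expectation by counting: the parts of the splitting have the relative sizes that
`nextMean` assigns to the slots. -/
lemma sum_slots_card_agreeing_mul {x : ApplicationState n m} (hx : x.agreeing.Nonempty)
    {s : Fin n} (hs : x.count s < m) (f : Fin m → ℕ → ℝ) :
    ∑ q ∈ x.slots s, ((x.apply s q.1 q.2).agreeing.card : ℝ) * f q.1 q.2 =
      x.agreeing.card * x.nextMean s f := by
  rw [slots, Finset.sum_sigma, nextMean, Finset.expect_eq_sum_div_card, mul_div_assoc',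
    Finset.mul_sum, Finset.sum_div]
  refine Finset.sum_congr rfl fun u hu => ?_
  rw [Finset.expect_eq_sum_div_card, mul_div_assoc', div_div, Finset.mul_sum, Finset.sum_div]
  refine Finset.sum_congr rfl fun i hi => ?_
  rw [card_agreeing_eq_mul hx hs hu (Nat.lt_succ_iff.1 (Finset.mem_range.1 hi)),
    Finset.card_range]
  have h1 : ((x.fresh s).card : ℝ) ≠ 0 := by
    exact_mod_cast (Finset.card_pos.2 ⟨u, hu⟩).ne'
  have h2 : (((x.applicants u).length + 1 : ℕ) : ℝ) ≠ 0 := by positivity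
  rw [Nat.cast_mul, Nat.cast_mul]
  generalize (((x.applicants u).length + 1 : ℕ) : ℝ) = b at h2 ⊢
  generalize ((x.fresh s).card : ℝ) = a at h1 ⊢
  generalize ((x.apply s u i).agreeing.card : ℝ) = c
  field_simp

lemma count_apply_le {K L : ℕ} {x : ApplicationState n m} {s : Fin n} (hs : x.Active K L s)
    (hc : ∀ t, x.count t ≤ K) (u : Fin m) (i : ℕ) (t : Fin n) : (x.apply s u i).count t ≤ K := by
  by_cases ht : t = s
  · subst ht; simpa [apply] using hs.1
  · simpa [apply, ht] using hc t

/-- A potential whose conditional mean grows by at most `a ↦ α * a + β` in each step grows at most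
accordingly on average over all profiles. -/
lemma sum_run_le {K L : ℕ} (hK : K ≤ m) {Ψ : ApplicationState n m → ℝ} (hΨ : ∀ x, 0 ≤ Ψ x)
    {α β : ℝ} (hα : 1 ≤ α) (hβ : 0 ≤ β)
    (hstep : ∀ (x : ApplicationState n m) (s : Fin n), x.agreeing.Nonempty → x.Active K L s →
      (∀ t, x.count t ≤ K) → x.nextMean s (fun u i => Ψ (x.apply s u i)) ≤ α * Ψ x + β)
    (j : ℕ) (x : ApplicationState n m) (hc : ∀ t, x.count t ≤ K) :
    ∑ ω ∈ x.agreeing, Ψ (run K L ω j x) ≤ x.agreeing.card * (α ^ j * (Ψ x + j * β)) := by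
  induction j generalizing x with
  | zero => simp [run]
  | succ j ih =>
    have hα0 : 0 ≤ α ^ j := by positivity
    by_cases h : ∃ s, x.Active K L s
    · rcases x.agreeing.eq_empty_or_nonempty with he | hne
      · simp [he]
      have h1 := sum_agreeing_step hK h fun ω y => Ψ (run K L ω j y)
      simp_rw [run_succ]
      rw [h1]
      have hs := h.choose_spec
      calc _ ≤ ∑ q ∈ x.slots h.choose, ((x.apply h.choose q.1 q.2).agreeing.card : ℝ) *
            (α ^ j * (Ψ (x.apply h.choose q.1 q.2) + j * β)) :=
            Finset.sum_le_sum fun q _ => ih _ (count_apply_le hs hc _ _)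
        _ = α ^ j * (∑ q ∈ x.slots h.choose, ((x.apply h.choose q.1 q.2).agreeing.card : ℝ) *
              Ψ (x.apply h.choose q.1 q.2) +
            j * β * ∑ q ∈ x.slots h.choose, ((x.apply h.choose q.1 q.2).agreeing.card : ℝ)) := by
            rw [Finset.mul_sum, ← Finset.sum_add_distrib, Finset.mul_sum]
            exact Finset.sum_congr rfl fun q _ => by ring
        _ = α ^ j * (x.agreeing.card * x.nextMean h.choose
              (fun u i => Ψ (x.apply h.choose u i)) + j * β * x.agreeing.card) := by
            rw [sum_slots_card_agreeing_mul hne (hs.1.trans_le hK)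
              (fun u i => Ψ (x.apply h.choose u i))]
            -- The parts have the total size of `x.agreeing`: this is `sum_agreeing_step` for the
            -- constant 1.
            congr 3
            have h2 := sum_agreeing_step hK h fun _ _ => (1 : ℝ)
            simpa using h2.symm
        _ ≤ α ^ j * (x.agreeing.card * (α * Ψ x + β) + j * β * x.agreeing.card) := by
            gcongr
            exact hstep x _ hne hs hc
        _ = x.agreeing.card * (α ^ j * (α * Ψ x + 1 * ((j + 1) * β))) := by ring
        -- α ≥ 1 allows the additive term to be inflated, which keeps the bound in the form required
        -- by the induction.
        _ ≤ x.agreeing.card * (α ^ j * (α * Ψ x + α * ((j + 1) * β))) := by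
            gcongr
        _ = _ := by push_cast; ring
    · simp_rw [run_of_not_active h]
      rw [Finset.sum_const, nsmul_eq_mul]
      gcongr
      have h1 : 1 ≤ α ^ (j + 1) := one_le_pow₀ hα
      have h2 : 0 ≤ ((j + 1 : ℕ) : ℝ) * β := by positivity
      nlinarith [hΨ x]

lemma agreeing_init : (init n m).agreeing = Finset.univ := by
  ext ω
  simp [mem_agreeing, init, PrefsAgree]

end ApplicationState
end

/-! ### Sequential deferred acceptance has the outcome of deferred acceptance by rounds. -/

noncomputable section
open scoped BigOperators

lemma List.mem_take_insertIdx {α : Type*} {a c : α} {l : List α} {i L : ℕ}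
    (h : c ∈ (l.insertIdx i a).take L) : c = a ∨ c ∈ l.take L := by
  induction l generalizing i L with
  | nil =>
    rcases i with _ | i
    · exact Or.inl (by simpa using List.mem_of_mem_take h)
    · rw [List.insertIdx_succ_nil] at h; exact Or.inr h
  | cons b l ih =>
    rcases L with _ | L
    · simp at h
    rcases i with _ | i
    · rw [List.insertIdx_zero, List.take_succ_cons] at h
      rcases List.mem_cons.1 h with h | h
      · exact Or.inl h
      · exact Or.inr (List.take_subset_take_left _ (Nat.le_succ L) h)
    · rw [List.insertIdx_succ_cons, List.take_succ_cons] at h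
      rw [List.take_succ_cons]
      rcases List.mem_cons.1 h with h | h
      · exact Or.inr (List.mem_cons.2 (Or.inl h))
      · exact (ih h).imp_right (List.mem_cons_of_mem _)

/-- Someone beyond the first L places has all of these L ahead of her. This turns positions in
applicant lists into the cardinalities in `Rejected` and `Justified`. -/
lemma le_card_of_notMem_take {n L : ℕ} {l : List (Fin n × ℕ)} {ρ : Equiv.Perm (Fin n)}
    (hl : (l.map Prod.fst).Pairwise fun a b => ρ a < ρ b) {b : Fin n × ℕ} (hb : b ∈ l)
    (hb' : b ∉ l.take L) {P : Finset (Fin n)}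
    (hP : ∀ c ∈ l.take L, ρ c.1 < ρ b.1 → c.1 ∈ P) : L ≤ P.card := by
  rw [← List.take_append_drop L l, List.mem_append] at hb
  have hd := hb.resolve_left hb'
  have hlen : L < l.length := by
    by_contra! h
    rw [List.drop_eq_nil_of_le h] at hd
    simp at hd
  have hnd : (l.map Prod.fst).Nodup :=
    hl.imp fun h => by rintro rfl; exact lt_irrefl _ h
  rw [List.pairwise_map, ← List.take_append_drop L l, List.pairwise_append] at hl
  have h1 : ((l.take L).map Prod.fst).Nodup := by
    rw [List.map_take]; exact hnd.sublist (List.take_sublist _ _)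
  have h2 : ((l.take L).map Prod.fst).toFinset.card = L := by
    rw [List.toFinset_card_of_nodup h1, List.length_map, List.length_take, min_eq_left hlen.le]
  rw [← h2]
  refine Finset.card_le_card fun t ht => ?_
  rw [List.mem_toFinset, List.mem_map] at ht
  obtain ⟨c, hc, rfl⟩ := ht
  exact hP c hc (hl.2.2 c hc b hd)

namespace ApplicationState

variable {n m : ℕ}

open Classical in
/-- The number of rejections that a student has received. -/
def rejections (L : ℕ) (x : ApplicationState n m) (s : Fin n) : ℕ :=
  if x.Held L s then x.count s - 1 else x.count s

/-- The invariants of sequential deferred acceptance. -/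
structure Valid (K L : ℕ) (ω : (Fin n → Equiv.Perm (Fin m)) × (Fin m → Equiv.Perm (Fin n)))
    (x : ApplicationState n m) : Prop where
  agree : ω ∈ x.agreeing
  count_le : ∀ t, x.count t ≤ K
  last_held : ∀ u t k, (t, k) ∈ (x.applicants u).take L → k + 1 = x.count t

lemma valid_init (K L : ℕ) (ω : (Fin n → Equiv.Perm (Fin m)) × (Fin m → Equiv.Perm (Fin n))) :
    (init n m).Valid K L ω :=
  ⟨by simp [agreeing_init], fun _ => Nat.zero_le _, fun u t k h => by simp [init] at h⟩

lemma take_apply {x : ApplicationState n m} {L : ℕ} {s : Fin n} {u : Fin m} {i : ℕ} {v : Fin m}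
    {t : Fin n} {k : ℕ} (h : (t, k) ∈ ((x.apply s u i).applicants v).take L) :
    (v = u ∧ t = s ∧ k = x.count s) ∨ (t, k) ∈ (x.applicants v).take L := by
  by_cases hv : v = u
  · subst hv
    simp only [apply, Function.update_self] at h
    rcases List.mem_take_insertIdx h with h | h
    · exact Or.inl ⟨rfl, (Prod.mk.injEq _ _ _ _ ▸ h : t = s ∧ k = x.count s)⟩
    · exact Or.inr h
  · simp only [apply, Function.update_of_ne hv] at h
    exact Or.inr h

namespace Valid

variable {K L : ℕ} {ω : (Fin n → Equiv.Perm (Fin m)) × (Fin m → Equiv.Perm (Fin n))}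
  {x : ApplicationState n m}

lemma step (hx : x.Valid K L ω) (hK : K ≤ m) : (step K L ω x).Valid K L ω := by
  by_cases h : ∃ s, x.Active K L s
  · obtain ⟨q, hq, h1, h2⟩ := exists_step_eq_apply hK h hx.agree
    rw [h2]
    refine ⟨h1, count_apply_le h.choose_spec hx.count_le _ _, fun u t k hk => ?_⟩
    rcases take_apply hk with ⟨-, rfl, rfl⟩ | hk
    · simp [apply]
    -- Only a student who is not held applies, so the counts of those held before do not change.
    · have ht : t ≠ h.choose := by
        rintro rfl
        exact h.choose_spec.2 ⟨u, k, hk⟩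
      simpa [apply, ht] using hx.last_held u t k hk
  · rwa [step_of_not_active h]

lemma run (hx : x.Valid K L ω) (hK : K ≤ m) (j : ℕ) : (run K L ω j x).Valid K L ω := by
  induction j generalizing x with
  | zero => exact hx
  | succ j ih => rw [run_succ]; exact ih (hx.step hK)

lemma mem_applicants (hx : x.Valid K L ω) {u : Fin m} {s : Fin n} {k : ℕ} :
    (s, k) ∈ x.applicants u ↔ (ω.1 s u : ℕ) = k ∧ k < x.count s :=
  (mem_agreeing.1 hx.agree).1 u s k

lemma proposesTo (hx : x.Valid K L ω) {u : Fin m} {t : Fin n} {k : ℕ}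
    (h : (t, k) ∈ (x.applicants u).take L) :
    (Market.ofRanks ω.1 ω.2).ProposesTo K (x.rejections L) t u := by
  have h1 := (hx.mem_applicants.1 (List.mem_of_mem_take h)).1
  have h2 := hx.last_held u t k h
  have h3 := hx.count_le t
  have h4 : x.rejections L t = k := by
    rw [rejections, if_pos ⟨u, k, h⟩]; omega
  refine ⟨by rw [h4]; exact h1, by rw [h4]; omega⟩

/-- A step raises a rejection count only if the applicant is turned down or a held student is
displaced, and both are rejections in the sense of the rounds. So the run is a path as in
`Market.eq_daFinal_of_path`. -/
lemma rejections_step (hx : x.Valid K L ω) (hK : K ≤ m) (t : Fin n) :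
    (ApplicationState.step K L ω x).rejections L t = x.rejections L t ∨
      ((Market.ofRanks ω.1 ω.2).Rejected K L (x.rejections L) t ∧
        (ApplicationState.step K L ω x).rejections L t = x.rejections L t + 1) := by
  classical
  by_cases h : ∃ s, x.Active K L s
  swap
  · rw [step_of_not_active h]; exact Or.inl rfl
  obtain ⟨⟨u, i⟩, hq, h1, h2⟩ := exists_step_eq_apply hK h hx.agree
  have hy := hx.step hK
  rw [h2] at hy ⊢
  obtain ⟨hs, hns⟩ := h.choose_spec
  set s := h.choose
  simp only at h1 hy ⊢
  obtain ⟨hu, hi⟩ := mem_slots.1 hq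
  have hrs : x.rejections L s = x.count s := if_neg hns
  have hru : (ω.1 s u : ℕ) = x.count s :=
    ((prefsAgree_apply hu hi).1 (mem_agreeing.1 h1).1).2
  have hsu : (Market.ofRanks ω.1 ω.2).ProposesTo K (x.rejections L) s u :=
    ⟨by rw [hrs]; exact hru, by rw [hrs]; exact hs⟩
  -- whoever is at `u` but not among the best `L` there is rejected
  have hrej : ∀ b ∈ (x.apply s u i).applicants u,
      b ∉ ((x.apply s u i).applicants u).take L →
      (Market.ofRanks ω.1 ω.2).ProposesTo K (x.rejections L) b.1 u →
      (Market.ofRanks ω.1 ω.2).Rejected K L (x.rejections L) b.1 := by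
    intro b hb hb' hp
    refine ⟨u, hp, le_card_of_notMem_take ((mem_agreeing.1 h1).2 u) hb hb' ?_⟩
    rintro ⟨w, k⟩ hw hlt
    rw [Finset.mem_filter, Market.prefers_ofRanks]
    refine ⟨Finset.mem_univ _, ?_, hlt⟩
    rcases take_apply hw with ⟨-, rfl, -⟩ | hw
    · exact hsu
    · exact hx.proposesTo hw
  have hmem : ∀ b, b ∈ (x.apply s u i).applicants u ↔
      b = (s, x.count s) ∨ b ∈ x.applicants u := fun b => by
    simp [apply, List.mem_insertIdx hi]
  by_cases hts : t = s
  · subst hts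
    have hcount : (x.apply s u i).count s = x.count s + 1 := by simp [apply]
    by_cases hh : (x.apply s u i).Held L s
    · left
      rw [rejections, if_pos hh, hcount, hrs, Nat.add_sub_cancel]
    · right
      rw [rejections, if_neg hh, hcount, hrs]
      exact ⟨hrej (s, x.count s) ((hmem _).2 (Or.inl rfl)) (fun hk => hh ⟨u, _, hk⟩) hsu, rfl⟩
  · have hcount : (x.apply s u i).count t = x.count t := by simp [apply, hts]
    by_cases hx' : x.Held L t
    · by_cases hh : (x.apply s u i).Held L t
      · left; rw [rejections, rejections, if_pos hh, if_pos hx', hcount]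
      · right
        obtain ⟨v, k, hk⟩ := hx'
        have hv : v = u := by
          by_contra hv
          exact hh ⟨v, k, by simpa [apply, hv] using hk⟩
        subst hv
        refine ⟨hrej (t, k) ((hmem _).2 (Or.inr (List.mem_of_mem_take hk)))
          (fun hk => hh ⟨_, _, hk⟩) (hx.proposesTo hk), ?_⟩
        have := hx.last_held _ _ _ hk
        rw [rejections, rejections, if_neg hh, if_pos ⟨_, _, hk⟩, hcount]
        omega
    · have hh : ¬ (x.apply s u i).Held L t := by
        rintro ⟨v, k, hk⟩
        rcases take_apply hk with ⟨-, h3, -⟩ | hk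
        · exact hts h3
        · exact hx' ⟨v, k, hk⟩
      left; rw [rejections, rejections, if_neg hh, if_neg hx', hcount]

lemma mem_take_of_proposesTo (hx : x.Valid K L ω) (hterm : ¬ ∃ s, x.Active K L s) {t : Fin n}
    {u : Fin m} (hp : (Market.ofRanks ω.1 ω.2).ProposesTo K (x.rejections L) t u) :
    (t, x.rejections L t) ∈ (x.applicants u).take L := by
  have hheld : x.Held L t := by
    by_contra hh
    refine hterm ⟨t, ?_, hh⟩
    have := hp.2
    rwa [rejections, if_neg hh] at this
  have hr : x.rejections L t = x.count t - 1 := if_pos hheld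
  obtain ⟨v, k, hk⟩ := hheld
  have h1 := hx.last_held _ _ _ hk
  have h2 : k = x.rejections L t := by omega
  subst h2
  obtain rfl := (hx.proposesTo hk).unique hp
  exact hk

/-- At the end all who propose to u are among its first L applicants; leaving out s, fewer than L
can be preferred to her. -/
lemma settled (hx : x.Valid K L ω) (hterm : ¬ ∃ s, x.Active K L s) :
    (Market.ofRanks ω.1 ω.2).Settled K L (x.rejections L) := by
  classical
  rintro s ⟨u, hsu, hcard⟩
  have hlt : (Finset.univ.filter fun t =>
      (Market.ofRanks ω.1 ω.2).ProposesTo K (x.rejections L) t u ∧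
        (Market.ofRanks ω.1 ω.2).Prefers u t s) ⊂
      (((x.applicants u).take L).map Prod.fst).toFinset := by
    refine Finset.ssubset_iff_subset_ne.2 ⟨fun t ht => ?_, fun he => ?_⟩
    · rw [Finset.mem_filter] at ht
      rw [List.mem_toFinset, List.mem_map]
      exact ⟨_, hx.mem_take_of_proposesTo hterm ht.2.1, rfl⟩
    · have : s ∈ (((x.applicants u).take L).map Prod.fst).toFinset := by
        rw [List.mem_toFinset, List.mem_map]
        exact ⟨_, hx.mem_take_of_proposesTo hterm hsu, rfl⟩
      rw [← he, Finset.mem_filter] at this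
      exact Market.not_prefers_self _ _ _ this.2.2
  have h1 := Finset.card_lt_card hlt
  have h2 := List.toFinset_card_le (((x.applicants u).take L).map Prod.fst)
  rw [List.length_map, List.length_take] at h2
  omega

lemma justified (hx : x.Valid K L ω) :
    (Market.ofRanks ω.1 ω.2).Justified K L (x.rejections L) := by
  classical
  intro t u htu _
  have hr : x.rejections L t ≤ x.count t := by
    rw [rejections]; split_ifs <;> omega
  have hmem : (t, (ω.1 t u : ℕ)) ∈ x.applicants u :=
    hx.mem_applicants.2 ⟨rfl, lt_of_lt_of_le htu hr⟩
  refine le_card_of_notMem_take ((mem_agreeing.1 hx.agree).2 u) hmem (fun hk => ?_) ?_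
  · have h1 := hx.proposesTo hk
    exact htu.ne h1.1
  · rintro ⟨w, k⟩ hw hlt
    rw [Finset.mem_filter, Market.prefers_ofRanks]
    exact ⟨Finset.mem_univ _, hx.proposesTo hw, hlt⟩

end Valid

/-- Each step with an active student adds one application, and there are at most n * K in all; hence
`n * K` steps in `final`. -/
lemma sum_count_run {K L : ℕ} (hK : K ≤ m)
    (ω : (Fin n → Equiv.Perm (Fin m)) × (Fin m → Equiv.Perm (Fin n))) (j : ℕ) :
    (¬ ∃ s, (run K L ω j (init n m)).Active K L s) ∨
      j ≤ ∑ s, (run K L ω j (init n m)).count s := by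
  induction j with
  | zero => exact Or.inr (Nat.zero_le _)
  | succ j ih =>
    rw [run, Function.iterate_succ_apply']
    change (¬ ∃ s, (step K L ω (run K L ω j (init n m))).Active K L s) ∨
      j + 1 ≤ ∑ s, (step K L ω (run K L ω j (init n m))).count s
    have hv := (valid_init K L ω).run hK j
    set x := run K L ω j (init n m)
    by_cases h : ∃ s, x.Active K L s
    · right
      obtain ⟨q, -, -, h2⟩ := exists_step_eq_apply hK h hv.agree
      rw [h2]
      refine Nat.succ_le_of_lt ((ih.resolve_left (not_not.2 h)).trans_lt ?_)
      refine Finset.sum_lt_sum (fun t _ => ?_) ⟨h.choose, Finset.mem_univ _, by simp [apply]⟩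
      by_cases ht : t = h.choose
      · subst ht; simp [apply]
      · simp [apply, ht]
    · left; rw [step_of_not_active h]; exact h

/-- The state reached by sequential deferred acceptance. -/
def final (K L : ℕ) (ω : (Fin n → Equiv.Perm (Fin m)) × (Fin m → Equiv.Perm (Fin n))) :
    ApplicationState n m := run K L ω (n * K) (init n m)

lemma valid_final {K : ℕ} (hK : K ≤ m) (L : ℕ)
    (ω : (Fin n → Equiv.Perm (Fin m)) × (Fin m → Equiv.Perm (Fin n))) :
    (final K L ω).Valid K L ω := (valid_init K L ω).run hK _

lemma not_active_final {K : ℕ} (hK : K ≤ m) (L : ℕ)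
    (ω : (Fin n → Equiv.Perm (Fin m)) × (Fin m → Equiv.Perm (Fin n))) :
    ¬ ∃ s, (final K L ω).Active K L s := by
  rcases sum_count_run hK ω (n * K) (L := L) with h | h
  · exact h
  · rintro ⟨s, hs⟩
    have : ∑ s, (final K L ω).count s < ∑ _s : Fin n, K :=
      Finset.sum_lt_sum (fun t _ => (valid_final hK L ω).count_le t) ⟨s, Finset.mem_univ _, hs.1⟩
    simp only [Finset.sum_const, Finset.card_univ, Fintype.card_fin, smul_eq_mul] at this
    exact absurd h (not_le.2 this)

/-- Sequential deferred acceptance has the same outcome as deferred acceptance by rounds. -/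
lemma rejections_final {K : ℕ} (hK : K ≤ m) (L : ℕ)
    (ω : (Fin n → Equiv.Perm (Fin m)) × (Fin m → Equiv.Perm (Fin n))) :
    (final K L ω).rejections L = (Market.ofRanks ω.1 ω.2).daFinal K L := by
  refine Market.eq_daFinal_of_path (p := fun j => (run K L ω j (init n m)).rejections L)
    (fun s => ?_) (fun j s => ?_) ((valid_final hK L ω).settled (not_active_final hK L ω))
    (valid_final hK L ω).justified
  · change (init n m).rejections L s = 0
    rw [rejections]
    split_ifs <;> rfl
  · have := ((valid_init K L ω).run hK j).rejections_step hK s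
    simpa only [run, Function.iterate_succ_apply'] using this

end ApplicationState
end

/-! ### Applications and matches counted by position on the list. -/

noncomputable section
open scoped BigOperators

lemma List.sum_range_getElem?_eq_countP {α : Type*} (l : List (α × ℕ)) (k L : ℕ) :
    ∑ i ∈ Finset.range L, (if (l.map Prod.snd)[i]? = some k then 1 else 0) =
      (l.take L).countP fun a => a.2 = k := by
  induction l generalizing L with
  | nil => simp
  | cons a l ih =>
    rcases L with _ | L
    · simp
    · rw [Finset.sum_range_succ', List.take_succ_cons, List.countP_cons, ← ih]
      simp only [List.map_cons, List.getElem?_cons_succ, List.getElem?_cons_zero,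
        Option.some.injEq, decide_eq_true_eq]

namespace ApplicationState

variable {n m : ℕ}

/-- The number of applications sent. -/
def numApplications (x : ApplicationState n m) : ℕ := ∑ s, x.count s

/-- The number of students who have applied to the university at position `k` of their list. -/
def numApplied (x : ApplicationState n m) (k : ℕ) : ℕ :=
  (Finset.univ.filter fun s => k < x.count s).card

open Classical in
/-- The number of students who are held by the university at position `k` of their list. -/
def numHeld (L : ℕ) (x : ApplicationState n m) (k : ℕ) : ℕ :=
  (Finset.univ.filter fun s => ∃ u, (s, k) ∈ (x.applicants u).take L).card

namespace Valid

variable {K L : ℕ} {ω : (Fin n → Equiv.Perm (Fin m)) × (Fin m → Equiv.Perm (Fin n))}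
  {x : ApplicationState n m}

lemma length_applicants (hx : x.Valid K L ω) (u : Fin m) :
    (x.applicants u).length = (Finset.univ.filter fun s => (ω.1 s u : ℕ) < x.count s).card := by
  classical
  have hnd : ((x.applicants u).map Prod.fst).Nodup :=
    ((mem_agreeing.1 hx.agree).2 u).imp fun h => by rintro rfl; exact lt_irrefl _ h
  rw [← List.length_map (f := Prod.fst), ← List.toFinset_card_of_nodup hnd]
  congr 1
  ext s
  rw [List.mem_toFinset, List.mem_map, Finset.mem_filter]
  constructor
  · rintro ⟨⟨t, k⟩, h, rfl⟩
    have := hx.mem_applicants.1 h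
    exact ⟨Finset.mem_univ _, this.1 ▸ this.2⟩
  · exact fun h => ⟨(s, ω.1 s u), hx.mem_applicants.2 ⟨rfl, h.2⟩, rfl⟩

lemma card_filter_lt_count (hx : x.Valid K L ω) (hK : K ≤ m) (s : Fin n) :
    (Finset.univ.filter fun u => (ω.1 s u : ℕ) < x.count s).card = x.count s := by
  have : (Finset.univ.filter fun u => (ω.1 s u : ℕ) < x.count s) =
      (Finset.univ.filter fun i : Fin m => (i : ℕ) < x.count s).map (ω.1 s).symm.toEmbedding := by
    ext u; simp
  rw [this, Finset.card_map, Fin.card_filter_val_lt, min_eq_right ((hx.count_le s).trans hK)]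

lemma sum_length_applicants (hx : x.Valid K L ω) (hK : K ≤ m) :
    ∑ u, (x.applicants u).length = x.numApplications := by
  simp_rw [hx.length_applicants, Finset.card_filter]
  rw [Finset.sum_comm]
  refine Finset.sum_congr rfl fun s _ => ?_
  rw [← Finset.card_filter]
  exact hx.card_filter_lt_count hK s

/-- At the end a held student has sent one application more than she has rejections, and any other
student has sent all K. -/
lemma lt_count_iff (hx : x.Valid K L ω) (hterm : ¬ ∃ s, x.Active K L s) (s : Fin n) (k : ℕ) :
    k < x.count s ↔ k ≤ x.rejections L s ∧ k < K := by
  have h1 := hx.count_le s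
  by_cases hh : x.Held L s
  · rw [rejections, if_pos hh]
    obtain ⟨u, j, hj⟩ := hh
    have := hx.last_held _ _ _ hj
    omega
  · rw [rejections, if_neg hh]
    have : ¬ x.count s < K := fun h => hterm ⟨s, h, hh⟩
    omega

lemma numApplied_zero (hx : x.Valid K L ω) (hterm : ¬ ∃ s, x.Active K L s) (hK : 1 ≤ K) :
    x.numApplied 0 = n := by
  have : ∀ s, 0 < x.count s := fun s => (hx.lt_count_iff hterm s 0).2 ⟨Nat.zero_le _, hK⟩
  simp [numApplied, this]

/-- At the end, whoever applied at position k is held there or went on to the next position. This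
fails for the last position, where a rejected student stops. -/
lemma numApplied_add_numHeld (hx : x.Valid K L ω) (hterm : ¬ ∃ s, x.Active K L s) {k : ℕ}
    (hk : k + 1 < K) : x.numApplied (k + 1) + x.numHeld L k = x.numApplied k := by
  classical
  rw [numApplied, numHeld, numApplied, ← Finset.card_union_of_disjoint]
  · congr 1
    ext s
    simp only [Finset.mem_union, Finset.mem_filter, Finset.mem_univ, true_and]
    constructor
    · rintro (h | ⟨u, hu⟩)
      · omega
      · have := hx.last_held _ _ _ hu; omega
    · intro h
      rcases Nat.lt_or_ge (k + 1) (x.count s) with h1 | h1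
      · exact Or.inl h1
      · right
        have hh : x.Held L s := by
          by_contra hh
          exact hterm ⟨s, by omega, hh⟩
        obtain ⟨u, j, hj⟩ := hh
        have := hx.last_held _ _ _ hj
        obtain rfl : j = k := by omega
        exact ⟨u, hj⟩
  · refine Finset.disjoint_left.2 fun s h1 h2 => ?_
    simp only [Finset.mem_filter, Finset.mem_univ, true_and] at h1 h2
    obtain ⟨u, hu⟩ := h2
    have := hx.last_held _ _ _ hu
    omega

lemma sum_numApplied (hx : x.Valid K L ω) :
    ∑ k ∈ Finset.range K, x.numApplied k = x.numApplications := by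
  simp_rw [numApplied, numApplications, Finset.card_filter]
  rw [Finset.sum_comm]
  refine Finset.sum_congr rfl fun s _ => ?_
  rw [← Finset.card_filter,
    show (Finset.range K).filter (fun k => k < x.count s) = Finset.range (x.count s) by
      ext k
      have := hx.count_le s
      simp only [Finset.mem_filter, Finset.mem_range]
      omega, Finset.card_range]

lemma sum_countP_take (hx : x.Valid K L ω) (k : ℕ) :
    ∑ u, ((x.applicants u).take L).countP (fun a => a.2 = k) = x.numHeld L k := by
  classical
  have hU : (Finset.univ.filter fun s => ∃ u, (s, k) ∈ (x.applicants u).take L) =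
      Finset.univ.biUnion fun u =>
        ((((x.applicants u).take L).filter fun a => a.2 = k).map Prod.fst).toFinset := by
    ext s
    simp
  rw [numHeld, hU, Finset.card_biUnion]
  · refine Finset.sum_congr rfl fun u _ => ?_
    have hnd : ((x.applicants u).map Prod.fst).Nodup :=
      ((mem_agreeing.1 hx.agree).2 u).imp fun h => by rintro rfl; exact lt_irrefl _ h
    rw [List.toFinset_card_of_nodup, List.length_map, List.countP_eq_length_filter]
    exact hnd.sublist ((List.filter_sublist.trans (List.take_sublist _ _)).map _)
  · intro u _ v _ huv
    refine Finset.disjoint_left.2 fun s h1 h2 => huv ?_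
    simp only [List.mem_toFinset, List.mem_map, List.mem_filter, decide_eq_true_eq] at h1 h2
    obtain ⟨⟨s1, k1⟩, ⟨h1, rfl⟩, rfl⟩ := h1
    obtain ⟨⟨s2, k2⟩, ⟨h2, h3⟩, h4⟩ := h2
    simp only at h3 h4
    subst h3 h4
    have e1 := (hx.mem_applicants.1 (List.mem_of_mem_take h1)).1
    have e2 := (hx.mem_applicants.1 (List.mem_of_mem_take h2)).1
    exact (ω.1 s2).injective (Fin.ext (e1.trans e2.symm))

lemma numApplications_le (hx : x.Valid K L ω) : x.numApplications ≤ n * K := by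
  refine (Finset.sum_le_sum fun s _ => hx.count_le s).trans ?_
  simp

end Valid

lemma totalApplications_ofRanks {K : ℕ} (hK : K ≤ m) (L : ℕ)
    (ω : (Fin n → Equiv.Perm (Fin m)) × (Fin m → Equiv.Perm (Fin n))) :
    (Market.ofRanks ω.1 ω.2).totalApplications K L = (final K L ω).numApplications := by
  have hx := valid_final hK L ω
  have hterm := not_active_final hK L ω
  refine Finset.sum_congr rfl fun s _ => ?_
  rw [← rejections_final hK, ← hx.card_filter_lt_count hK s]
  congr 1
  ext u
  simp only [Finset.mem_filter, Finset.mem_univ, true_and, hx.lt_count_iff hterm]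
  rfl

lemma numFirstChoice_ofRanks {K : ℕ} (hK : K ≤ m) (L : ℕ)
    (ω : (Fin n → Equiv.Perm (Fin m)) × (Fin m → Equiv.Perm (Fin n))) :
    (Market.ofRanks ω.1 ω.2).numFirstChoice K L = (final K L ω).numHeld L 0 := by
  have hx := valid_final hK L ω
  have hterm := not_active_final hK L ω
  rw [Market.numFirstChoice, numHeld, ← rejections_final hK]
  congr 1
  ext s
  simp only [Finset.mem_filter, Finset.mem_univ, true_and]
  refine exists_congr fun u => ⟨fun ⟨h1, h2⟩ => ?_, fun h => ?_⟩
  · have h3 := hx.mem_take_of_proposesTo hterm h2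
    rwa [← h2.1, h1] at h3
  · exact ⟨(hx.mem_applicants.1 (List.mem_of_mem_take h)).1, hx.proposesTo h⟩

end ApplicationState
end

/-! ### Mean change of sums over universities caused by one application. -/

noncomputable section
open scoped BigOperators

/-- Indicator of the lists of length `c`. -/
def lengthIs {α : Type*} (c : ℕ) (l : List (α × ℕ)) : ℝ := if l.length = c then 1 else 0

/-- Indicator of the lists of length `c` whose entry at place `i` has label `k`. -/
def labelAt {α : Type*} (k c i : ℕ) (l : List (α × ℕ)) : ℝ :=
  if l.length = c ∧ (l.map Prod.snd)[i]? = some k then 1 else 0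

lemma lengthIs_mem_Icc {α : Type*} (c : ℕ) (l : List (α × ℕ)) :
    0 ≤ lengthIs c l ∧ lengthIs c l ≤ 1 := by
  unfold lengthIs; split_ifs <;> norm_num

lemma labelAt_mem_Icc {α : Type*} (k c i : ℕ) (l : List (α × ℕ)) :
    0 ≤ labelAt k c i l ∧ labelAt k c i l ≤ 1 := by
  unfold labelAt; split_ifs <;> norm_num

lemma labelAt_zero {α : Type*} (k i : ℕ) (l : List (α × ℕ)) : labelAt k 0 i l = 0 := by
  unfold labelAt
  rw [if_neg]
  rintro ⟨h1, h2⟩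
  rw [List.length_eq_zero_iff] at h1
  simp [h1] at h2

lemma expect_lengthIs_insertIdx {α : Type*} (c : ℕ) (a : α × ℕ) (l : List (α × ℕ)) :
    𝔼 j ∈ Finset.range (l.length + 1), lengthIs c (l.insertIdx j a) =
      shiftSeq (fun c => lengthIs c l) c := by
  rw [Finset.expect_congr rfl fun j hj => show lengthIs c (l.insertIdx j a) =
      shiftSeq (fun c => lengthIs c l) c by
    rw [lengthIs, List.length_insertIdx_of_le_length (Nat.lt_succ_iff.1 (Finset.mem_range.1 hj))]
    cases c <;> simp [lengthIs]]
  exact Finset.expect_const ⟨0, by simp⟩ _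

lemma sum_range_ite_lt_eq (c i : ℕ) (A B C : ℝ) :
    ∑ j ∈ Finset.range (c + 1), (if i < j then A else if i = j then B else C) =
      ((c - i : ℕ) : ℝ) * A + (if i ≤ c then B else 0) + ((min i (c + 1) : ℕ) : ℝ) * C := by
  induction c with
  | zero => rcases i with _ | i <;> simp
  | succ c ih =>
    rw [Finset.sum_range_succ, ih]
    rcases lt_trichotomy i (c + 1) with h | rfl | h
    · rw [if_pos h, if_pos (by omega), if_pos (by omega), min_eq_left (by omega),
        min_eq_left (by omega), show c + 1 - i = (c - i) + 1 by omega]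
      push_cast; ring
    · simp [add_comm]
    · rw [if_neg (by omega), if_neg (by omega), if_neg (by omega), if_neg (by omega),
        min_eq_right (by omega), min_eq_right (by omega), show c + 1 - i = 0 by omega,
        show c - i = 0 by omega]
      push_cast; ring

/-- For i ≤ c, of the c + 1 insertion places, c - i lie beyond i and leave its entry unchanged, one
is i itself, and i lie before it and push the entry of i - 1 there. For i = 0 the truncated i - 1
has coefficient 0. -/
lemma expect_labelAt_insertIdx {α : Type*} (k c i : ℕ) (a : α × ℕ) (l : List (α × ℕ)) :
    𝔼 j ∈ Finset.range (l.length + 1), labelAt k (c + 1) i (l.insertIdx j a) =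
      (((c - i : ℕ) : ℝ) * labelAt k c i l + (if i ≤ c ∧ a.2 = k then lengthIs c l else 0)
        + i * labelAt k c (i - 1) l) / (c + 1) := by
  by_cases hl : l.length = c
  · have h1 : ∀ j ∈ Finset.range (l.length + 1), labelAt k (c + 1) i (l.insertIdx j a) =
        if i < j then labelAt k c i l else if i = j then (if a.2 = k then 1 else 0)
          else labelAt k c (i - 1) l := by
      intro j hj
      have hj := Nat.lt_succ_iff.1 (Finset.mem_range.1 hj)
      rw [labelAt, List.length_insertIdx_of_le_length hj, List.map_insertIdx,
        List.getElem?_insertIdx]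
      have hj' : j ≤ (l.map Prod.snd).length := by simpa using hj
      split_ifs <;> simp_all [labelAt]
    rw [Finset.expect_congr rfl h1, Finset.expect_eq_sum_div_card, Finset.card_range, hl,
      sum_range_ite_lt_eq]
    push_cast
    congr 2
    · congr 1
      by_cases h : i ≤ c <;> simp [h, lengthIs, hl]
    -- For i > c + 1 only c + 1 places lie before i, but place i - 1 is then beyond the list and
    -- contributes nothing.
    · rcases Nat.lt_or_ge (c + 1) i with h | h
      · have : labelAt k c (i - 1) l = 0 := by
          rw [labelAt, if_neg]
          rintro ⟨-, h2⟩
          rw [List.getElem?_eq_none (by simp; omega)] at h2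
          simp at h2
        rw [this]; simp
      · rw [← Nat.cast_one, ← Nat.cast_add, ← Nat.cast_min, min_eq_left h]
  · have h0 : ∀ j, labelAt k c j l = 0 := fun j => by simp [labelAt, hl]
    have h1 : lengthIs c l = 0 := by simp [lengthIs, hl]
    rw [h0, h0, h1, Finset.expect_congr rfl fun j hj => show
      labelAt k (c + 1) i (l.insertIdx j a) = 0 by
        rw [labelAt, List.length_insertIdx_of_le_length
          (Nat.lt_succ_iff.1 (Finset.mem_range.1 hj)), if_neg (by omega)]]
    simp

namespace ApplicationState

variable {n m : ℕ}

lemma nextMean_add (x : ApplicationState n m) (s : Fin n) (f g : Fin m → ℕ → ℝ) :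
    x.nextMean s (fun u i => f u i + g u i) = x.nextMean s f + x.nextMean s g := by
  simp only [nextMean, Finset.expect_add_distrib]

lemma nextMean_mul_left (x : ApplicationState n m) (s : Fin n) (a : ℝ) (f : Fin m → ℕ → ℝ) :
    x.nextMean s (fun u i => a * f u i) = a * x.nextMean s f := by
  simp only [nextMean, Finset.mul_expect]

lemma nextMean_const {x : ApplicationState n m} {s : Fin n} (h : (x.fresh s).Nonempty) (a : ℝ) :
    x.nextMean s (fun _ _ => a) = a := by
  have h1 : ∀ u, (Finset.range ((x.applicants u).length + 1)).Nonempty := fun u => ⟨0, by simp⟩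
  simp only [nextMean, Finset.expect_const (h1 _), Finset.expect_const h]

lemma nextMean_sum (x : ApplicationState n m) (s : Fin n) {ι : Type*} (I : Finset ι)
    (f : ι → Fin m → ℕ → ℝ) :
    x.nextMean s (fun u i => ∑ q ∈ I, f q u i) = ∑ q ∈ I, x.nextMean s (f q) := by
  simp only [nextMean, Finset.expect_sum_comm]

lemma nextMean_mono {x : ApplicationState n m} {s : Fin n} {f g : Fin m → ℕ → ℝ}
    (h : ∀ u ∈ x.fresh s, ∀ i ≤ (x.applicants u).length, f u i ≤ g u i) :
    x.nextMean s f ≤ x.nextMean s g :=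
  Finset.expect_le_expect fun u hu => Finset.expect_le_expect fun i hi =>
    h u hu i (Nat.lt_succ_iff.1 (Finset.mem_range.1 hi))

/-- The mean of the square after a step in terms of the mean drift. -/
lemma nextMean_sq_le {x : ApplicationState n m} {s : Fin n} (h : (x.fresh s).Nonempty)
    {f : Fin m → ℕ → ℝ} {a B : ℝ}
    (hB : ∀ u ∈ x.fresh s, ∀ i ≤ (x.applicants u).length, |f u i - a| ≤ B) :
    x.nextMean s (fun u i => f u i ^ 2) ≤ a ^ 2 + 2 * a * (x.nextMean s f - a) + B ^ 2 := by
  -- (f - a)² ≤ B², expanded, bounds f² by a function affine in f.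
  calc x.nextMean s (fun u i => f u i ^ 2) ≤
        x.nextMean s (fun u i => 2 * a * f u i + (B ^ 2 - a ^ 2)) := by
        refine nextMean_mono fun u hu i hi => ?_
        have := sq_le_sq' (abs_le.1 (hB u hu i hi)).1 (abs_le.1 (hB u hu i hi)).2
        nlinarith
    _ = _ := by
        rw [nextMean_add, nextMean_mul_left, nextMean_const h]; ring

/-- The sum of a function over the lists of applicants. -/
def total (f : List (Fin n × ℕ) → ℝ) (x : ApplicationState n m) : ℝ := ∑ u, f (x.applicants u)

lemma total_apply (f : List (Fin n × ℕ) → ℝ) (x : ApplicationState n m) (s : Fin n) (u : Fin m)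
    (i : ℕ) : total f (x.apply s u i) =
      total f x + (f ((x.applicants u).insertIdx i (s, x.count s)) - f (x.applicants u)) := by
  classical
  rw [total, total, ← Finset.add_sum_erase _ _ (Finset.mem_univ u),
    ← Finset.add_sum_erase Finset.univ (fun v => f (x.applicants v)) (Finset.mem_univ u)]
  have : ∑ v ∈ Finset.univ.erase u, f ((x.apply s u i).applicants v) =
      ∑ v ∈ Finset.univ.erase u, f (x.applicants v) :=
    Finset.sum_congr rfl fun v hv => by simp [apply, Finset.ne_of_mem_erase hv]
  rw [this]
  simp only [apply, Function.update_self]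
  ring

lemma abs_total_apply_sub_le {f : List (Fin n × ℕ) → ℝ} (hf : ∀ l, 0 ≤ f l ∧ f l ≤ 1)
    (x : ApplicationState n m) (s : Fin n) (u : Fin m) (i : ℕ) :
    |total f (x.apply s u i) - total f x| ≤ 1 := by
  rw [total_apply, add_sub_cancel_left, abs_le]
  have h1 := hf ((x.applicants u).insertIdx i (s, x.count s))
  have h2 := hf (x.applicants u)
  constructor <;> linarith [h1.1, h1.2, h2.1, h2.2]

lemma numApplications_apply (x : ApplicationState n m) (s : Fin n) (u : Fin m) (i : ℕ) :
    (x.apply s u i).numApplications = x.numApplications + 1 := by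
  classical
  rw [numApplications, numApplications, ← Finset.add_sum_erase _ _ (Finset.mem_univ s),
    ← Finset.add_sum_erase Finset.univ x.count (Finset.mem_univ s)]
  have : ∑ t ∈ Finset.univ.erase s, (x.apply s u i).count t =
      ∑ t ∈ Finset.univ.erase s, x.count t :=
    Finset.sum_congr rfl fun t ht => by simp [apply, Finset.ne_of_mem_erase ht]
  rw [this]
  simp only [apply, Function.update_self]
  ring

lemma numApplied_apply (x : ApplicationState n m) (s : Fin n) (u : Fin m) (i k : ℕ) :
    (x.apply s u i).numApplied k = x.numApplied k + if x.count s = k then 1 else 0 := by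
  classical
  rw [numApplied, numApplied, Finset.card_filter, Finset.card_filter,
    ← Finset.add_sum_erase _ _ (Finset.mem_univ s),
    ← Finset.add_sum_erase Finset.univ (fun t => if k < x.count t then 1 else 0)
      (Finset.mem_univ s)]
  have : ∑ t ∈ Finset.univ.erase s, (if k < (x.apply s u i).count t then 1 else 0) =
      ∑ t ∈ Finset.univ.erase s, if k < x.count t then 1 else 0 :=
    Finset.sum_congr rfl fun t ht => by simp [apply, Finset.ne_of_mem_erase ht]
  rw [this]
  simp only [apply, Function.update_self]
  split_ifs <;> omega

lemma numApplied_le (x : ApplicationState n m) (k : ℕ) : x.numApplied k ≤ n := by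
  refine (Finset.card_filter_le _ _).trans ?_
  simp

/-- The next application goes to a nearly uniform university. -/
lemma abs_expect_fresh_sub_le {x : ApplicationState n m} (hx : x.agreeing.Nonempty) {s : Fin n}
    {K : ℕ} (hs : x.count s < K) (hK : K ≤ m) {g : Fin m → ℝ} (hg : ∀ u, |g u| ≤ 1) :
    |𝔼 u ∈ x.fresh s, g u - (∑ u, g u) / m| ≤ 2 * K / m := by
  classical
  obtain ⟨ω, hω⟩ := hx
  have hcard := card_fresh (mem_agreeing.1 hω).1 s
  set F := x.fresh s
  have hFK : m ≤ F.card + K := by omega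
  have hF0 : 0 < F.card := by omega
  have hFm : F.card ≤ m := by omega
  have hsplit := Finset.sum_add_sum_compl F g
  have h1 : |∑ u ∈ F, g u| ≤ F.card := by
    refine (Finset.abs_sum_le_sum_abs _ _).trans ((Finset.sum_le_sum fun u _ => hg u).trans ?_)
    simp
  have h2 : |∑ u ∈ Fᶜ, g u| ≤ K := by
    refine (Finset.abs_sum_le_sum_abs _ _).trans ((Finset.sum_le_sum fun u _ => hg u).trans ?_)
    rw [Finset.sum_const, Finset.card_compl, Fintype.card_fin, nsmul_eq_mul, mul_one]
    exact_mod_cast (by omega : m - F.card ≤ K)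
  rw [Finset.expect_eq_sum_div_card, ← hsplit]
  have hF0' : (0 : ℝ) < F.card := by exact_mod_cast hF0
  have hm0 : (0 : ℝ) < m := by exact_mod_cast hF0.trans_le hFm
  have hFK' : (m : ℝ) ≤ F.card + K := by exact_mod_cast hFK
  have hFm' : (F.card : ℝ) ≤ m := by exact_mod_cast hFm
  generalize ∑ u ∈ F, g u = S at *
  generalize ∑ u ∈ Fᶜ, g u = S' at *
  generalize (F.card : ℝ) = a at *
  -- At most K universities are not fresh: changing the denominator costs at most K/m, and their
  -- omission from the sum another K/m.
  have e : S / a - (S + S') / m = (S / a * (m - a) - S') / m := by field_simp; ring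
  rw [e, abs_div, abs_of_pos hm0]
  gcongr
  have h3 : |S / a * (m - a)| ≤ K := by
    rw [abs_mul, abs_div, abs_of_pos hF0', abs_of_nonneg (by linarith : (0 : ℝ) ≤ m - a)]
    calc |S| / a * (m - a) ≤ 1 * K := by
          gcongr
          · rw [div_le_one hF0']; exact h1
          · linarith
      _ = K := one_mul _
  calc _ ≤ |S / a * (m - a)| + |S'| := abs_sub _ _
    _ ≤ 2 * K := by linarith

/-- Mean drift of a total. -/
lemma abs_nextMean_total_sub_le {f : List (Fin n × ℕ) → ℝ} (hf : ∀ l, 0 ≤ f l ∧ f l ≤ 1)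
    {x : ApplicationState n m} (hx : x.agreeing.Nonempty) {s : Fin n} {K : ℕ}
    (hs : x.count s < K) (hK : K ≤ m) :
    |x.nextMean s (fun u i => total f (x.apply s u i)) - total f x -
      (∑ u, (𝔼 i ∈ Finset.range ((x.applicants u).length + 1),
        f ((x.applicants u).insertIdx i (s, x.count s)) - f (x.applicants u))) / m|
      ≤ 2 * K / m := by
  have hfresh : (x.fresh s).Nonempty := by
    obtain ⟨ω, hω⟩ := hx
    rw [← Finset.card_pos, card_fresh (mem_agreeing.1 hω).1 s]
    omega
  have h1 : x.nextMean s (fun u i => total f (x.apply s u i)) - total f x =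
      𝔼 u ∈ x.fresh s, (𝔼 i ∈ Finset.range ((x.applicants u).length + 1),
        f ((x.applicants u).insertIdx i (s, x.count s)) - f (x.applicants u)) := by
    simp_rw [total_apply]
    rw [nextMean_add, nextMean_const hfresh, add_sub_cancel_left, nextMean]
    refine Finset.expect_congr rfl fun u _ => ?_
    rw [Finset.expect_sub_distrib, Finset.expect_const ⟨0, by simp⟩]
  rw [h1]
  refine abs_expect_fresh_sub_le hx hs hK fun u => ?_
  have hne : (Finset.range ((x.applicants u).length + 1)).Nonempty := ⟨0, by simp⟩
  have h2 : 0 ≤ 𝔼 i ∈ Finset.range ((x.applicants u).length + 1),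
      f ((x.applicants u).insertIdx i (s, x.count s)) :=
    Finset.expect_nonneg fun i _ => (hf _).1
  have h3 : 𝔼 i ∈ Finset.range ((x.applicants u).length + 1),
      f ((x.applicants u).insertIdx i (s, x.count s)) ≤ 1 :=
    Finset.expect_le hne fun i _ => (hf _).2
  have h4 := hf (x.applicants u)
  rw [abs_le]
  constructor <;> linarith [h4.1, h4.2]

end ApplicationState
end

/-! ### Deviations from the typical counts and their mean drift. -/

noncomputable section
open scoped BigOperators
namespace ApplicationState

variable {n m : ℕ}

/-- The mean number of applications per university. -/
def load (x : ApplicationState n m) : ℝ := x.numApplications / m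

/-- Deviation of the number of universities with `c` applicants from its typical value. -/
def lengthError (c : ℕ) (x : ApplicationState n m) : ℝ :=
  total (lengthIs c) x - m * poissonWeight c x.load

/-- Typical number of universities with `c` applicants, the one at place `i` having label `k`. -/
def labelTarget (k : ℕ) : ℕ → ℕ → ApplicationState n m → ℝ
  | 0, _, _ => 0
  | c + 1, i, x => if i ≤ c then x.numApplied k * poissonWeight c x.load / (c + 1) else 0

/-- Deviation of the number of universities with `c` applicants, the one at place `i` having
label `k`, from its typical value. -/
def labelError (k c i : ℕ) (x : ApplicationState n m) : ℝ :=
  total (labelAt k c i) x - labelTarget k c i x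

lemma labelError_zero (k i : ℕ) (x : ApplicationState n m) : labelError k 0 i x = 0 := by
  simp [labelError, labelTarget, total, labelAt_zero]

lemma load_nonneg (x : ApplicationState n m) : 0 ≤ x.load := by unfold load; positivity

lemma load_apply (x : ApplicationState n m) (s : Fin n) (u : Fin m) (i : ℕ) :
    (x.apply s u i).load = x.load + 1 / m := by
  rw [load, load, numApplications_apply]; push_cast; ring

/-- The mean drift of the length errors. -/
lemma abs_drift_lengthError_le {x : ApplicationState n m} (hx : x.agreeing.Nonempty) {s : Fin n}
    {K : ℕ} (hs : x.count s < K) (hK : K ≤ m) (c : ℕ) :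
    |x.nextMean s (fun u i => lengthError c (x.apply s u i)) - lengthError c x -
      (shiftSeq (fun c => lengthError c x) c - lengthError c x) / m| ≤ (2 * K + 2) / m := by
  have hm0 : (0 : ℝ) < m := by exact_mod_cast (by omega : 0 < m)
  have hfresh : (x.fresh s).Nonempty := by
    obtain ⟨ω, hω⟩ := hx
    rw [← Finset.card_pos, card_fresh (mem_agreeing.1 hω).1 s]
    omega
  have h1 := abs_nextMean_total_sub_le (lengthIs_mem_Icc c) hx hs hK
  simp_rw [expect_lengthIs_insertIdx] at h1
  have h2 := abs_poissonWeight_taylor_le c x.load_nonneg (h := 1 / m) (by positivity)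
  have h3 : x.nextMean s (fun u i => lengthError c (x.apply s u i)) =
      x.nextMean s (fun u i => total (lengthIs c) (x.apply s u i)) -
        m * poissonWeight c (x.load + 1 / m) := by
    simp only [lengthError, load_apply, sub_eq_add_neg]
    rw [nextMean_add, nextMean_const hfresh]
  have h4 : shiftSeq (fun c => lengthError c x) c =
      ∑ u, shiftSeq (fun c => lengthIs c (x.applicants u)) c -
        m * shiftSeq (fun c => poissonWeight c x.load) c := by
    cases c <;> simp [lengthError, total]
  rw [h3, h4]
  rw [Finset.sum_sub_distrib] at h1
  simp only [lengthError]
  change |_ - _ - (_ - total (lengthIs c) x) / _| ≤ _ at h1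
  set V := x.nextMean s (fun u i => total (lengthIs c) (x.apply s u i))
  set W := ∑ u, shiftSeq (fun c => lengthIs c (x.applicants u)) c
  set U := total (lengthIs c) x
  set p := poissonWeight c x.load
  set p' := poissonWeight c (x.load + 1 / m)
  set q := shiftSeq (fun c => poissonWeight c x.load) c
  -- The first-order change of the target cancels the target part of the mean drift; the Taylor
  -- remainder is left.
  have e : V - m * p' - (U - m * p) - (W - m * q - (U - m * p)) / m =
      (V - U - (W - U) / m) - m * (p' - p - 1 / m * (q - p)) := by
    field_simp; ring
  rw [e]
  calc _ ≤ |V - U - (W - U) / m| + |m * (p' - p - 1 / m * (q - p))| := abs_sub _ _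
    _ ≤ 2 * K / m + m * (2 * (1 / m) ^ 2) := by
        rw [abs_mul, abs_of_pos hm0]
        gcongr
    _ = _ := by field_simp

/-- The heuristic target is m p_{c+1}(λ) A_k/T, and (c+1) p_{c+1}(λ) = λ p_c(λ) with λ = T/m
rewrites it as A_k p_c(λ)/(c+1), free of a division by T. The identity says that the targets,
inserted in the mean change of `expect_labelAt_insertIdx`, reproduce their own first-order change
when λ grows by 1/m and A_k by δ. -/
lemma labelTarget_recursion (k c i : ℕ) (x : ApplicationState n m) (hm : 1 ≤ m) (δ : ℝ) :
    ((((c - i : ℕ) : ℝ) * labelTarget k c i x +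
        (if i ≤ c then δ * (m * poissonWeight c x.load) else 0) +
        i * labelTarget k c (i - 1) x) / (c + 1) - labelTarget k (c + 1) i x) / m =
      (if i ≤ c then (x.numApplied k * ((1 / m) *
        (shiftSeq (fun c => poissonWeight c x.load) c - poissonWeight c x.load)) +
          δ * poissonWeight c x.load) / (c + 1) else 0) := by
  have hm0 : (m : ℝ) ≠ 0 := by positivity
  have hc0 : (c : ℝ) + 1 ≠ 0 := by positivity
  cases c with
  | zero =>
    rcases i with _ | i
    · simp only [labelTarget, shiftSeq_zero]
      simp
      field_simp
      ring
    · simp [labelTarget]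
  | succ c =>
    simp only [labelTarget, shiftSeq_succ]
    have hc1 : (c : ℝ) + 1 ≠ 0 := by positivity
    rcases lt_trichotomy i (c + 1) with h | rfl | h
    · rw [if_pos (by omega), if_pos (by omega), if_pos (by omega), if_pos (by omega),
        if_pos (by omega), Nat.cast_sub (by omega)]
      push_cast at hc0 ⊢
      field_simp
      ring
    · rw [if_neg (by omega), if_pos le_rfl, if_pos (by omega), if_pos le_rfl, if_pos le_rfl]
      push_cast at hc0 ⊢
      field_simp
      ring
    · rw [if_neg (by omega), if_neg (by omega), if_neg (by omega), if_neg (by omega),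
        if_neg (by omega)]
      simp

/-- The mean drift of the label errors. -/
lemma abs_drift_labelError_le {x : ApplicationState n m} (hx : x.agreeing.Nonempty) {s : Fin n}
    {K : ℕ} (hs : x.count s < K) (hK : K ≤ m) {R : ℝ} (hR : n ≤ R * m) (k c i : ℕ) :
    |x.nextMean s (fun u j => labelError k (c + 1) i (x.apply s u j)) - labelError k (c + 1) i x -
      ((((c - i : ℕ) : ℝ) * labelError k c i x +
        (if i ≤ c ∧ x.count s = k then lengthError c x else 0) +
        i * labelError k c (i - 1) x) / (c + 1) - labelError k (c + 1) i x) / m|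
      ≤ (2 * K + 2 * R + 1) / m := by
  have hm1 : 1 ≤ m := by omega
  have hm0 : (0 : ℝ) < m := by exact_mod_cast hm1
  have hfresh : (x.fresh s).Nonempty := by
    obtain ⟨ω, hω⟩ := hx
    rw [← Finset.card_pos, card_fresh (mem_agreeing.1 hω).1 s]
    omega
  set δ : ℝ := if x.count s = k then 1 else 0 with hδ
  have hδ0 : 0 ≤ δ := by rw [hδ]; split_ifs <;> norm_num
  have hδ1 : δ ≤ 1 := by rw [hδ]; split_ifs <;> norm_num
  have h1 := abs_nextMean_total_sub_le (labelAt_mem_Icc k (c + 1) i) hx hs hK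
  simp_rw [expect_labelAt_insertIdx] at h1
  have hsum : ∑ u, ((((c - i : ℕ) : ℝ) * labelAt k c i (x.applicants u) +
        (if i ≤ c ∧ x.count s = k then lengthIs c (x.applicants u) else 0) +
        i * labelAt k c (i - 1) (x.applicants u)) / (c + 1) -
          labelAt k (c + 1) i (x.applicants u)) =
      (((c - i : ℕ) : ℝ) * total (labelAt k c i) x +
        (if i ≤ c ∧ x.count s = k then total (lengthIs c) x else 0) +
        i * total (labelAt k c (i - 1)) x) / (c + 1) - total (labelAt k (c + 1) i) x := by
    simp only [total, Finset.sum_sub_distrib, ← Finset.sum_div, Finset.sum_add_distrib,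
      ← Finset.mul_sum]
    split_ifs <;> simp
  rw [hsum] at h1
  -- The change of the target is the same for every slot, so it passes through `nextMean` as a
  -- constant.
  set d : ℝ := if i ≤ c then (((x.numApplied k : ℝ) + δ) * poissonWeight c (x.load + 1 / m) -
    x.numApplied k * poissonWeight c x.load) / (c + 1) else 0 with hd
  have h3 : x.nextMean s (fun u j => labelError k (c + 1) i (x.apply s u j)) =
      x.nextMean s (fun u j => total (labelAt k (c + 1) i) (x.apply s u j)) -
        (labelTarget k (c + 1) i x + d) := by
    have ht : ∀ u j, labelTarget k (c + 1) i (x.apply s u j) = labelTarget k (c + 1) i x + d := by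
      intro u j
      simp only [labelTarget, load_apply, numApplied_apply, hd, hδ]
      split_ifs <;> push_cast <;> ring
    simp only [labelError, ht, sub_eq_add_neg]
    rw [nextMean_add, nextMean_const hfresh]
  have hrec := labelTarget_recursion k c i x hm1 δ
  have h4 : (if i ≤ c ∧ x.count s = k then lengthError c x else 0) =
      (if i ≤ c ∧ x.count s = k then total (lengthIs c) x else 0) -
        (if i ≤ c then δ * (m * poissonWeight c x.load) else 0) := by
    rw [hδ, lengthError]
    by_cases h5 : i ≤ c <;> by_cases h6 : x.count s = k <;> simp [h5, h6]
  -- A_k ≤ R m times the Taylor remainder 2/m², plus δ ≤ 1 times the Lipschitz bound 1/m.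
  have h5 : |d - (if i ≤ c then (x.numApplied k * ((1 / m) *
        (shiftSeq (fun c => poissonWeight c x.load) c - poissonWeight c x.load)) +
          δ * poissonWeight c x.load) / (c + 1) else 0)| ≤ (2 * R + 1) / m := by
    have hR0 : 0 ≤ R := by
      by_contra! hneg
      have : (n : ℝ) < 0 := hR.trans_lt (mul_neg_of_neg_of_pos hneg hm0)
      exact absurd this (not_lt.2 (Nat.cast_nonneg n))
    rw [hd]
    split_ifs with hic
    · rw [← sub_div, abs_div, abs_of_nonneg (by positivity : (0 : ℝ) ≤ c + 1)]
      refine (div_le_self (abs_nonneg _) (by linarith [Nat.cast_nonneg (α := ℝ) c])).trans ?_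
      have ht := abs_poissonWeight_taylor_le c x.load_nonneg (h := 1 / m) (by positivity)
      have hl := abs_poissonWeight_sub_le c x.load_nonneg
        (show 0 ≤ x.load + 1 / m by have := x.load_nonneg; positivity)
      rw [add_sub_cancel_left, abs_of_pos (by positivity : (0 : ℝ) < 1 / m)] at hl
      have hA : (x.numApplied k : ℝ) ≤ R * m :=
        le_trans (by exact_mod_cast x.numApplied_le k) hR
      set A : ℝ := (x.numApplied k : ℝ)
      have hA0 : 0 ≤ A := Nat.cast_nonneg _
      set p := poissonWeight c x.load
      set p' := poissonWeight c (x.load + 1 / m)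
      set q := shiftSeq (fun c => poissonWeight c x.load) c
      have e : (A + δ) * p' - A * p - (A * (1 / m * (q - p)) + δ * p) =
          A * (p' - p - 1 / m * (q - p)) + δ * (p' - p) := by ring
      rw [e]
      calc _ ≤ |A * (p' - p - 1 / m * (q - p))| + |δ * (p' - p)| := abs_add_le _ _
        _ ≤ R * m * (2 * (1 / m) ^ 2) + 1 * (1 / m) := by
            rw [abs_mul, abs_mul, abs_of_nonneg hA0, abs_of_nonneg hδ0]
            gcongr
        _ = _ := by field_simp
    · rw [sub_zero, abs_zero]; positivity
  rw [← hrec] at h5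
  rw [h3, h4]
  simp only [labelError]
  set V := x.nextMean s (fun u j => total (labelAt k (c + 1) i) (x.apply s u j))
  set U := total (labelAt k (c + 1) i) x
  set U1 := total (labelAt k c i) x
  set U2 := total (labelAt k c (i - 1)) x
  set Q := (if i ≤ c ∧ x.count s = k then total (lengthIs c) x else 0)
  set τ := labelTarget k (c + 1) i x
  set τ1 := labelTarget k c i x
  set τ2 := labelTarget k c (i - 1) x
  set P := (if i ≤ c then δ * (m * poissonWeight c x.load) else 0)
  have e : V - (τ + d) - (U - τ) - ((((c - i : ℕ) : ℝ) * (U1 - τ1) + (Q - P) + i * (U2 - τ2))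
      / (c + 1) - (U - τ)) / m =
      (V - U - ((((c - i : ℕ) : ℝ) * U1 + Q + i * U2) / (c + 1) - U) / m) -
      (d - ((((c - i : ℕ) : ℝ) * τ1 + P + i * τ2) / (c + 1) - τ) / m) := by
    ring
  rw [e]
  calc _ ≤ 2 * K / m + (2 * R + 1) / m := (abs_sub _ _).trans (add_le_add h1 h5)
    _ = _ := by ring

end ApplicationState
end

/-! ### The quadratic potential and its growth. -/

noncomputable section
open scoped BigOperators
namespace ApplicationState

variable {n m : ℕ}

/-- The length errors and the label errors as one family. -/
def stateError (k : ℕ) : ℕ × ℕ → ApplicationState n m → ℝ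
  | (c, 0), x => lengthError c x
  | (c, i + 1), x => labelError k c i x

/-- The sum of the squares of the errors. -/
def potential (k C L : ℕ) (x : ApplicationState n m) : ℝ :=
  ∑ q ∈ Finset.range (C + 1) ×ˢ Finset.range (L + 1), stateError k q x ^ 2

lemma potential_nonneg (k C L : ℕ) (x : ApplicationState n m) : 0 ≤ potential k C L x :=
  Finset.sum_nonneg fun _ _ => sq_nonneg _

lemma abs_stateError_le {k C L : ℕ} {q : ℕ × ℕ}
    (hq : q ∈ Finset.range (C + 1) ×ˢ Finset.range (L + 1)) (x : ApplicationState n m) :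
    |stateError k q x| ≤ √(potential k C L x) :=
  Real.abs_le_sqrt (Finset.single_le_sum (f := fun q => stateError k q x ^ 2)
    (fun _ _ => sq_nonneg _) hq)

/-- One application changes a total by at most 1, and a target by at most R (A_k ≤ R m times the
Lipschitz bound 1/m) plus one weight. -/
lemma abs_stateError_apply_sub_le (hm : 1 ≤ m) {R : ℝ} (hR : n ≤ R * m) (k : ℕ) (q : ℕ × ℕ)
    (x : ApplicationState n m) (s : Fin n) (u : Fin m) (i : ℕ) :
    |stateError k q (x.apply s u i) - stateError k q x| ≤ R + 2 := by
  have hm0 : (0 : ℝ) < m := by exact_mod_cast hm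
  have hR0 : 0 ≤ R := by
    by_contra! hneg
    have : (n : ℝ) < 0 := hR.trans_lt (mul_neg_of_neg_of_pos hneg hm0)
    exact absurd this (not_lt.2 (Nat.cast_nonneg n))
  have hl : ∀ c, |poissonWeight c (x.load + 1 / m) - poissonWeight c x.load| ≤ 1 / m := fun c => by
    have := abs_poissonWeight_sub_le c x.load_nonneg
      (show 0 ≤ x.load + 1 / m by have := x.load_nonneg; positivity)
    rwa [add_sub_cancel_left, abs_of_pos (by positivity : (0 : ℝ) < 1 / m)] at this
  obtain ⟨c, _ | j⟩ := q
  · have h1 := abs_total_apply_sub_le (lengthIs_mem_Icc c) x s u i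
    have h2 : |m * (poissonWeight c (x.load + 1 / m) - poissonWeight c x.load)| ≤ 1 := by
      rw [abs_mul, abs_of_pos hm0]
      calc _ ≤ m * (1 / m : ℝ) := by gcongr; exact hl c
        _ = 1 := by field_simp
    simp only [stateError, lengthError, load_apply]
    rw [abs_le] at h1 h2 ⊢
    constructor <;> linarith [h1.1, h1.2, h2.1, h2.2]
  · rcases c with _ | c
    · simp only [stateError, labelError_zero, sub_zero, abs_zero]
      positivity
    · have h1 := abs_total_apply_sub_le (labelAt_mem_Icc k (c + 1) j) x s u i
      have h2 : |labelTarget k (c + 1) j (x.apply s u i) - labelTarget k (c + 1) j x| ≤ R + 1 := by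
        simp only [labelTarget, load_apply, numApplied_apply]
        split_ifs with hjc hs
        all_goals try (rw [sub_zero, abs_zero]; positivity)
        all_goals
          rw [← sub_div, abs_div, abs_of_nonneg (by positivity : (0 : ℝ) ≤ c + 1)]
          refine (div_le_self (abs_nonneg _) (by linarith [Nat.cast_nonneg (α := ℝ) c])).trans ?_
          have hA : (x.numApplied k : ℝ) ≤ R * m :=
            le_trans (by exact_mod_cast x.numApplied_le k) hR
          have hpos : 0 ≤ x.load + 1 / m := by have := x.load_nonneg; positivity
          have h3 : |(x.numApplied k : ℝ) *
              (poissonWeight c (x.load + 1 / m) - poissonWeight c x.load)| ≤ R := by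
            rw [abs_mul, Nat.abs_cast]
            calc _ ≤ R * m * (1 / m) := by gcongr; exact hl c
              _ = R := by field_simp
          have h4 := poissonWeight_nonneg c hpos
          have h5 := poissonWeight_le_one c hpos
          push_cast
          rw [abs_le] at h3 ⊢
          constructor <;> linarith [h3.1, h3.2]
      simp only [stateError, labelError]
      rw [abs_le] at h1 h2 ⊢
      constructor <;> linarith [h1.1, h1.2, h2.1, h2.2]

/-- The drift of an error involves only errors with indices in the same finite box, so the family
closes. The coefficient c - i is absorbed by the denominator c + 1, and i by L. -/
lemma abs_drift_stateError_le {x : ApplicationState n m} (hx : x.agreeing.Nonempty) {s : Fin n}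
    {K : ℕ} (hs : x.count s < K) (hK : K ≤ m) {R : ℝ} (hR : n ≤ R * m) (k C L : ℕ) {q : ℕ × ℕ}
    (hq : q ∈ Finset.range (C + 1) ×ˢ Finset.range (L + 1)) :
    |x.nextMean s (fun u j => stateError k q (x.apply s u j)) - stateError k q x| ≤
      ((L + 3) * √(potential k C L x) + (2 * K + 2 * R + 2)) / m := by
  have hm0 : (0 : ℝ) < m := by exact_mod_cast (by omega : 0 < m)
  have hR0 : 0 ≤ R := by
    by_contra! hneg
    have : (n : ℝ) < 0 := hR.trans_lt (mul_neg_of_neg_of_pos hneg hm0)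
    exact absurd this (not_lt.2 (Nat.cast_nonneg n))
  have hfresh : (x.fresh s).Nonempty := by
    obtain ⟨ω, hω⟩ := hx
    rw [← Finset.card_pos, card_fresh (mem_agreeing.1 hω).1 s]
    omega
  have hN0 : 0 ≤ √(potential k C L x) := Real.sqrt_nonneg _
  have hN : ∀ c ≤ C, ∀ j ≤ L, |stateError k (c, j) x| ≤ √(potential k C L x) := fun c hc j hj =>
    abs_stateError_le (by simp; omega) x
  set N := √(potential k C L x)
  have hcomb : ∀ a b d e : ℝ, |a - b - d / m| ≤ e / m → |d| ≤ (L + 3) * N →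
      e ≤ 2 * K + 2 * R + 2 → |a - b| ≤ ((L + 3) * N + (2 * K + 2 * R + 2)) / m := by
    intro a b d e h1 h2 h3
    calc |a - b| = |(a - b - d / m) + d / m| := by congr 1; ring
      _ ≤ |a - b - d / m| + |d / m| := abs_add_le _ _
      _ ≤ e / m + (L + 3) * N / m := by
          gcongr
          rw [abs_div, abs_of_pos hm0]
          gcongr
      _ = ((L + 3) * N + e) / m := by ring
      _ ≤ _ := by gcongr
  obtain ⟨c, j⟩ := q
  simp only [Finset.mem_product, Finset.mem_range, Nat.lt_succ_iff] at hq
  have hL0 : (0 : ℝ) ≤ L := Nat.cast_nonneg L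
  rcases j with _ | i
  · refine hcomb _ _ _ _ (abs_drift_lengthError_le hx hs hK c) ?_ (by linarith)
    have h1 := hN c hq.1 0 (Nat.zero_le _)
    have h2 : |shiftSeq (fun c => lengthError c x) c| ≤ N := by
      rcases c with _ | c
      · simpa using hN0
      · exact hN c (by omega) 0 (Nat.zero_le _)
    refine (abs_sub _ _).trans ((add_le_add h2 h1).trans ?_)
    nlinarith
  · rcases c with _ | c
    · simp only [stateError, labelError_zero]
      rw [nextMean_const hfresh, sub_zero, abs_zero]
      positivity
    · refine hcomb _ _ _ _ (abs_drift_labelError_le hx hs hK hR k c i) ?_ (by linarith)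
      have h1 : |labelError k (c + 1) i x| ≤ N := hN (c + 1) hq.1 (i + 1) hq.2
      have h2 : |labelError k c i x| ≤ N := hN c (by omega) (i + 1) hq.2
      have h3 : |if i ≤ c ∧ x.count s = k then lengthError c x else 0| ≤ N := by
        split_ifs
        · exact hN c (by omega) 0 (Nat.zero_le _)
        · simpa using hN0
      have h4 : |labelError k c (i - 1) x| ≤ N := hN c (by omega) (i - 1 + 1) (by omega)
      have hc1 : (0 : ℝ) < c + 1 := by positivity
      have hci : ((c - i : ℕ) : ℝ) ≤ c := by exact_mod_cast Nat.sub_le c i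
      have hiL : (i : ℝ) ≤ L := by exact_mod_cast (by omega : i ≤ L)
      refine (abs_sub _ _).trans ?_
      rw [abs_div, abs_of_pos hc1]
      have h5 : |((c - i : ℕ) : ℝ) * labelError k c i x +
          (if i ≤ c ∧ x.count s = k then lengthError c x else 0) +
          i * labelError k c (i - 1) x| / (c + 1) ≤ (L + 2) * N := by
        rw [div_le_iff₀ hc1]
        calc _ ≤ |((c - i : ℕ) : ℝ) * labelError k c i x| +
              |if i ≤ c ∧ x.count s = k then lengthError c x else 0| +
              |i * labelError k c (i - 1) x| :=
              (abs_add_le _ _).trans (add_le_add_left (abs_add_le _ _) _)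
          _ ≤ c * N + N + L * N := by
              rw [abs_mul, abs_mul, Nat.abs_cast, Nat.abs_cast]
              gcongr
          _ ≤ (L + 2) * N * (c + 1) := by
              have : 0 ≤ N * c * (L + 1) := by positivity
              nlinarith
      linarith

/-- The mean drift of the potential. -/
lemma nextMean_potential_le {x : ApplicationState n m} (hx : x.agreeing.Nonempty) {s : Fin n}
    {K : ℕ} (hs : x.count s < K) (hK : K ≤ m) {R : ℝ} (hR : n ≤ R * m) (k C L : ℕ) :
    x.nextMean s (fun u j => potential k C L (x.apply s u j)) ≤
      (1 + 2 * ((C + 1) * (L + 1)) * (L + 2 * K + 2 * R + 5) / m) * potential k C L x +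
        (C + 1) * (L + 1) * (2 * (2 * K + 2 * R + 2) + (R + 2) ^ 2) := by
  have hm1 : 1 ≤ m := by omega
  have hm0 : (1 : ℝ) ≤ m := by exact_mod_cast hm1
  have hR0 : 0 ≤ R := by
    by_contra! hneg
    have : (n : ℝ) < 0 := hR.trans_lt (mul_neg_of_neg_of_pos hneg (by linarith))
    exact absurd this (not_lt.2 (Nat.cast_nonneg n))
  have hfresh : (x.fresh s).Nonempty := by
    obtain ⟨ω, hω⟩ := hx
    rw [← Finset.card_pos, card_fresh (mem_agreeing.1 hω).1 s]
    omega
  set I := Finset.range (C + 1) ×ˢ Finset.range (L + 1) with hI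
  set P := potential k C L x with hP
  have hP0 : 0 ≤ P := potential_nonneg k C L x
  have hN2 : √P * √P = P := Real.mul_self_sqrt hP0
  have hN0 : 0 ≤ √P := Real.sqrt_nonneg _
  -- This turns the cross term, of order √P, into one affine in P, as `sum_run_le` requires.
  have hN1 : √P ≤ 1 + P := by nlinarith [sq_nonneg (√P - 1)]
  set b : ℝ := 2 * K + 2 * R + 2 with hb
  have hb0 : 0 ≤ b := by positivity
  have hq : ∀ q ∈ I, x.nextMean s (fun u j => stateError k q (x.apply s u j) ^ 2) ≤
      stateError k q x ^ 2 +
        (2 * (L + 3 + b) / m * P + (2 * b + (R + 2) ^ 2)) := by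
    intro q hqI
    have h1 := nextMean_sq_le hfresh (a := stateError k q x) (B := R + 2)
      fun u _ j _ => abs_stateError_apply_sub_le hm1 hR k q x s u j
    have h2 := abs_drift_stateError_le hx hs hK hR k C L hqI
    have h3 := abs_stateError_le (k := k) hqI x
    set D := x.nextMean s (fun u j => stateError k q (x.apply s u j)) - stateError k q x
    have h4 : stateError k q x * D ≤ √P * (((L + 3) * √P + b) / m) :=
      (le_abs_self _).trans (by rw [abs_mul]; gcongr)
    have h5 : √P * (((L + 3) * √P + b) / m) ≤ (L + 3 + b) / m * P + b := by
      have e : √P * (((L + 3) * √P + b) / m) = ((L + 3) * P + b * √P) / m := by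
        calc _ = ((L + 3) * (√P * √P) + b * √P) / m := by ring
          _ = _ := by rw [hN2]
      rw [e]
      calc _ ≤ ((L + 3) * P + b * (1 + P)) / m := by gcongr
        _ = (L + 3 + b) / m * P + b / m := by ring
        _ ≤ _ := by gcongr; exact div_le_self hb0 hm0
    calc _ ≤ _ := h1
      _ ≤ stateError k q x ^ 2 + 2 * ((L + 3 + b) / m * P + b) + (R + 2) ^ 2 := by
          linarith
      _ = _ := by ring
  have hcard : (I.card : ℝ) = (C + 1) * (L + 1) := by
    rw [hI, Finset.card_product, Finset.card_range, Finset.card_range]; push_cast; ring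
  calc x.nextMean s (fun u j => potential k C L (x.apply s u j)) =
        ∑ q ∈ I, x.nextMean s (fun u j => stateError k q (x.apply s u j) ^ 2) :=
        nextMean_sum x s I fun q u j => stateError k q (x.apply s u j) ^ 2
    _ ≤ ∑ q ∈ I, (stateError k q x ^ 2 +
        (2 * (L + 3 + b) / m * P + (2 * b + (R + 2) ^ 2))) := Finset.sum_le_sum hq
    _ = P + (C + 1) * (L + 1) * (2 * (L + 3 + b) / m * P + (2 * b + (R + 2) ^ 2)) := by
        rw [Finset.sum_add_distrib, Finset.sum_const, nsmul_eq_mul, hcard]; rfl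
    _ = _ := by rw [hb]; ring

lemma potential_init (k C L : ℕ) : potential k C L (init n m) = 0 := by
  refine Finset.sum_eq_zero fun q _ => ?_
  have hload : (init n m).load = 0 := by simp [load, numApplications, init]
  have hap : (init n m).numApplied k = 0 := by simp [numApplied, init]
  have hnil : ∀ u, (init n m).applicants u = [] := fun _ => rfl
  obtain ⟨c, _ | i⟩ := q
  · rcases c with _ | c
    · simp [stateError, lengthError, hload, poissonWeight_zero_zero, total, hnil, lengthIs]
    · simp [stateError, lengthError, hload, poissonWeight_succ_zero, total, hnil, lengthIs]
  · rcases c with _ | c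
    · simp [stateError, labelError_zero]
    · simp [stateError, labelError, labelTarget, hap, total, hnil, labelAt]

/-- Every error has second moment `O(n)` at the end of deferred acceptance. -/
lemma exists_expect_potential_le (C L K : ℕ) {R : ℝ} (hR0 : 0 ≤ R) :
    ∃ A : ℝ, 0 ≤ A ∧ ∀ k n m : ℕ, K ≤ m → 1 ≤ m → (n : ℝ) ≤ R * m →
      𝔼 ω : (Fin n → Equiv.Perm (Fin m)) × (Fin m → Equiv.Perm (Fin n)),
        potential k C L (final K L ω) ≤ A * n := by
  set a : ℝ := 2 * ((C + 1) * (L + 1)) * (L + 2 * K + 2 * R + 5) with ha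
  set β : ℝ := (C + 1) * (L + 1) * (2 * (2 * K + 2 * R + 2) + (R + 2) ^ 2) with hβ
  have ha0 : 0 ≤ a := by positivity
  have hβ0 : 0 ≤ β := by positivity
  refine ⟨Real.exp (a * K * R) * (K * β), by positivity, fun k n m hK hm hR => ?_⟩
  have hm0 : (0 : ℝ) < m := by exact_mod_cast hm
  have h := sum_run_le hK (potential_nonneg (n := n) (m := m) k C L) (α := 1 + a / m) (β := β)
    (by have : 0 ≤ a / m := by positivity
        linarith) hβ0
    (fun x s hx hs _ => nextMean_potential_le hx hs.1 hK hR k C L) (n * K) (init n m)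
    (fun _ => Nat.zero_le _) (L := L)
  rw [agreeing_init, potential_init, zero_add] at h
  rw [Finset.expect_eq_sum_div_card]
  refine div_le_of_le_mul₀ (Nat.cast_nonneg _) (by positivity) (h.trans ?_)
  -- The Grönwall factor stays bounded because the number n * K of steps is at most K * R * m.
  have h1 : (1 + a / m) ^ (n * K) ≤ Real.exp (a * K * R) := by
    calc (1 + a / m) ^ (n * K) ≤ Real.exp (a / m) ^ (n * K) := by
          gcongr; rw [add_comm]; exact Real.add_one_le_exp _
      _ = Real.exp (n * K * (a / m)) := by rw [← Real.exp_nat_mul]; push_cast; rfl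
      _ ≤ _ := Real.exp_le_exp.2 <| by
          calc (n : ℝ) * K * (a / m) ≤ R * m * K * (a / m) := by gcongr
            _ = a * K * R := by field_simp
  have h2 : (1 + a / m) ^ (n * K) * (((n * K : ℕ) : ℝ) * β) ≤
      Real.exp (a * K * R) * (K * β) * n := by
    calc _ ≤ Real.exp (a * K * R) * (((n * K : ℕ) : ℝ) * β) := by gcongr
      _ = _ := by push_cast; ring
  exact (mul_le_mul_of_nonneg_left h2 (Nat.cast_nonneg _)).trans (mul_comm _ _).le

end ApplicationState
end

/-! ### Applications to all positions succeed at the same rate. -/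

noncomputable section
open scoped BigOperators

lemma hasSum_mul_poissonWeight (x : ℝ) : HasSum (fun c : ℕ => c * poissonWeight c x) x := by
  have h := (hasSum_poissonWeight x).mul_left x
  rw [mul_one] at h
  rw [← hasSum_nat_add_iff' 1]
  simpa [succ_mul_poissonWeight_succ] using h

/-- Markov's inequality for the tail: for c > C, min L c ≤ L ≤ (L/(C+1)) c, and the mean is x. -/
lemma sum_min_mul_poissonWeight_bounds (L C : ℕ) {x : ℝ} (hx : 0 ≤ x) :
    ∑ c ∈ Finset.range (C + 1), poissonWeight c x * ((min L c : ℕ) : ℝ) ≤ poissonMin L x ∧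
      poissonMin L x ≤ ∑ c ∈ Finset.range (C + 1), poissonWeight c x * ((min L c : ℕ) : ℝ) +
        L / (C + 1) * x := by
  have h := hasSum_poissonMin L x
  refine ⟨sum_le_hasSum _ (fun c _ => mul_nonneg (poissonWeight_nonneg c hx) (Nat.cast_nonneg _)) h,
    ?_⟩
  have h1 := hasSum_sum_of_ne_finset_zero (s := Finset.range (C + 1))
    (f := fun c => if c ∈ Finset.range (C + 1) then poissonWeight c x * ((min L c : ℕ) : ℝ) else 0)
    (L := SummationFilter.unconditional ℕ) (fun c hc => if_neg hc)
  rw [Finset.sum_congr rfl fun c hc => if_pos hc] at h1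
  refine hasSum_le (fun c => ?_) h (h1.add ((hasSum_mul_poissonWeight x).mul_left ((L : ℝ) / (C + 1))))
  have hp := poissonWeight_nonneg c hx
  by_cases hc : c ∈ Finset.range (C + 1)
  · rw [if_pos hc]
    have : 0 ≤ (L : ℝ) / (C + 1) * (c * poissonWeight c x) := by positivity
    linarith
  · rw [if_neg hc, zero_add]
    rw [Finset.mem_range, not_lt] at hc
    have hc' : (C : ℝ) + 1 ≤ c := by exact_mod_cast hc
    have h2 : ((min L c : ℕ) : ℝ) ≤ L / (C + 1) * c := by
      calc ((min L c : ℕ) : ℝ) ≤ L := by exact_mod_cast min_le_left L c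
        _ = L / (C + 1) * (C + 1) := by field_simp
        _ ≤ _ := by gcongr
    calc poissonWeight c x * ((min L c : ℕ) : ℝ) ≤ poissonWeight c x * (L / (C + 1) * c) := by
          gcongr
      _ = _ := by ring

/-- By (c+1) p_{c+1} = x p_c a factor x comes out of the truncated sum, so after division the error
does not depend on x. -/
lemma abs_sum_min_div_mul_poissonWeight_sub_le (L C : ℕ) {x : ℝ} (hx : 0 < x) :
    |∑ c ∈ Finset.range C, ((min L (c + 1) : ℕ) : ℝ) / (c + 1) * poissonWeight c x -
      poissonMin L x / x| ≤ L / (C + 1) := by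
  have h := sum_min_mul_poissonWeight_bounds L C hx.le
  have e : ∑ c ∈ Finset.range (C + 1), poissonWeight c x * ((min L c : ℕ) : ℝ) =
      x * ∑ c ∈ Finset.range C, ((min L (c + 1) : ℕ) : ℝ) / (c + 1) * poissonWeight c x := by
    rw [Finset.sum_range_succ', Finset.mul_sum]
    simp only [Nat.min_zero, Nat.cast_zero, mul_zero, add_zero]
    refine Finset.sum_congr rfl fun c _ => ?_
    have hs := succ_mul_poissonWeight_succ c x
    have hc : (c : ℝ) + 1 ≠ 0 := by positivity
    calc _ = ((c : ℝ) + 1) * poissonWeight (c + 1) x * ((min L (c + 1) : ℕ) : ℝ) / (c + 1) := by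
          field_simp
      _ = _ := by rw [hs]; ring
  rw [e] at h
  set S := ∑ c ∈ Finset.range C, ((min L (c + 1) : ℕ) : ℝ) / (c + 1) * poissonWeight c x
  have h1 : S ≤ poissonMin L x / x := by rw [le_div_iff₀ hx]; linarith [h.1]
  have h2 : poissonMin L x / x ≤ S + L / (C + 1) := by rw [div_le_iff₀ hx]; linarith [h.2]
  rw [abs_le]
  have : (0 : ℝ) ≤ L / (C + 1) := by positivity
  constructor <;> linarith

/-- The empirical counterpart of the tail bound: a list longer than C has at most L relevant
entries, which is at most L/(C+1) times its length. -/
lemma sum_labelAt_bounds {α : Type*} (k C L : ℕ) (l : List (α × ℕ)) :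
    ∑ c ∈ Finset.range (C + 1), ∑ i ∈ Finset.range L, labelAt k c i l ≤
        ((l.take L).countP fun a => a.2 = k : ℕ) ∧
      (((l.take L).countP fun a => a.2 = k : ℕ) : ℝ) ≤
        ∑ c ∈ Finset.range (C + 1), ∑ i ∈ Finset.range L, labelAt k c i l +
          L / (C + 1) * l.length := by
  have h1 : ∑ c ∈ Finset.range (C + 1), ∑ i ∈ Finset.range L, labelAt k c i l =
      if l.length ≤ C then (((l.take L).countP fun a => a.2 = k : ℕ) : ℝ) else 0 := by
    have h : ∀ c, ∑ i ∈ Finset.range L, labelAt k c i l =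
        if l.length = c then (((l.take L).countP fun a => a.2 = k : ℕ) : ℝ) else 0 := fun c => by
      rw [← List.sum_range_getElem?_eq_countP]
      unfold labelAt
      by_cases hc : l.length = c
      · simp only [hc, true_and, if_true]
        push_cast
        rfl
      · simp only [hc, false_and, if_false, Finset.sum_const_zero]
    rw [Finset.sum_congr rfl fun c _ => h c, Finset.sum_ite_eq]
    simp only [Finset.mem_range, Nat.lt_succ_iff]
  have h2 : (0 : ℝ) ≤ L / (C + 1) * l.length := by positivity
  rw [h1]
  split_ifs with h
  · exact ⟨le_rfl, by linarith⟩
  · refine ⟨Nat.cast_nonneg _, ?_⟩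
    rw [zero_add]
    have h3 : (C : ℝ) + 1 ≤ l.length := by exact_mod_cast not_le.1 h
    calc (((l.take L).countP fun a => a.2 = k : ℕ) : ℝ) ≤ L := by
          exact_mod_cast List.countP_le_length.trans (List.length_take_le _ _)
      _ = L / (C + 1) * (C + 1) := by field_simp
      _ ≤ _ := by gcongr

namespace ApplicationState

variable {n m : ℕ}

lemma sum_labelTarget (k C L : ℕ) (x : ApplicationState n m) :
    ∑ c ∈ Finset.range (C + 1), ∑ i ∈ Finset.range L, labelTarget k c i x =
      x.numApplied k * ∑ c ∈ Finset.range C,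
        ((min L (c + 1) : ℕ) : ℝ) / (c + 1) * poissonWeight c x.load := by
  rw [Finset.sum_range_succ', Finset.mul_sum]
  simp only [labelTarget, Finset.sum_const_zero, add_zero]
  refine Finset.sum_congr rfl fun c _ => ?_
  rw [← Finset.sum_filter, Finset.sum_const, nsmul_eq_mul,
    show (Finset.range L).filter (fun i => i ≤ c) = Finset.range (min L (c + 1)) by
      ext i; simp only [Finset.mem_filter, Finset.mem_range]; omega, Finset.card_range]
  ring

/-- The applications of each kind are successful at nearly the same rate. -/
lemma Valid.abs_numHeld_sub_le {K L : ℕ}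
    {ω : (Fin n → Equiv.Perm (Fin m)) × (Fin m → Equiv.Perm (Fin n))} {x : ApplicationState n m}
    (hx : x.Valid K L ω) (hK : K ≤ m) (hload : 0 < x.load) (k C : ℕ) :
    |x.numHeld L k - x.numApplied k * (poissonMin L x.load / x.load)| ≤
      (C + 1) * L * √(potential k C L x) + L / (C + 1) * (n * K + n) := by
  set T := ∑ c ∈ Finset.range (C + 1), ∑ i ∈ Finset.range L, total (labelAt k c i) x
  have hT : T = ∑ u, ∑ c ∈ Finset.range (C + 1), ∑ i ∈ Finset.range L,
      labelAt k c i (x.applicants u) := by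
    simp only [T, total]
    rw [Finset.sum_comm]
    rw [Finset.sum_congr rfl fun i _ => Finset.sum_comm, Finset.sum_comm]
    exact Finset.sum_congr rfl fun u _ => Finset.sum_comm
  have hH : (x.numHeld L k : ℝ) =
      ∑ u, (((x.applicants u).take L).countP (fun a => a.2 = k) : ℝ) := by
    rw [← hx.sum_countP_take k]; push_cast; rfl
  have hlen : ∑ u, (L : ℝ) / (C + 1) * (x.applicants u).length ≤ L / (C + 1) * (n * K) := by
    rw [← Finset.mul_sum]
    gcongr
    have h1 := hx.sum_length_applicants hK
    have h2 := hx.numApplications_le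
    exact_mod_cast h1.trans_le h2
  -- First error: universities with more than C applicants, given n * K applications at most in
  -- total.
  have h1 : |(x.numHeld L k : ℝ) - T| ≤ L / (C + 1) * (n * K) := by
    have hb := fun u => sum_labelAt_bounds k C L (x.applicants u)
    have h2 : T ≤ x.numHeld L k := by
      rw [hT, hH]; exact Finset.sum_le_sum fun u _ => (hb u).1
    have h3 : (x.numHeld L k : ℝ) ≤ T + L / (C + 1) * (n * K) := by
      rw [hT, hH]
      refine (Finset.sum_le_sum fun u _ => (hb u).2).trans ?_
      rw [Finset.sum_add_distrib]
      linarith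
    rw [abs_of_nonneg (by linarith)]
    linarith
  -- Second error: (C + 1) * L label errors, each at most the root of the potential.
  have h2 : |T - x.numApplied k * ∑ c ∈ Finset.range C,
      ((min L (c + 1) : ℕ) : ℝ) / (c + 1) * poissonWeight c x.load| ≤
      (C + 1) * L * √(potential k C L x) := by
    rw [← sum_labelTarget, ← Finset.sum_sub_distrib]
    simp_rw [← Finset.sum_sub_distrib]
    calc _ ≤ ∑ c ∈ Finset.range (C + 1), ∑ i ∈ Finset.range L, √(potential k C L x) := by
          refine (Finset.abs_sum_le_sum_abs _ _).trans (Finset.sum_le_sum fun c hc => ?_)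
          refine (Finset.abs_sum_le_sum_abs _ _).trans (Finset.sum_le_sum fun i hi => ?_)
          exact abs_stateError_le (q := (c, i + 1)) (Finset.mem_product.2
            ⟨hc, Finset.mem_range.2 (by have := Finset.mem_range.1 hi; simp only; omega)⟩) x
      _ = _ := by
          simp only [Finset.sum_const, Finset.card_range, nsmul_eq_mul]; push_cast; ring
  -- Third error: truncation of the Poisson sum at C.
  have h3 : |x.numApplied k * ∑ c ∈ Finset.range C,
      ((min L (c + 1) : ℕ) : ℝ) / (c + 1) * poissonWeight c x.load -
      x.numApplied k * (poissonMin L x.load / x.load)| ≤ L / (C + 1) * n := by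
    rw [← mul_sub, abs_mul, Nat.abs_cast, mul_comm]
    gcongr
    · exact abs_sum_min_div_mul_poissonWeight_sub_le L C hload
    · exact x.numApplied_le k
  rw [abs_le] at h1 h2 h3 ⊢
  constructor <;> linarith [h1.1, h1.2, h2.1, h2.2, h3.1, h3.2]

/-- Mean form of the equal success rates at the end of deferred acceptance. -/
lemma exists_expect_abs_numHeld_sub_le (L K : ℕ) (hK : 1 ≤ K) {R : ℝ} (hR0 : 0 ≤ R) {ε : ℝ}
    (hε : 0 < ε) :
    ∃ N : ℕ, ∀ k n m : ℕ, N ≤ n → 1 ≤ n → K ≤ m → (n : ℝ) ≤ R * m →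
      𝔼 ω : (Fin n → Equiv.Perm (Fin m)) × (Fin m → Equiv.Perm (Fin n)),
        |((final K L ω).numHeld L k : ℝ) - (final K L ω).numApplied k *
          (poissonMin L (final K L ω).load / (final K L ω).load)| ≤ ε * n := by
  obtain ⟨C, hC⟩ := exists_nat_ge (2 * L * (K + 1) / ε)
  obtain ⟨A, hA0, hA⟩ := exists_expect_potential_le C L K hR0
  set b : ℝ := (C + 1) * L with hb
  have hb0 : 0 ≤ b := by positivity
  -- Chosen so that 2bδ ≤ ε/2; C leaves ε/2 for the truncation errors, and n ≥ A/δ² makes the mean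
  -- potential at most (δn)².
  set δ : ℝ := ε / (4 * (b + 1)) with hδ
  have hδ0 : 0 < δ := by positivity
  obtain ⟨N, hN⟩ := exists_nat_ge (A / δ ^ 2)
  refine ⟨N, fun k n m hNn hn hKm hR => ?_⟩
  have hn0 : (0 : ℝ) < n := by exact_mod_cast hn
  have hm : 1 ≤ m := hK.trans hKm
  have hm0 : (0 : ℝ) < m := by exact_mod_cast hm
  have hCp : (0 : ℝ) < C + 1 := by positivity
  have htail : (L : ℝ) / (C + 1) * (n * K + n) ≤ ε / 2 * n := by
    rw [div_le_iff₀ hε] at hC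
    rw [div_mul_eq_mul_div, div_le_iff₀ hCp]
    nlinarith
  -- This linearises the square root, so that a bound on the mean of the potential suffices.
  have hsqrt : ∀ P : ℝ, 0 ≤ P → √P ≤ δ * n + P / (δ * n) := fun P hP => by
    have hd : 0 < δ * n := by positivity
    have h1 : √P * (δ * n) ≤ (δ * n) ^ 2 + P := by
      have := Real.mul_self_sqrt hP
      nlinarith [sq_nonneg (√P - δ * n), sq_nonneg (√P), sq_nonneg (δ * n)]
    calc √P = √P * (δ * n) / (δ * n) := by field_simp
      _ ≤ ((δ * n) ^ 2 + P) / (δ * n) := by gcongr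
      _ = _ := by field_simp
  calc _ ≤ 𝔼 ω : (Fin n → Equiv.Perm (Fin m)) × (Fin m → Equiv.Perm (Fin n)),
        (b / (δ * n) * potential k C L (final K L ω) + (b * (δ * n) + ε / 2 * n)) := by
        refine Finset.expect_le_expect fun ω _ => ?_
        have hx := valid_final hKm L ω
        have hload : 0 < (final K L ω).load := by
          have h1 := hx.numApplied_zero (not_active_final hKm L ω) hK
          have h2 : 0 < (final K L ω).numApplications := by
            rw [← hx.sum_numApplied]
            exact lt_of_lt_of_le (by rw [h1]; exact hn)
              (Finset.single_le_sum (f := fun k => (final K L ω).numApplied k)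
                (fun _ _ => Nat.zero_le _) (Finset.mem_range.2 hK))
          rw [load]
          positivity
        have h1 := hx.abs_numHeld_sub_le hKm hload k C
        have h2 := mul_le_mul_of_nonneg_left
          (hsqrt _ (potential_nonneg k C L (final K L ω))) hb0
        rw [← hb] at h1
        have e : b * (δ * n + potential k C L (final K L ω) / (δ * n)) =
            b / (δ * n) * potential k C L (final K L ω) + b * (δ * n) := by ring
        linarith
    _ = b / (δ * n) * (𝔼 ω : (Fin n → Equiv.Perm (Fin m)) × (Fin m → Equiv.Perm (Fin n)),
          potential k C L (final K L ω)) + (b * (δ * n) + ε / 2 * n) := by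
        rw [Finset.expect_add_distrib, ← Finset.mul_expect,
          Finset.expect_const Finset.univ_nonempty]
    _ ≤ b / (δ * n) * (A * n) + (b * (δ * n) + ε / 2 * n) := by
        gcongr
        exact hA k n m hKm hm hR
    _ ≤ b * (δ * n) + (b * (δ * n) + ε / 2 * n) := by
        refine add_le_add_left ?_ _
        have hAn : A ≤ δ ^ 2 * n := by
          rw [div_le_iff₀ (by positivity)] at hN
          have : (N : ℝ) ≤ n := by exact_mod_cast hNn
          nlinarith [sq_nonneg δ]
        calc b / (δ * n) * (A * n) = b / δ * A := by field_simp
          _ ≤ b / δ * (δ ^ 2 * n) := mul_le_mul_of_nonneg_left hAn (by positivity)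
          _ = _ := by field_simp
    _ ≤ ε * n := by
        have : 2 * (b * δ) ≤ ε / 2 := by
          rw [hδ, mul_div_assoc', mul_div_assoc', div_le_iff₀ (by positivity)]
          nlinarith
        nlinarith

end ApplicationState
end

/-! ### From equal rates to the consistency equation. -/

noncomputable section
open scoped BigOperators

/-- The acceptance curve per student in a large market. -/
def limitCurve (M : ℝ) (L : ℕ) (t : ℝ) : ℝ := M * poissonMin L (t / M)

lemma isAcceptanceCurve_limitCurve {L : ℕ} (hL : 1 ≤ L) {M : ℝ} (hM : 0 < M) :
    IsAcceptanceCurve (limitCurve M L) := isAcceptanceCurve_poisson hL hM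

lemma acceptedPoisson_eq_limitCurve {n m : ℕ} (hn : 1 ≤ n) {M : ℝ}
    (hm : (m : ℝ) = M * n) (L : ℕ) (x : ℝ) :
    acceptedPoisson m L x = n * limitCurve M L (x / n) := by
  have hn0 : (n : ℝ) ≠ 0 := by positivity
  rw [acceptedPoisson_eq, limitCurve, hm, div_div, mul_comm (n : ℝ) M]
  ring

lemma limitCurve_div {n m : ℕ} (hn : 1 ≤ n) {M : ℝ}
    (hm : (m : ℝ) = M * n) (L : ℕ) (x : ℝ) :
    limitCurve M L (x / n) / (x / n) = acceptedPoisson m L x / x := by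
  rw [acceptedPoisson_eq_limitCurve hn hm, div_div_eq_mul_div, mul_comm]

/-- The Poisson form is homogeneous when m = Mn, so per student the equation does not depend on n.
-/
lemma consistencyDefect_limitCurve {n m : ℕ} (hn : 1 ≤ n) {M : ℝ}
    (hm : (m : ℝ) = M * n) (L K : ℕ) (x : ℝ) :
    consistencyDefect (limitCurve M L) 1 K (x / n) =
      consistencyDefect (acceptedPoisson m L) n K x := by
  have hn0 : (n : ℝ) ≠ 0 := by positivity
  rw [consistencyDefect, consistencyDefect, limitCurve_div hn hm,
    acceptedPoisson_eq_limitCurve hn hm, mul_div_cancel_left₀ _ hn0, div_one]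

/-- A sequence losing nearly the proportion `p` of its value at each step is nearly geometric. -/
lemma abs_sub_geometric_le {a h : ℕ → ℝ} {p : ℝ} (hp0 : 0 ≤ p) (hp1 : p ≤ 1) {K : ℕ}
    (h0 : a 0 = 1) (hs : ∀ k, k + 1 < K → a (k + 1) + h k = a k) {k : ℕ} (hk : k < K) :
    |a k - (1 - p) ^ k| ≤ ∑ j ∈ Finset.range k, |h j - a j * p| := by
  induction k with
  | zero => simp [h0]
  | succ k ih =>
    rw [Finset.sum_range_succ]
    have e : a (k + 1) - (1 - p) ^ (k + 1) =
        (1 - p) * (a k - (1 - p) ^ k) - (h k - a k * p) := by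
      rw [← hs k hk]; ring
    rw [e]
    refine (abs_sub _ _).trans (add_le_add_left ?_ _)
    rw [abs_mul, abs_of_nonneg (by linarith : 0 ≤ 1 - p)]
    exact (mul_le_of_le_one_left (abs_nonneg _) (by linarith)).trans (ih (by omega))

/-- Since a k is nearly (1-p)^k, the sum is nearly geometric; this produces the right-hand side of
the consistency equation. -/
lemma abs_mul_sum_sub_le {a h : ℕ → ℝ} {p : ℝ} (hp0 : 0 ≤ p) (hp1 : p ≤ 1) {K : ℕ}
    (h0 : a 0 = 1) (hs : ∀ k, k + 1 < K → a (k + 1) + h k = a k) :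
    |p * ∑ k ∈ Finset.range K, a k - (1 - (1 - p) ^ K)| ≤
      K * ∑ j ∈ Finset.range K, |h j - a j * p| := by
  have e : 1 - (1 - p) ^ K = p * ∑ k ∈ Finset.range K, (1 - p) ^ k := by
    rw [← geom_sum_mul_neg]; ring
  rw [e, ← mul_sub, ← Finset.sum_sub_distrib, abs_mul, abs_of_nonneg hp0]
  refine (mul_le_of_le_one_left (abs_nonneg _) hp1).trans ?_
  calc _ ≤ ∑ k ∈ Finset.range K, |a k - (1 - p) ^ k| := Finset.abs_sum_le_sum_abs _ _
    _ ≤ ∑ _k ∈ Finset.range K, ∑ j ∈ Finset.range K, |h j - a j * p| :=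
        Finset.sum_le_sum fun k hk => (abs_sub_geometric_le hp0 hp1 h0 hs
          (Finset.mem_range.1 hk)).trans (Finset.sum_le_sum_of_subset_of_nonneg
            (Finset.range_mono (Finset.mem_range.1 hk).le) fun _ _ _ => abs_nonneg _)
    _ = _ := by rw [Finset.sum_const, Finset.card_range, nsmul_eq_mul]

/-- On a compact set, a function vanishing at the zeros of `f` is small where `f` is small. -/
lemma IsCompact.exists_le_add_mul_abs {s : Set ℝ} (hs : IsCompact s) {f φ : ℝ → ℝ}
    (hf : ContinuousOn f s) (hφ : ContinuousOn φ s)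
    (h0 : ∀ t ∈ s, f t = 0 → φ t = 0) {δ : ℝ} (hδ : 0 < δ) :
    ∃ C, 0 ≤ C ∧ ∀ t ∈ s, φ t ≤ δ + C * |f t| := by
  obtain ⟨B, hB⟩ := hs.exists_bound_of_continuousOn hφ
  -- Where φ ≥ δ, f has no zero, so |f| has a positive minimum there by compactness. The bound of φ
  -- divided by this minimum serves as C.
  have hc : IsCompact (s ∩ φ ⁻¹' Set.Ici δ) :=
    hs.of_isClosed_subset (hφ.preimage_isClosed_of_isClosed hs.isClosed isClosed_Ici)
      Set.inter_subset_left
  rcases (s ∩ φ ⁻¹' Set.Ici δ).eq_empty_or_nonempty with he | hne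
  · refine ⟨0, le_rfl, fun t ht => ?_⟩
    by_contra! h
    have : t ∈ s ∩ φ ⁻¹' Set.Ici δ := ⟨ht, by simp only [Set.mem_preimage, Set.mem_Ici]; linarith⟩
    rw [he] at this
    exact this
  · obtain ⟨t₀, ht₀, hmin⟩ := hc.exists_isMinOn hne
      (hf.abs.mono (Set.inter_subset_left (t := φ ⁻¹' Set.Ici δ)))
    have hpos : 0 < |f t₀| := abs_pos.2 fun h => by
      have h1 : δ ≤ φ t₀ := ht₀.2
      rw [h0 t₀ ht₀.1 h] at h1
      linarith
    have hB0 : 0 ≤ B := (norm_nonneg _).trans (hB t₀ ht₀.1)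
    refine ⟨B / |f t₀|, by positivity, fun t ht => ?_⟩
    have hC : 0 ≤ B / |f t₀| := by positivity
    by_cases h : δ ≤ φ t
    · have h1 : |f t₀| ≤ |f t| := hmin ⟨ht, h⟩
      have h2 : φ t ≤ B := (le_abs_self _).trans (hB t ht)
      have h3 : B / |f t₀| * |f t₀| ≤ B / |f t₀| * |f t| := by gcongr
      rw [div_mul_cancel₀ _ hpos.ne'] at h3
      linarith
    · have : 0 ≤ B / |f t₀| * |f t| := by positivity
      linarith

namespace ApplicationState

variable {n m : ℕ}

lemma Valid.numApplications_mem_Icc {K L : ℕ}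
    {ω : (Fin n → Equiv.Perm (Fin m)) × (Fin m → Equiv.Perm (Fin n))} {x : ApplicationState n m}
    (hx : x.Valid K L ω) (hterm : ¬ ∃ s, x.Active K L s) (hK : 1 ≤ K) :
    n ≤ x.numApplications ∧ x.numApplications ≤ n * K := by
  refine ⟨?_, hx.numApplications_le⟩
  rw [← hx.sum_numApplied]
  refine (hx.numApplied_zero hterm hK).symm.trans_le ?_
  exact Finset.single_le_sum (f := fun k => x.numApplied k) (fun _ _ => Nat.zero_le _)
    (Finset.mem_range.2 hK)

lemma load_eq {M : ℝ} (hn : 1 ≤ n) (hm : (m : ℝ) = M * n) (L : ℕ)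
    (x : ApplicationState n m) :
    poissonMin L x.load / x.load =
      limitCurve M L (x.numApplications / n) / (x.numApplications / n) := by
  rw [limitCurve_div hn hm, acceptedPoisson_eq, load, div_div_eq_mul_div, mul_comm]

/-- The total number of applications nearly solves the consistency equation. -/
lemma Valid.abs_consistencyDefect_le {K L : ℕ} {M : ℝ}
    {ω : (Fin n → Equiv.Perm (Fin m)) × (Fin m → Equiv.Perm (Fin n))} {x : ApplicationState n m}
    (hx : x.Valid K L ω) (hterm : ¬ ∃ s, x.Active K L s) (hK : 1 ≤ K) (hL : 1 ≤ L) (hn : 1 ≤ n)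
    (hM : 0 < M) (hm : (m : ℝ) = M * n) :
    |consistencyDefect (limitCurve M L) 1 K (x.numApplications / n)| ≤
      K / n * ∑ k ∈ Finset.range K,
        |(x.numHeld L k : ℝ) - x.numApplied k * (poissonMin L x.load / x.load)| := by
  have hn0 : (0 : ℝ) < n := by exact_mod_cast hn
  have ht : (0 : ℝ) < x.numApplications / n := by
    have : (n : ℝ) ≤ x.numApplications := by
      exact_mod_cast (hx.numApplications_mem_Icc hterm hK).1
    exact div_pos (by linarith) hn0
  rw [load_eq hn hm L]
  set t : ℝ := x.numApplications / n with ht'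
  set p := limitCurve M L t / t with hp
  have hG := isAcceptanceCurve_limitCurve hL hM
  have h := abs_mul_sum_sub_le (a := fun k => (x.numApplied k : ℝ) / n)
    (h := fun k => (x.numHeld L k : ℝ) / n) (hG.div_pos ht).le (hG.div_le_one ht) (K := K)
    (by simp only [hx.numApplied_zero hterm hK]; exact div_self hn0.ne')
    (fun k hk => by
      rw [← add_div]
      congr 1
      exact_mod_cast hx.numApplied_add_numHeld hterm hk)
  rw [← hp] at h
  have hsum : ∑ k ∈ Finset.range K, (x.numApplied k : ℝ) / n = t := by
    rw [← Finset.sum_div, ht', ← hx.sum_numApplied]; push_cast; rfl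
  have e : consistencyDefect (limitCurve M L) 1 K t = p * t - (1 - (1 - p) ^ K) := by
    rw [consistencyDefect, ← hp, hp, div_mul_cancel₀ _ ht.ne', div_one]; ring
  rw [hsum] at h
  rw [e]
  refine h.trans (le_of_eq ?_)
  rw [div_mul_eq_mul_div, mul_div_assoc, Finset.sum_div]
  congr 1
  refine Finset.sum_congr rfl fun k _ => ?_
  rw [← abs_of_pos hn0, ← abs_div, abs_of_pos hn0]
  congr 1
  ring

/-- Total applications and first choices concentrate near their values in a large market. -/
lemma exists_expect_errors_le (L K : ℕ) (hK : 1 ≤ K) (hL : 1 ≤ L) {M : ℝ} (hM : 0 < M) {ε : ℝ}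
    (hε : 0 < ε) :
    ∃ N : ℕ, ∀ n m : ℕ, N ≤ n → 1 ≤ n → K ≤ m → (m : ℝ) = M * n →
      (𝔼 ω : (Fin n → Equiv.Perm (Fin m)) × (Fin m → Equiv.Perm (Fin n)),
        |consistencyDefect (limitCurve M L) 1 K ((final K L ω).numApplications / n)|) ≤ ε ∧
      (𝔼 ω : (Fin n → Equiv.Perm (Fin m)) × (Fin m → Equiv.Perm (Fin n)),
        |((final K L ω).numHeld L 0 : ℝ) / n -
          limitCurve M L ((final K L ω).numApplications / n) /
            ((final K L ω).numApplications / n)|) ≤ ε := by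
  have hK1 : (1 : ℝ) ≤ K := by exact_mod_cast hK
  -- One factor K comes from `abs_mul_sum_sub_le`, the other from the sum over the K positions.
  obtain ⟨N, hN⟩ := exists_expect_abs_numHeld_sub_le L K hK (R := M⁻¹) (by positivity)
    (ε := ε / (K * K)) (by positivity)
  refine ⟨N, fun n m hNn hn hKm hm => ?_⟩
  have hn0 : (0 : ℝ) < n := by exact_mod_cast hn
  have hR : (n : ℝ) ≤ M⁻¹ * m := by rw [hm]; field_simp; exact le_rfl
  have hE := fun k => hN k n m hNn hn hKm hR
  constructor
  · calc _ ≤ 𝔼 ω : (Fin n → Equiv.Perm (Fin m)) × (Fin m → Equiv.Perm (Fin n)),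
          K / n * ∑ k ∈ Finset.range K, |((final K L ω).numHeld L k : ℝ) -
            (final K L ω).numApplied k * (poissonMin L (final K L ω).load /
              (final K L ω).load)| :=
          Finset.expect_le_expect fun ω _ => (valid_final hKm L ω).abs_consistencyDefect_le
            (not_active_final hKm L ω) hK hL hn hM hm
      _ = K / n * ∑ k ∈ Finset.range K,
          𝔼 ω : (Fin n → Equiv.Perm (Fin m)) × (Fin m → Equiv.Perm (Fin n)),
            |((final K L ω).numHeld L k : ℝ) - (final K L ω).numApplied k *
              (poissonMin L (final K L ω).load / (final K L ω).load)| := by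
          rw [← Finset.mul_expect, Finset.expect_sum_comm]
      _ ≤ K / n * ∑ _k ∈ Finset.range K, ε / (K * K) * n := by
          gcongr with k _
          exact hE k
      _ = ε := by
          rw [Finset.sum_const, Finset.card_range, nsmul_eq_mul]
          field_simp
  · calc _ = 𝔼 ω : (Fin n → Equiv.Perm (Fin m)) × (Fin m → Equiv.Perm (Fin n)),
          1 / n * |((final K L ω).numHeld L 0 : ℝ) - (final K L ω).numApplied 0 *
            (poissonMin L (final K L ω).load / (final K L ω).load)| := by
          refine Finset.expect_congr rfl fun ω _ => ?_
          rw [(valid_final hKm L ω).numApplied_zero (not_active_final hKm L ω) hK,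
            load_eq hn hm L]
          rw [show ∀ z : ℝ, 1 / n * |z| = |1 / n * z| from fun z => by
            rw [abs_mul, abs_of_pos (by positivity : (0 : ℝ) < 1 / n)]]
          congr 1
          field_simp
      _ = 1 / n * 𝔼 ω : (Fin n → Equiv.Perm (Fin m)) × (Fin m → Equiv.Perm (Fin n)),
          |((final K L ω).numHeld L 0 : ℝ) - (final K L ω).numApplied 0 *
            (poissonMin L (final K L ω).load / (final K L ω).load)| := by
          rw [← Finset.mul_expect]
      _ ≤ 1 / n * (ε / (K * K) * n) := by
          gcongr
          exact hE 0
      _ = ε / (K * K) := by field_simp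
      _ ≤ ε := div_le_self hε.le (by nlinarith)

end ApplicationState

/-- A statistic of the outcome has the same mean in the market and in sequential deferred
acceptance. -/
lemma Market.expectation_eq_expect_final {n m : ℕ} (D : MeasureTheory.Measure ℝ≥0)
    [MeasureTheory.IsProbabilityMeasure D] {K : ℕ} (hK : K ≤ m) (L : ℕ) (f : ℕ → ℕ → ℝ) :
    Market.expectation D D n m (fun I => f (I.totalApplications K L) (I.numFirstChoice K L)) =
      𝔼 ω : (Fin n → Equiv.Perm (Fin m)) × (Fin m → Equiv.Perm (Fin n)),
        f (ApplicationState.final K L ω).numApplications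
          ((ApplicationState.final K L ω).numHeld L 0) := by
  rw [Market.expectation_eq_rankExpectation D _ fun I J hr hp => by
    rw [totalApplications_congr hr hp, numFirstChoice_congr hr hp], Market.rankExpectation,
    ← Finset.univ_product_univ, Finset.expect_product]
  refine Finset.expect_congr rfl fun r _ => Finset.expect_congr rfl fun ρ _ => ?_
  rw [← ApplicationState.totalApplications_ofRanks hK L (r, ρ),
    ← ApplicationState.numFirstChoice_ofRanks hK L (r, ρ)]

/-- For x ≥ n both g/n and g/x move by at most B/n, and the K-th power is K-Lipschitz on [0, 1]. So
a root for one reading nearly solves the equation for the other. -/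
lemma abs_consistencyDefect_sub_le {g h : ℝ → ℝ} {n x B : ℝ} (hn : 0 < n) (hx : n ≤ x) (K : ℕ)
    (hg0 : 0 ≤ g x / x) (hg1 : g x / x ≤ 1) (hh0 : 0 ≤ h x / x) (hh1 : h x / x ≤ 1)
    (hB : |g x - h x| ≤ B) :
    |consistencyDefect g n K x - consistencyDefect h n K x| ≤ (1 + K) * (B / n) := by
  have hx0 : 0 < x := hn.trans_le hx
  have hB0 : 0 ≤ B := (abs_nonneg _).trans hB
  have h1 : |g x / n - h x / n| ≤ B / n := by
    rw [← sub_div, abs_div, abs_of_pos hn]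
    gcongr
  have h2 : |g x / x - h x / x| ≤ B / n := by
    rw [← sub_div, abs_div, abs_of_pos hx0]
    gcongr
  have h3 : |(1 - g x / x) ^ K - (1 - h x / x) ^ K| ≤ K * (B / n) := by
    refine (abs_pow_sub_pow_le _ _ K).trans ?_
    rw [sub_sub_sub_cancel_left, abs_sub_comm, abs_of_nonneg (by linarith : 0 ≤ 1 - g x / x),
      abs_of_nonneg (by linarith : 0 ≤ 1 - h x / x)]
    have h4 : max (1 - g x / x) (1 - h x / x) ^ (K - 1) ≤ 1 :=
      pow_le_one₀ (le_max_of_le_left (by linarith)) (max_le (by linarith) (by linarith))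
    calc _ ≤ |g x / x - h x / x| * K * 1 := by gcongr
      _ ≤ B / n * K * 1 := by gcongr
      _ = _ := by ring
  have e : consistencyDefect g n K x - consistencyDefect h n K x =
      (g x / n - h x / n) + ((1 - g x / x) ^ K - (1 - h x / x) ^ K) := by
    unfold consistencyDefect; ring
  rw [e]
  refine (abs_add_le _ _).trans ?_
  linarith

lemma abs_accepted_sub_acceptedPoisson_le {g : ℕ → ℕ → ℝ → ℝ}
    (hg : g = acceptedExact ∨ g = acceptedPoisson) {K L n m : ℕ} (hL : 1 ≤ L) (hn : 1 ≤ n)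
    (hm1 : 1 ≤ m) {M : ℝ} (hM : 0 < M) (hm : (m : ℝ) = M * n) {x : ℝ} (hx0 : 0 ≤ x)
    (hx : x ≤ n * K) :
    |g m L x - acceptedPoisson m L x| ≤ 2 * L ^ 2 * (K / M) + 2 := by
  rcases hg with rfl | rfl
  · refine (abs_acceptedExact_sub_acceptedPoisson_le hm1 hL hx0).trans ?_
    gcongr 2 * L ^ 2 * ?_ + 2
    rw [hm, div_le_div_iff₀ (by positivity) hM]
    nlinarith
  · rw [sub_self, abs_zero]; positivity

lemma isAcceptanceCurve_accepted {g : ℕ → ℕ → ℝ → ℝ}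
    (hg : g = acceptedExact ∨ g = acceptedPoisson) {L m : ℕ} (hL : 1 ≤ L) (hm1 : 1 ≤ m) :
    IsAcceptanceCurve (g m L) := by
  rcases hg with rfl | rfl
  · exact isAcceptanceCurve_acceptedExact hm1 hL
  · exact isAcceptanceCurve_acceptedPoisson hm1 hL

end

/-! ### Concentration around the limiting root and the main theorem. -/

noncomputable section
open scoped BigOperators

/-- Common data of the large market limit: the limiting number `τ` of applications per student,
and bounds on the distance from it. -/
lemma exists_limit {L K : ℕ} (hL : 1 ≤ L) (hK : 1 ≤ K) {M : ℝ} (hM : 0 < M) :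
    ∃ τ : ℝ, 0 < τ ∧ ∀ δ : ℝ, 0 < δ → ∃ C, 0 ≤ C ∧ ∀ t ∈ Set.Icc (1 : ℝ) K,
      |t - τ| + |limitCurve M L t / t - limitCurve M L τ / τ| ≤
        δ + C * |consistencyDefect (limitCurve M L) 1 K t| := by
  have hG := isAcceptanceCurve_limitCurve hL hM
  obtain ⟨τ, hτ, h0⟩ := hG.exists_consistencyDefect_eq_zero one_pos hK
  have hsub : Set.Icc (1 : ℝ) K ⊆ Set.Ioi 0 := fun t ht => one_pos.trans_le ht.1
  refine ⟨τ, hτ, fun δ hδ => isCompact_Icc.exists_le_add_mul_abs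
    (φ := fun t => |t - τ| + |limitCurve M L t / t - limitCurve M L τ / τ|)
    ((hG.continuousOn_consistencyDefect 1 K).mono hsub) ?_ (fun t ht ht0 => ?_) hδ⟩
  · have h1 : ContinuousOn (fun t => limitCurve M L t / t) (Set.Icc (1 : ℝ) K) :=
      (hG.cont.mono hsub).div continuousOn_id fun t ht => ne_of_gt (hsub ht)
    exact (continuousOn_id.sub continuousOn_const).abs.add (h1.sub continuousOn_const).abs
  · have : t = τ := (hG.consistencyDefect_strictMonoOn one_pos hK).injOn (hsub ht) hτ
      (ht0.trans h0.symm)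
    simp [this]

lemma abs_expect_sub_le {ι : Type*} [Fintype ι] [Nonempty ι] (f : ι → ℝ) (c : ℝ) :
    |(𝔼 i, f i) - c| ≤ 𝔼 i, |f i - c| := by
  rw [show (𝔼 i, f i) - c = 𝔼 i, (f i - c) by
    rw [Finset.expect_sub_distrib, Finset.expect_const Finset.univ_nonempty]]
  exact abs_le.2 ⟨by
    rw [← Finset.expect_neg_distrib]
    exact Finset.expect_le_expect fun i _ => neg_abs_le _,
    Finset.expect_le_expect fun i _ => le_abs_self _⟩

/-- Markov's inequality. -/
lemma expect_ite_lt_le {ι : Type*} [Fintype ι] {f : ι → ℝ} (hf : ∀ i, 0 ≤ f i) {ε B : ℝ}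
    (hε : 0 < ε) (hB : 𝔼 i, f i ≤ B) [∀ i, Decidable (ε < f i)] :
    (𝔼 i, if ε < f i then (1 : ℝ) else 0) ≤ B / ε := by
  rw [le_div_iff₀ hε, Finset.expect_mul]
  refine (Finset.expect_le_expect fun i _ => ?_).trans hB
  split_ifs with h
  · linarith
  · simpa using hf i

open ApplicationState in
/-- Estimates in a large market, for one accuracy. -/
lemma eventually_large_market {K L : ℕ} (hK : 1 ≤ K) (hL : 1 ≤ L) {M : ℝ} (hM : 0 < M)
    {g : ℕ → ℕ → ℝ → ℝ} (hg : g = acceptedExact ∨ g = acceptedPoisson) {κ : ℝ} (hκ : 0 < κ) :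
    ∃ N : ℕ, ∀ n m : ℕ, N ≤ n → (m : ℝ) = M * n → 1 ≤ n ∧ K ≤ m ∧
      ∀ x : ℝ, IsConsistent (g m L) n K x → ∀ X : ℝ,
        X = (𝔼 ω : (Fin n → Equiv.Perm (Fin m)) × (Fin m → Equiv.Perm (Fin n)),
          ((final K L ω).numApplications : ℝ)) →
        |X - x| ≤ 2 * κ * n ∧ ∀ y : ℝ, (y = x ∨ y = X) →
          (𝔼 ω : (Fin n → Equiv.Perm (Fin m)) × (Fin m → Equiv.Perm (Fin n)),
            |((final K L ω).numHeld L 0 : ℝ) / n - g m L y / y|) ≤ 3 * κ := by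
  have hG := isAcceptanceCurve_limitCurve hL hM
  obtain ⟨τ, hτ, hC⟩ := exists_limit hL hK hM
  have hK1 : (1 : ℝ) ≤ K := by exact_mod_cast hK
  have hcont : ContinuousAt (fun t => limitCurve M L t / t) τ :=
    ((hG.cont.div continuousOn_id fun t ht => ne_of_gt ht).continuousAt (Ioi_mem_nhds hτ))
  obtain ⟨δ₁, hδ₁, hcont⟩ := Metric.continuousAt_iff.1 hcont κ hκ
  -- Points within 2δ of τ are in the range δ₁ of continuity, and δ/(C+1) + 2δ ≤ κ.
  set δ := min (κ / 4) (δ₁ / 4) with hδ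
  have hδ0 : 0 < δ := lt_min (by linarith) (by linarith)
  have hδκ : δ ≤ κ / 4 := min_le_left _ _
  have hδδ : δ ≤ δ₁ / 4 := min_le_right _ _
  obtain ⟨C, hC0, hC⟩ := hC δ hδ0
  obtain ⟨N₁, hN₁⟩ := exists_expect_errors_le L K hK hL hM (ε := δ / (C + 1)) (by positivity)
  set C₀ : ℝ := 2 * L ^ 2 * (K / M) + 2 with hC₀
  have hC₀0 : 0 ≤ C₀ := by positivity
  -- N₂ makes the O(1) gap between the readings of g negligible in the defect; N₃ ensures that lists
  -- have at least K entries.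
  obtain ⟨N₂, hN₂⟩ := exists_nat_ge (C₀ / (δ / (C + 1) / (1 + K)))
  obtain ⟨N₃, hN₃⟩ := exists_nat_ge (K / M)
  refine ⟨N₁ + N₂ + N₃ + 1, fun n m hN hm => ?_⟩
  have hn : 1 ≤ n := by omega
  have hn0 : (0 : ℝ) < n := by exact_mod_cast hn
  have hKm : K ≤ m := by
    have h1 : (N₃ : ℝ) ≤ n := by exact_mod_cast (by omega : N₃ ≤ n)
    have h2 := hN₃.trans h1
    rw [div_le_iff₀ hM] at h2
    have : (K : ℝ) ≤ m := by rw [hm]; linarith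
    exact_mod_cast this
  have hm1 : 1 ≤ m := hK.trans hKm
  refine ⟨hn, hKm, fun x hx X hX => ?_⟩
  have hCδ : C * (δ / (C + 1)) ≤ δ := by
    rw [mul_div_assoc', div_le_iff₀ (by positivity)]; nlinarith
  have hsmall : (1 + K) * (C₀ / n) ≤ δ / (C + 1) := by
    have h1 : (N₂ : ℝ) ≤ n := by exact_mod_cast (by omega : N₂ ≤ n)
    have h2 := hN₂.trans h1
    rw [div_le_iff₀ (by positivity)] at h2
    rw [mul_div_assoc', div_le_iff₀ hn0]
    calc (1 + K) * C₀ ≤ (1 + K) * (n * (δ / (C + 1) / (1 + K))) := by gcongr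
      _ = _ := by field_simp
  have hsmall' : C₀ / n ≤ κ := by
    have h1 : δ / (C + 1) ≤ δ := div_le_self hδ0.le (by linarith)
    have h2 : 0 ≤ C₀ / n := by positivity
    nlinarith
  have hcurve := isAcceptanceCurve_accepted hg hL hm1
  have hcurveP := isAcceptanceCurve_acceptedPoisson hm1 hL
  obtain ⟨hx0, hxz⟩ := isConsistent_iff.1 hx
  have hxI := hcurve.mem_Icc_of_consistencyDefect_eq_zero hn0 hK hx0 hxz
  have hscale : ∀ y : ℝ, n ≤ y ∧ y ≤ n * K → y / n ∈ Set.Icc (1 : ℝ) K := fun y hy =>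
    ⟨by rw [le_div_iff₀ hn0]; linarith [hy.1], by rw [div_le_iff₀ hn0]; linarith [hy.2]⟩
  -- x has defect zero for g, hence a small one for the Poisson form, hence x/n is near τ.
  have hxτ : |x / n - τ| ≤ 2 * δ := by
    have h1 := hC _ (hscale x hxI)
    have h2 : |consistencyDefect (limitCurve M L) 1 K (x / n)| ≤ δ / (C + 1) := by
      rw [consistencyDefect_limitCurve hn hm]
      have h3 := abs_consistencyDefect_sub_le hn0 hxI.1 K (hcurve.div_pos hx0).le
        (hcurve.div_le_one hx0) (hcurveP.div_pos hx0).le (hcurveP.div_le_one hx0)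
        (abs_accepted_sub_acceptedPoisson_le hg hL hn hm1 hM hm hx0.le hxI.2)
      rw [hxz, zero_sub, abs_neg] at h3
      exact h3.trans hsmall
    have h3 := mul_le_mul_of_nonneg_left h2 hC0
    have h4 := abs_nonneg (limitCurve M L (x / n) / (x / n) - limitCurve M L τ / τ)
    linarith
  obtain ⟨hE1, hE2⟩ := hN₁ n m (by omega) hn hKm hm
  have hT := fun ω : (Fin n → Equiv.Perm (Fin m)) × (Fin m → Equiv.Perm (Fin n)) =>
    (valid_final hKm L ω).numApplications_mem_Icc (not_active_final hKm L ω) hK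
  have hT' : ∀ ω : (Fin n → Equiv.Perm (Fin m)) × (Fin m → Equiv.Perm (Fin n)),
      (n : ℝ) ≤ (final K L ω).numApplications ∧ ((final K L ω).numApplications : ℝ) ≤ n * K :=
    fun ω => ⟨by exact_mod_cast (hT ω).1, by exact_mod_cast (hT ω).2⟩
  have hmean : (𝔼 ω : (Fin n → Equiv.Perm (Fin m)) × (Fin m → Equiv.Perm (Fin n)),
      (|((final K L ω).numApplications : ℝ) / n - τ| +
        |limitCurve M L ((final K L ω).numApplications / n) /
          ((final K L ω).numApplications / n) - limitCurve M L τ / τ|)) ≤ 2 * δ := by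
    calc _ ≤ 𝔼 ω : (Fin n → Equiv.Perm (Fin m)) × (Fin m → Equiv.Perm (Fin n)),
          (δ + C * |consistencyDefect (limitCurve M L) 1 K ((final K L ω).numApplications / n)|) :=
          Finset.expect_le_expect fun ω _ => hC _ (hscale _ (hT' ω))
      _ = δ + C * 𝔼 ω : (Fin n → Equiv.Perm (Fin m)) × (Fin m → Equiv.Perm (Fin n)),
          |consistencyDefect (limitCurve M L) 1 K ((final K L ω).numApplications / n)| := by
          rw [Finset.expect_add_distrib, Finset.expect_const Finset.univ_nonempty,
            ← Finset.mul_expect]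
      _ ≤ δ + C * (δ / (C + 1)) := by gcongr
      _ ≤ 2 * δ := by linarith
  rw [Finset.expect_add_distrib] at hmean
  have hXn : X / n = 𝔼 ω : (Fin n → Equiv.Perm (Fin m)) × (Fin m → Equiv.Perm (Fin n)),
      ((final K L ω).numApplications : ℝ) / n := by
    rw [hX, Finset.expect_div]
  have hq0 : 0 ≤ 𝔼 ω : (Fin n → Equiv.Perm (Fin m)) × (Fin m → Equiv.Perm (Fin n)),
      |limitCurve M L ((final K L ω).numApplications / n) /
          ((final K L ω).numApplications / n) - limitCurve M L τ / τ| :=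
    Finset.expect_nonneg fun _ _ => abs_nonneg _
  have ht0 : 0 ≤ 𝔼 ω : (Fin n → Equiv.Perm (Fin m)) × (Fin m → Equiv.Perm (Fin n)),
      |((final K L ω).numApplications : ℝ) / n - τ| :=
    Finset.expect_nonneg fun _ _ => abs_nonneg _
  have hXτ : |X / n - τ| ≤ 2 * δ := by
    rw [hXn]
    exact (abs_expect_sub_le _ _).trans (by linarith)
  have hXI : (n : ℝ) ≤ X ∧ X ≤ n * K := by
    rw [hX]
    exact ⟨Finset.le_expect Finset.univ_nonempty fun ω _ => (hT' ω).1,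
      Finset.expect_le Finset.univ_nonempty fun ω _ => (hT' ω).2⟩
  constructor
  · have h1 : |X / n - x / n| ≤ 2 * κ := by
      rw [abs_le] at hXτ hxτ ⊢
      constructor <;> linarith [hXτ.1, hXτ.2, hxτ.1, hxτ.2]
    rwa [← sub_div, abs_div, abs_of_pos hn0, div_le_iff₀ hn0] at h1
  · intro y hy
    have hyI : (n : ℝ) ≤ y ∧ y ≤ n * K := by rcases hy with rfl | rfl <;> assumption
    have hyτ : |y / n - τ| ≤ 2 * δ := by rcases hy with rfl | rfl <;> assumption
    have hy0 : 0 < y := hn0.trans_le hyI.1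
    have h1 : |limitCurve M L (y / n) / (y / n) - limitCurve M L τ / τ| ≤ κ := by
      have := hcont (x := y / n) (by rw [Real.dist_eq]; linarith)
      rw [Real.dist_eq] at this
      exact this.le
    have h2 : |g m L y / y - limitCurve M L (y / n) / (y / n)| ≤ κ := by
      rw [limitCurve_div hn hm, ← sub_div, abs_div, abs_of_pos hy0]
      refine le_trans ?_ hsmall'
      exact div_le_div₀ hC₀0
        (abs_accepted_sub_acceptedPoisson_le hg hL hn hm1 hM hm hy0.le hyI.2) hn0 hyI.1
    -- The comparison runs through the rate at the random load, the rate at τ, and the limiting rate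
    -- at y/n; the last two passages, from τ to y, cost κ each.
    calc _ ≤ 𝔼 ω : (Fin n → Equiv.Perm (Fin m)) × (Fin m → Equiv.Perm (Fin n)),
          (|((final K L ω).numHeld L 0 : ℝ) / n -
            limitCurve M L ((final K L ω).numApplications / n) /
              ((final K L ω).numApplications / n)| +
            |limitCurve M L ((final K L ω).numApplications / n) /
              ((final K L ω).numApplications / n) - limitCurve M L τ / τ| + 2 * κ) := by
          refine Finset.expect_le_expect fun ω _ => ?_
          refine (abs_sub_le _ (limitCurve M L ((final K L ω).numApplications / n) /
              ((final K L ω).numApplications / n)) _).trans ?_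
          rw [add_assoc]
          refine add_le_add_right ?_ _
          refine (abs_sub_le _ (limitCurve M L τ / τ) _).trans (add_le_add_right ?_ _)
          rw [abs_sub_comm]
          refine (abs_sub_le _ (limitCurve M L (y / n) / (y / n)) _).trans ?_
          linarith
      _ ≤ δ / (C + 1) + 2 * δ + 2 * κ := by
          rw [Finset.expect_add_distrib, Finset.expect_add_distrib,
            Finset.expect_const Finset.univ_nonempty]
          linarith
      _ ≤ 3 * κ := by
          have : δ / (C + 1) ≤ δ := div_le_self hδ0.le (by linarith)
          linarith

theorem mainTheorem5 (D D' : MeasureTheory.Measure ℝ≥0)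
    [MeasureTheory.IsProbabilityMeasure D] [MeasureTheory.IsProbabilityMeasure D']
    (hDD' : D = D') (K L : ℕ) (hK : 1 ≤ K) (hL : 1 ≤ L) (M : ℝ) (hM : 0 < M)
    (g : ℕ → ℕ → ℝ → ℝ) (hg : g = acceptedExact ∨ g = acceptedPoisson) :
    (∀ n m : ℕ, 1 ≤ n → (m : ℝ) = M * n → ∃! x : ℝ, IsConsistent (g m L) n K x) ∧
    ∀ ε : ℝ, 0 < ε → ∀ᶠ n : ℕ in Filter.atTop, ∀ m : ℕ, (m : ℝ) = M * n →
      ∀ x : ℝ, IsConsistent (g m L) n K x →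
        |Market.expectation D D' n m (fun I => (I.totalApplications K L : ℝ)) - x| ≤ ε * n ∧
        ∀ y : ℝ,
          (y = x ∨ y = Market.expectation D D' n m (fun I => (I.totalApplications K L : ℝ))) →
          |Market.expectation D D' n m (fun I => (I.numFirstChoice K L : ℝ) / n)
              - g m L y / y| ≤ ε ∧
          Market.probability D D' n m
            (fun I => ε < |(I.numFirstChoice K L : ℝ) / n - g m L y / y|) ≤ ε := by
  subst hDD'
  refine ⟨fun n m hn hm => ?_, fun ε hε => ?_⟩
  · have hm1 : 1 ≤ m := by
      have : (0 : ℝ) < m := by rw [hm]; positivity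
      exact_mod_cast this
    exact (isAcceptanceCurve_accepted hg hL hm1).existsUnique_isConsistent hn hK
  -- ε/3 serves the expectations; ε²/3 gives 3κ/ε ≤ ε after Markov's inequality.
  · set κ := min (ε / 3) (ε ^ 2 / 3) with hκ
    have hκ0 : 0 < κ := lt_min (by positivity) (by positivity)
    have hκ1 : κ ≤ ε / 3 := min_le_left _ _
    have hκ2 : κ ≤ ε ^ 2 / 3 := min_le_right _ _
    obtain ⟨N, hN⟩ := eventually_large_market hK hL hM hg hκ0
    refine Filter.eventually_atTop.2 ⟨N, fun n hn m hm x hx => ?_⟩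
    obtain ⟨hn1, hKm, h⟩ := hN n m hn hm
    have hX := Market.expectation_eq_expect_final (n := n) D hKm L fun T _ => (T : ℝ)
    obtain ⟨h1, h2⟩ := h x hx _ hX
    have hn0 : (0 : ℝ) < n := by exact_mod_cast hn1
    refine ⟨h1.trans (by nlinarith), fun y hy => ?_⟩
    have h3 := h2 y hy
    constructor
    · rw [Market.expectation_eq_expect_final (n := n) D hKm L fun _ H => (H : ℝ) / n]
      exact (abs_expect_sub_le _ _).trans (h3.trans (by linarith))
    · classical
      rw [Market.probability, Market.expectation_eq_expect_final (n := n) D hKm L fun _ H =>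
        if ε < |(H : ℝ) / n - g m L y / y| then (1 : ℝ) else 0]
      refine (expect_ite_lt_le (fun _ => abs_nonneg _) hε h3).trans ?_
      rw [div_le_iff₀ hε]
      linarith

end
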